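/- **Theorem (sums of affine powers with different nodes).** For a field $\mathbb F$ of characteristic $0$ and $f\in\mathbb F[x]$, let $\mathrm{AffPow}_{\mathbb F}(f)$ be the least $s$ such that $f=\sum_{i=1}^s\alpha_i(x-a_i)^{e_i}$ for some $\alpha_i,a_i\in\mathbb F$ and $e_i\in\mathbb N$. An $\mathrm{SDE}(k,0)$ is an equation $\sum_{i=0}^kP_i(x)\,g^{(i)}(x)=0$ in the unknown $g$, where $P_0,\dots,P_k\in\mathbb F[x]$ are not all zero and $\deg P_i\le i$. Let $f=\sum_{i=1}^s\alpha_i(x-a_i)^{e_i}$ with $a_1,\dots,a_s\in\mathbb F$ distinct, $\alpha_i\in\mathbb F\setminus\{0\}$ and $e_i\in\mathbb N$. Assume that $n_i\le(3i/4)^{1/3}-1$ for all integers $i\ge2$, where $n_i=\#\{j: e_j\le i\}$. Then: 1. $\mathrm{AffPow}_{\mathbb F}(f)=s$. 2. The following recursive algorithm $\mathtt{Build}(f)$ outputs exactly the triples $(\alpha_i,a_i,e_i)$, $1\le i\le s$. Whatever admissible choices are made (of the SDE in Step 1, of the order among solutions of equal exponent in Step 2, of $r$ in Step 3), the objects asked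 for in every step exist, the set in Step 2 is finite, and the algorithm stops after at most $s$ passes. $\mathtt{Build}(0)$ outputs nothing; for $f\ne0$, a pass is: - Step 1. Let $t$ be the least integer such that $f$ satisfies an $\mathrm{SDE}(t,0)$, and take one such SDE. - Step 2. List the pairs $(b_1,d_1),\dots,(b_l,d_l)$ such that $(x-b)^{d}$ satisfies the SDE and $\frac{(t+1)^2}2\le d\le\deg f+\frac{(\deg f+2)^2}8$, each of them once, with $d_1\ge\dots\ge d_l$; put $d_{l+1}:=\frac{(t+1)^2}2$. - Step 3. Take $r\in\{1,\dots,l\}$ with $d_r-d_{r+1}>r^2/2$ and $d_{r+1}<\deg f$. - Step 4. Put $j:=\lceil d_r-r^2/2\rceil$ and find $\beta_1,\dots,\beta_r\in\mathbb F$ with $f^{(j)}=\sum_{i=1}^r\beta_i\frac{d_i!}{(d_i-j)!}(x-b_i)^{d_i-j}$. - Step 5. Output the triples $(\beta_i,b_i,d_i)$ with $i\le r$, $\beta_i\ne0$, followed by the output of $\mathtt{Build}(h)$, where $h:=f-\sum_{i=1}^r\beta_i(x-b_i)^{d_i}$. 3. $\mathtt{Build}$ runs in polynomial time: there are one program and one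 polynomial $q$, independent of $\mathbb F$, $f$ and $s$, such that for every $f$ as above, the program, on input the dense representation of $f$ (the list of its $\deg f+1$ coefficients, $\deg f$ being read as $0$ if $f=0$), halts after at most $q(\deg f+1)$ steps, and its output is the list of triples $(\alpha_i,a_i,e_i)$, in some order, as output by a run of $\mathtt{Build}(f)$. Programs compute with trees (nested pairs) whose leaves are $\mathrm{nil}$ or elements of $\mathbb F$; their only constants are $\mathrm{nil}$, $0$ and $1$; natural numbers are written in unary. A step is an arithmetic operation in $\mathbb F$, an equality test in $\mathbb F$, or an elementary operation on trees and variables. A program may also ask for the list of the roots in $\mathbb F$ (each once, in an arbitrary order) of a nonzero polynomial of degree at most $\max(2s-1,0)$ given by a list of at most $\max(2s-1,0)+1$ coefficients, at a cost of one step plus the number of these coefficients. -/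

import Mathlib

open Polynomial

universe u

namespace AffinePowers

/-! ### Sums of affine powers -/

section Polynomials

variable {F : Type u} [Field F]

/-- The sum `∑ α i * (X - a i) ^ e i`. -/
noncomputable def affineSum {s : ℕ} (α a : Fin s → F) (e : Fin s → ℕ) : F[X] :=
  ∑ i, C (α i) * (X - C (a i)) ^ e i

/-- The least number of terms in an expression of `f` as a linear combination of powers
`(X - a) ^ e` with `a` in `F` (every polynomial has such an expression, with `a = 0`). -/
noncomputable def affPow (f : F[X]) : ℕ :=
  sInf {s : ℕ | ∃ (α a : Fin s → F) (e : Fin s → ℕ), f = affineSum α a e}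

/-! ### Shifted differential equations -/

/-- `P 0, …, P k` are the coefficients of a (nontrivial) shifted differential equation of order `k`
and shift `l`, that is of `∑_{i ≤ k} P i * g⁽ⁱ⁾ = 0` with `deg (P i) ≤ i + l`. -/
def IsSDE (k l : ℕ) (P : ℕ → F[X]) : Prop :=
  (∃ i ≤ k, P i ≠ 0) ∧ ∀ i ≤ k, (P i).natDegree ≤ i + l

/-- `g` satisfies the differential equation `∑_{i ≤ k} P i * g⁽ⁱ⁾ = 0`. -/
def Satisfies (k : ℕ) (P : ℕ → F[X]) (g : F[X]) : Prop :=
  ∑ i ∈ Finset.range (k + 1), P i * derivative^[i] g = 0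

/-! ### The recursive algorithm

The choices that the algorithm leaves open (which equation of least order, in which order the
solutions of equal exponent are listed, which index `r`) are arguments of the definitions. -/

/-- Step 1: an equation of shift `0` satisfied by `f`, whose order `t` is the least possible. -/
def IsMinimalSDE (f : F[X]) (t : ℕ) (P : ℕ → F[X]) : Prop :=
  IsSDE t 0 P ∧ Satisfies t P f ∧
    ∀ (k : ℕ) (Q : ℕ → F[X]), IsSDE k 0 Q → Satisfies k Q f → t ≤ k

/-- Step 2: the pairs `(b, e)` in the prescribed range of exponents such that `(X - b) ^ e`
satisfies the equation. -/
def affineSolutions (f : F[X]) (t : ℕ) (P : ℕ → F[X]) : Set (F × ℕ) :=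
  {p | ((t : ℚ) + 1) ^ 2 / 2 ≤ p.2 ∧
    (p.2 : ℚ) ≤ f.natDegree + ((f.natDegree : ℚ) + 2) ^ 2 / 8 ∧
    Satisfies t P ((X - C p.1) ^ p.2)}

/-- Step 2: `(b 1, d 1), …, (b l, d l)` lists the elements of `S`, each of them once, by
decreasing exponent. -/
def IsListing (S : Set (F × ℕ)) (l : ℕ) (b : ℕ → F) (d : ℕ → ℕ) : Prop :=
  Set.BijOn (fun i => (b i, d i)) (Set.Icc 1 l) S ∧ AntitoneOn d (Set.Icc 1 l)

/-- The exponents `d 1, …, d l`, followed by the sentinel `(t + 1) ^ 2 / 2` at index `l + 1`. -/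
def exponentAt (t l : ℕ) (d : ℕ → ℕ) (i : ℕ) : ℚ :=
  if i ≤ l then (d i : ℚ) else ((t : ℚ) + 1) ^ 2 / 2

/-- Step 3: an index `r` at which the exponents drop sufficiently. -/
def IsCut (f : F[X]) (t l : ℕ) (d : ℕ → ℕ) (r : ℕ) : Prop :=
  1 ≤ r ∧ r ≤ l ∧
    (r : ℚ) ^ 2 / 2 < exponentAt t l d r - exponentAt t l d (r + 1) ∧
    exponentAt t l d (r + 1) < f.natDegree

/-- Step 4: the order of differentiation, `d r - r ^ 2 / 2` rounded up to an integer. -/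
def cutOrder (d : ℕ → ℕ) (r : ℕ) : ℕ := ⌈(d r : ℚ) - (r : ℚ) ^ 2 / 2⌉₊

/-- Step 4: `f⁽ʲ⁾ = ∑_{i ≤ r} β i * (d i)! / (d i - j)! * (X - b i) ^ (d i - j)`, where `j` is the
order of differentiation. -/
def IsExpression (f : F[X]) (b : ℕ → F) (d : ℕ → ℕ) (r : ℕ) (β : ℕ → F) : Prop :=
  derivative^[cutOrder d r] f =
    ∑ i ∈ Finset.Icc 1 r, C (β i * ((d i).descFactorial (cutOrder d r) : F)) *
      (X - C (b i)) ^ (d i - cutOrder d r)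

open Classical in
/-- Step 5: the triples `(β i, b i, d i)` with `1 ≤ i ≤ r` and `β i ≠ 0`. -/
noncomputable def extracted (b : ℕ → F) (d : ℕ → ℕ) (r : ℕ) (β : ℕ → F) : List (F × F × ℕ) :=
  ((List.range' 1 r).filter fun i => decide (β i ≠ 0)).map fun i => (β i, b i, d i)

/-- Step 5: what remains of `f`, the polynomial `h = f - ∑_{i ≤ r} β i * (X - b i) ^ d i`. -/
noncomputable def remainder (f : F[X]) (b : ℕ → F) (d : ℕ → ℕ) (r : ℕ) (β : ℕ → F) : F[X] :=
  f - ∑ i ∈ Finset.Icc 1 r, C (β i) * (X - C (b i)) ^ d i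

/-- One pass of the algorithm on `f` (for some admissible choices) outputs the triples `A` and
leaves `h`. -/
def BuildPass (f : F[X]) (A : List (F × F × ℕ)) (h : F[X]) : Prop :=
  ∃ (t : ℕ) (P : ℕ → F[X]) (l : ℕ) (b : ℕ → F) (d : ℕ → ℕ) (r : ℕ) (β : ℕ → F),
    IsMinimalSDE f t P ∧ IsListing (affineSolutions f t P) l b d ∧ IsCut f t l d r ∧
    IsExpression f b d r β ∧ A = extracted b d r β ∧ h = remainder f b d r β

/-- A pass on `f` never gets stuck: whatever choices have been made so far, the objects which the
next step asks for exist. In particular the set of solutions in Step 2 is finite. -/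
def NeverStuck (f : F[X]) : Prop :=
  (∃ t P, IsMinimalSDE f t P) ∧ ∀ t P, IsMinimalSDE f t P →
    (∃ l b d, IsListing (affineSolutions f t P) l b d) ∧
    ∀ l b d, IsListing (affineSolutions f t P) l b d →
      (∃ r, IsCut f t l d r) ∧ ∀ r, IsCut f t l d r → ∃ β, IsExpression f b d r β

/-- `BuildRun f L`: some run of the algorithm on `f` outputs the list of triples `L`. -/
inductive BuildRun : F[X] → List (F × F × ℕ) → Prop
  | done : BuildRun 0 []
  | pass {f h : F[X]} {A L : List (F × F × ℕ)} :
      f ≠ 0 → BuildPass f A h → BuildRun h L → BuildRun f (A ++ L)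

/-- `BuildsTo n f T`: whatever the choices, the algorithm on `f` never gets stuck, stops after at
most `n` passes, and outputs exactly the triples in `T` (with multiplicity, in some order). -/
def BuildsTo : ℕ → F[X] → Multiset (F × F × ℕ) → Prop
  | 0, f, T => f = 0 ∧ T = 0
  | n + 1, f, T =>
      (f = 0 ∧ T = 0) ∨
      (f ≠ 0 ∧ NeverStuck f ∧
        ∀ A h, BuildPass f A h → ∃ T', T = (A : Multiset (F × F × ℕ)) + T' ∧ BuildsTo n h T')

end Polynomials

/-! ### The model of computation

A first-order language of programs on binary trees whose leaves are `nil` or elements of the field.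
Every operation has unit cost, except root finding, which is also charged for reading its input. -/

/-- The data of a program: `nil`, field elements, and ordered pairs (held by reference). -/
inductive Val (F : Type u) : Type u
  | nil : Val F
  | elt : F → Val F
  | cons : Val F → Val F → Val F

namespace Val

variable {F : Type u}

/-- A finite list as a tree. -/
def ofList : List (Val F) → Val F
  | [] => nil
  | v :: vs => cons v (ofList vs)

/-- A natural number in unary notation. -/
def ofNat (n : ℕ) : Val F := ofList (List.replicate n nil)

/-- A triple (coefficient, node, exponent). -/
def ofTriple (p : F × F × ℕ) : Val F := cons (elt p.1) (cons (elt p.2.1) (ofNat p.2.2))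

/-- The dense representation of `f`: its coefficients of degree `0, …, deg f`. -/
def ofPoly [Semiring F] (f : F[X]) : Val F :=
  ofList ((List.range (f.natDegree + 1)).map fun i => elt (f.coeff i))

end Val

/-- Programs, which do not depend on the field and whose only constants are `nil`, `0` and `1`. They
are evaluated in an environment, a list of values: `var n` is its entry number `n`. -/
inductive Prog : Type
  | var : ℕ → Prog
  | nil : Prog
  | zero : Prog
  | one : Prog
  | cons : Prog → Prog → Prog
  | fst : Prog → Prog
  | snd : Prog → Prog
  | add : Prog → Prog → Prog
  | sub : Prog → Prog → Prog
  | mul : Prog → Prog → Prog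
  | div : Prog → Prog → Prog
  /-- `ifEq p q a b`: if `p` and `q` give the same field element then `a` else `b`. -/
  | ifEq : Prog → Prog → Prog → Prog → Prog
  /-- `ifPair p a b`: if `p` gives a pair then `a` else `b`. -/
  | ifPair : Prog → Prog → Prog → Prog
  /-- `letIn p q`: evaluate `p`, put its value in front of the environment, evaluate `q`. -/
  | letIn : Prog → Prog → Prog
  /-- `loop c p`: while `c` gives a pair, replace entry number `0` of the environment by the value
  of `p`; the result is the final entry number `0`. -/
  | loop : Prog → Prog → Prog
  /-- The list of roots of the polynomial given by a list of coefficients. -/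
  | roots : Prog → Prog

section Semantics

variable {F : Type u} [Field F]

/-- The polynomial with a given list of coefficients, constant coefficient first. -/
noncomputable def polyOfList : List F → F[X]
  | [] => 0
  | c :: cs => C c + X * polyOfList cs

/-- `ρ` lists the roots in `F` of every nonzero polynomial, without repetition, in some order. -/
def IsRootFinder (ρ : F[X] → List F) : Prop :=
  ∀ p : F[X], p ≠ 0 → (ρ p).Nodup ∧ ∀ x, x ∈ ρ p ↔ p.IsRoot x

/-- `Eval ρ D env p v n`: in the environment `env`, the program `p` halts with the value `v` after
`n` steps, where roots are found by `ρ`, and only of nonzero polynomials of degree at most `D`.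
A program that applies an operation to data of a wrong kind, divides by `0`, or asks for the roots
of any other polynomial has no value. -/
inductive Eval (ρ : F[X] → List F) (D : ℕ) : List (Val F) → Prog → Val F → ℕ → Prop
  | var {env v} (i : ℕ) : env[i]? = some v → Eval ρ D env (.var i) v 1
  | nil {env} : Eval ρ D env .nil .nil 1
  | zero {env} : Eval ρ D env .zero (.elt 0) 1
  | one {env} : Eval ρ D env .one (.elt 1) 1
  | cons {env p q v w m n} : Eval ρ D env p v m → Eval ρ D env q w n →
      Eval ρ D env (.cons p q) (.cons v w) (m + n + 1)
  | fst {env p v w m} : Eval ρ D env p (.cons v w) m → Eval ρ D env (.fst p) v (m + 1)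
  | snd {env p v w m} : Eval ρ D env p (.cons v w) m → Eval ρ D env (.snd p) w (m + 1)
  | add {env p q x y m n} : Eval ρ D env p (.elt x) m → Eval ρ D env q (.elt y) n →
      Eval ρ D env (.add p q) (.elt (x + y)) (m + n + 1)
  | sub {env p q x y m n} : Eval ρ D env p (.elt x) m → Eval ρ D env q (.elt y) n →
      Eval ρ D env (.sub p q) (.elt (x - y)) (m + n + 1)
  | mul {env p q x y m n} : Eval ρ D env p (.elt x) m → Eval ρ D env q (.elt y) n →
      Eval ρ D env (.mul p q) (.elt (x * y)) (m + n + 1)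
  | div {env p q x y m n} : Eval ρ D env p (.elt x) m → Eval ρ D env q (.elt y) n → y ≠ 0 →
      Eval ρ D env (.div p q) (.elt (x / y)) (m + n + 1)
  | ifEq_true {env p q a b x v m n k} : Eval ρ D env p (.elt x) m → Eval ρ D env q (.elt x) n →
      Eval ρ D env a v k → Eval ρ D env (.ifEq p q a b) v (m + n + k + 1)
  | ifEq_false {env p q a b x y v m n k} : Eval ρ D env p (.elt x) m →
      Eval ρ D env q (.elt y) n → x ≠ y → Eval ρ D env b v k →
      Eval ρ D env (.ifEq p q a b) v (m + n + k + 1)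
  | ifPair_true {env p a b u w v m k} : Eval ρ D env p (.cons u w) m → Eval ρ D env a v k →
      Eval ρ D env (.ifPair p a b) v (m + k + 1)
  | ifPair_false {env p a b u v m k} : Eval ρ D env p u m → (∀ x y, u ≠ .cons x y) →
      Eval ρ D env b v k → Eval ρ D env (.ifPair p a b) v (m + k + 1)
  | letIn {env p q v w m n} : Eval ρ D env p v m → Eval ρ D (v :: env) q w n →
      Eval ρ D env (.letIn p q) w (m + n + 1)
  | loop_stop {env c p v u m} : Eval ρ D (v :: env) c u m → (∀ x y, u ≠ .cons x y) →
      Eval ρ D (v :: env) (.loop c p) v (m + 1)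
  | loop_step {env c p v x y v' w m n k} : Eval ρ D (v :: env) c (.cons x y) m →
      Eval ρ D (v :: env) p v' n → Eval ρ D (v' :: env) (.loop c p) w k →
      Eval ρ D (v :: env) (.loop c p) w (m + n + k + 1)
  | roots {env p m} (cs : List F) : Eval ρ D env p (Val.ofList (cs.map .elt)) m →
      cs.length ≤ D + 1 → polyOfList cs ≠ 0 →
      Eval ρ D env (.roots p) (Val.ofList ((ρ (polyOfList cs)).map .elt)) (m + cs.length + 1)

end Semantics

end AffinePowers

/-!
The proof rests on a Wronskian estimate, `order_le_of_minimal_relation`. In a minimal linear relation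
between `n + 1` polynomials, any `n` of them are independent and have the same Wronskian up to a
constant factor; if each polynomial vanishes to high order at its node, then this Wronskian, which is
nonzero and of controlled degree, is divisible by a high power of `X - z` for every node `z`.
Independent polynomials have a nonzero Wronskian because a differential equation of order `t` has at
most `t` independent polynomial solutions (`card_le_of_linearIndependent_of_diffOp_eq_zero`): their
degrees are roots of the indicial polynomial at infinity. Two consequences carry everything else: the
exponents in a relation between `r` affine powers are less than `r (r - 1) / 2`
(`exponent_le_of_relation`), and if a sum of affine powers with different nodes satisfies a shifted
differential equation, then the terms that do not satisfy it themselves have small exponents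
(`exponent_le_of_not_satisfies`).

The hypothesis on the numbers of small exponents is used in the form `IsSparse`, which passes to
every part of the sum. Let `f` be a sparse sum of `s` terms. Comparing it with another expression
gives a relation whose exponents are too large unless the other expression has at least `s` terms
(`IsSparse.card_le_of_eq_affineSum`). By counting dimensions, `f` satisfies an equation of order
`t < 2 s` (`exists_isSDE`); every term of large exponent satisfies it too (`IsSparse.satisfies`), and
the equation has at most `t` solutions in the range considered (`card_affineSolutions_le`). The largest
of their exponents is at least `deg f`, which exceeds the threshold so far that the exponents cannot
descend to it in at most `t` steps of size at most `r ^ 2 / 2` (`exists_drop`, `threshold_add_sum_lt`):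
there is a drop as required in Step 3. Above a drop, the listed powers are independent
modulo polynomials of degree less than `j` (`eq_zero_of_iterate_derivative_eq_zero`), so the
coefficients found are those of `f`, and a pass removes exactly the terms of exponent at least `j`,
among them one of largest exponent. Hence `IsSparse.buildsTo`. As the order of solutions of equal
exponent is free, every list of the terms by decreasing exponents is the output of some run
(`IsSparse.buildRun`).

For the complexity, `ev` evaluates programs functionally, with a bound `S` on the number of passes of
each loop; a program that `ev` evaluates runs in time polynomial in `S` (`eval_of_ev`). The program
`buildP` represents polynomials by vectors of `2 (deg f + 1)` coefficients. Gaussian elimination finds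
the least order for which the `X ^ k * f⁽ⁱ⁾` are dependent, and thereby an equation; the nodes of its
solutions are roots of its leading coefficient (`isRoot_of_satisfies`), which has degree less than
`2 s`. Instead of looking for a drop, a pass of the program takes solutions of large exponent and
removes those of least exponent, one by one, until `f` is a combination of the others in a unique way,
modulo lower degrees. Such a combination also consists of terms of `f`, and a drop guarantees that the
search ends in time (`IsSparse.exists_extr`). The passes of the program may thus differ from those of
the algorithm, but its output is a list of the terms by decreasing exponents
(`IsSparse.ev_buildP`), and therefore the output of a run.
-/

namespace AffinePowers

/-! ### Differential operators and Wronskians -/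

section Wronskian

variable {F : Type u} [Field F]

/-- The operator `∑_{i ≤ t} P i * D^i`, as an `F`-linear map. -/
noncomputable def diffOp (t : ℕ) (P : ℕ → F[X]) : F[X] →ₗ[F] F[X] :=
  ∑ i ∈ Finset.range (t + 1), LinearMap.mulLeft F (P i) ∘ₗ (derivative ^ i : Module.End F F[X])

theorem diffOp_apply (t : ℕ) (P : ℕ → F[X]) (g : F[X]) :
    diffOp t P g = ∑ i ∈ Finset.range (t + 1), P i * derivative^[i] g := by
  simp [diffOp, LinearMap.sum_apply, Module.End.pow_apply]

theorem satisfies_iff (t : ℕ) (P : ℕ → F[X]) (g : F[X]) :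
    Satisfies t P g ↔ diffOp t P g = 0 := by
  rw [diffOp_apply, Satisfies]

theorem coeff_X_pow_mul_iterate_derivative (g : F[X]) (i n : ℕ) :
    (X ^ i * derivative^[i] g).coeff n = (n.descFactorial i : F) * g.coeff n := by
  rw [coeff_X_pow_mul']
  split_ifs with h
  · rw [coeff_iterate_derivative, Nat.sub_add_cancel h, nsmul_eq_mul]
  · rw [Nat.descFactorial_of_lt (by omega)]; simp

/-- The degrees of the solutions of a differential equation of order `t` are roots of a nonzero
polynomial of degree at most `t`, the indicial polynomial at infinity. -/
theorem exists_indicial (t : ℕ) (P : ℕ → F[X]) (hP : ∃ i ≤ t, P i ≠ 0) :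
    ∃ χ : F[X], χ ≠ 0 ∧ χ.natDegree ≤ t ∧
      ∀ g : F[X], g ≠ 0 → diffOp t P g = 0 → χ.IsRoot (g.natDegree : F) := by
  classical
  -- After multiplication by `X ^ t`, the equation reads `∑ Q i * (X ^ i * g⁽ⁱ⁾) = 0`.
  set Q : ℕ → F[X] := fun i => P i * X ^ (t - i) with hQ
  set m := (Finset.range (t + 1)).sup fun i => (Q i).natDegree with hm
  have hle : ∀ i ∈ Finset.range (t + 1), (Q i).natDegree ≤ m := fun i hi =>
    Finset.le_sup (f := fun i => (Q i).natDegree) hi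
  obtain ⟨i₀, hi₀, hi₀'⟩ := Finset.exists_mem_eq_sup (Finset.range (t + 1))
    ⟨0, by simp⟩ fun i => (Q i).natDegree
  have hQ0 : ∃ i ∈ Finset.range (t + 1), (Q i).coeff m ≠ 0 := by
    by_cases h : Q i₀ = 0
    · obtain ⟨i, hi, hPi⟩ := hP
      have hi' : i ∈ Finset.range (t + 1) := by simp; omega
      have hQi : Q i ≠ 0 := mul_ne_zero hPi (pow_ne_zero _ X_ne_zero)
      refine ⟨i, hi', ?_⟩
      have h0 : m = 0 := by rw [hm, hi₀', h, natDegree_zero]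
      have h1 : (Q i).natDegree = m := le_antisymm (hle i hi') (by omega)
      rw [← h1]; exact leadingCoeff_ne_zero.2 hQi
    · refine ⟨i₀, hi₀, ?_⟩
      rw [hm, hi₀']; exact leadingCoeff_ne_zero.2 h
  set χ : F[X] := ∑ i ∈ Finset.range (t + 1), C ((Q i).coeff m) * descPochhammer F i with hχ
  have hdeg : ∀ i, (C ((Q i).coeff m) * descPochhammer F i).natDegree ≤ i := fun i =>
    (natDegree_C_mul_le _ _).trans (descPochhammer_natDegree F i).le
  refine ⟨χ, ?_, ?_, ?_⟩
  · -- The largest `i` with a nonzero coefficient gives the leading term.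
    obtain ⟨i, hi, hiQ⟩ := hQ0
    set S := (Finset.range (t + 1)).filter fun i => (Q i).coeff m ≠ 0 with hS
    have hSne : S.Nonempty := ⟨i, by simp [hS, hiQ]; simpa using hi⟩
    obtain ⟨hk1, hk2⟩ := Finset.mem_filter.1 (S.max'_mem hSne)
    set k := S.max' hSne
    intro h0
    have : χ.coeff k = (Q k).coeff m := by
      rw [hχ, finsetSum_coeff, Finset.sum_eq_single k]
      · rw [coeff_C_mul]
        have := (monic_descPochhammer F k).coeff_natDegree
        rw [descPochhammer_natDegree] at this
        rw [this, mul_one]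
      · intro j hj hjk
        rcases lt_or_gt_of_ne hjk with h | h
        · exact coeff_eq_zero_of_natDegree_lt ((hdeg j).trans_lt h)
        · have : (Q j).coeff m = 0 := by
            by_contra hne
            exact absurd (S.le_max' j (Finset.mem_filter.2 ⟨hj, hne⟩)) (not_le.2 h)
          simp [this]
      · intro h; exact absurd hk1 h
    rw [h0, coeff_zero] at this
    exact hk2 this.symm
  · refine natDegree_sum_le_of_forall_le _ _ fun i hi => (hdeg i).trans ?_
    simp at hi; omega
  · intro g hg hLg
    have h1 : ∑ i ∈ Finset.range (t + 1), Q i * (X ^ i * derivative^[i] g) = 0 := by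
      have : X ^ t * diffOp t P g = 0 := by rw [hLg, mul_zero]
      rw [diffOp_apply, Finset.mul_sum] at this
      rw [← this]
      refine Finset.sum_congr rfl fun i hi => ?_
      have hi' : t = (t - i) + i := by simp at hi; omega
      conv_rhs => rw [hi', pow_add]
      simp only [hQ]; ring
    have h2 := congrArg (fun p => p.coeff (m + g.natDegree)) h1
    simp only [finsetSum_coeff, coeff_zero] at h2
    have h3 : ∀ i ∈ Finset.range (t + 1),
        (Q i * (X ^ i * derivative^[i] g)).coeff (m + g.natDegree) =
          ((Q i).coeff m * (g.natDegree.descFactorial i : F)) * g.leadingCoeff := by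
      intro i hi
      rw [coeff_mul_add_eq_of_natDegree_le (hle i hi), coeff_X_pow_mul_iterate_derivative, mul_assoc]
      · rfl
      · refine natDegree_le_iff_coeff_eq_zero.2 fun n hn => ?_
        rw [coeff_X_pow_mul_iterate_derivative, coeff_eq_zero_of_natDegree_lt hn, mul_zero]
    rw [Finset.sum_congr rfl h3, ← Finset.sum_mul] at h2
    have h4 := (mul_eq_zero.1 h2).resolve_right (leadingCoeff_ne_zero.2 hg)
    rw [IsRoot.def, hχ, eval_finsetSum, ← h4]
    refine Finset.sum_congr rfl fun i _ => ?_
    rw [eval_mul, eval_C, descPochhammer_eval_eq_descFactorial]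

/-- A nontrivial differential equation of order `t` has at most `t` independent polynomial
solutions. -/
theorem card_le_of_linearIndependent_of_diffOp_eq_zero [CharZero F] {t n : ℕ} {P : ℕ → F[X]}
    (hP : ∃ i ≤ t, P i ≠ 0) {v : Fin n → F[X]} (hv : LinearIndependent F v)
    (hsol : ∀ i, diffOp t P (v i) = 0) : n ≤ t := by
  classical
  obtain ⟨χ, hχ0, hχt, hχ⟩ := exists_indicial t P hP
  set T : Set ℕ := {d | χ.IsRoot (d : F)} with hT
  have hTmap : Set.MapsTo (fun d : ℕ => (d : F)) T (χ.roots.toFinset : Set F) := by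
    intro d hd; simpa [hχ0, hT] using hd
  have hTfin : T.Finite :=
    Set.Finite.of_injOn hTmap (Nat.cast_injective.injOn) (Finset.finite_toSet _)
  have hTcard : hTfin.toFinset.card ≤ t := by
    refine (Finset.card_le_card_of_injOn (fun d : ℕ => (d : F)) ?_ Nat.cast_injective.injOn).trans
      ((Multiset.toFinset_card_le _).trans ((card_roots' χ).trans hχt))
    intro d hd
    have : d ∈ T := by simpa using hd
    exact hTmap this
  -- A solution is determined by its coefficients in the degrees that are roots of `χ`.
  let φ : F[X] →ₗ[F] (hTfin.toFinset → F) := LinearMap.pi fun d => lcoeff F d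
  have hinj : LinearIndependent F (φ ∘ v) := by
    refine hv.map ?_
    rw [Submodule.disjoint_def]
    intro g hg hg0
    by_contra hne
    have hgs : diffOp t P g = 0 := by
      have : Submodule.span F (Set.range v) ≤ LinearMap.ker (diffOp t P) := by
        rw [Submodule.span_le]; rintro _ ⟨i, rfl⟩; exact hsol i
      exact this hg
    have hroot := hχ g hne hgs
    have hmem : g.natDegree ∈ hTfin.toFinset := by simpa [hT] using hroot
    have := congrFun (LinearMap.mem_ker.1 hg0) ⟨_, hmem⟩
    exact leadingCoeff_ne_zero.2 hne this
  have := hinj.fintype_card_le_finrank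
  simp only [Fintype.card_fin, Module.finrank_fintype_fun_eq_card, Fintype.card_coe] at this
  omega

/-- The Wronskian matrix of a finite family of polynomials. -/
noncomputable def wronskiMatrix {n : ℕ} (g : Fin n → F[X]) : Matrix (Fin n) (Fin n) F[X] :=
  Matrix.of fun i j => derivative^[(j : ℕ)] (g i)

/-- A linear dependence between the columns is a differential equation of order less than `n` with `n`
independent solutions. -/
theorem det_wronskiMatrix_ne_zero [CharZero F] {n : ℕ} {g : Fin n → F[X]} (hg : LinearIndependent F g) :
    (wronskiMatrix g).det ≠ 0 := by
  intro h0
  obtain ⟨v, hv, hMv⟩ := Matrix.exists_mulVec_eq_zero_iff.2 h0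
  obtain ⟨k, hk⟩ := Function.ne_iff.1 hv
  obtain ⟨t, rfl⟩ : ∃ t, n = t + 1 := ⟨n - 1, by have := k.2; omega⟩
  have := card_le_of_linearIndependent_of_diffOp_eq_zero (t := t)
    (P := fun i => if h : i < t + 1 then v ⟨i, h⟩ else 0) ⟨k, by omega, by simpa [k.2] using hk⟩ hg ?_
  · omega
  · intro i
    have := congrFun hMv i
    rw [diffOp_apply, Finset.sum_range]
    simp only [Matrix.mulVec, dotProduct, wronskiMatrix, Matrix.of_apply, Pi.zero_apply] at this
    rw [← this]
    refine Finset.sum_congr rfl fun j _ => ?_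
    rw [dif_pos j.2, mul_comm]

theorem natDegree_iterate_derivative_add_le (g : F[X]) (k : ℕ) (h : derivative^[k] g ≠ 0) :
    (derivative^[k] g).natDegree + k ≤ g.natDegree := by
  have h1 := natDegree_iterate_derivative g k
  by_contra hlt
  refine h (iterate_derivative_eq_zero ?_)
  omega

/-- In every nonzero product of the Leibniz expansion, the `j`-th derivative lowers the degree by at
least `j`. -/
theorem natDegree_det_wronskiMatrix_le {n : ℕ} (g : Fin n → F[X])
    (h : (wronskiMatrix g).det ≠ 0) :
    (wronskiMatrix g).det.natDegree + ∑ i ∈ Finset.range n, i ≤ ∑ i, (g i).natDegree := by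
  have hperm : ∀ σ : Equiv.Perm (Fin n), (∏ i, wronskiMatrix g (σ i) i) ≠ 0 →
      (∏ i, wronskiMatrix g (σ i) i).natDegree + ∑ i ∈ Finset.range n, i ≤
        ∑ i, (g i).natDegree := by
    intro σ hσ
    rw [natDegree_prod _ _ (fun i _ => Finset.prod_ne_zero_iff.1 hσ i (Finset.mem_univ _)),
      Finset.sum_range, ← Finset.sum_add_distrib, ← Equiv.sum_comp σ fun i => (g i).natDegree]
    refine Finset.sum_le_sum fun i _ => natDegree_iterate_derivative_add_le _ _ ?_
    exact Finset.prod_ne_zero_iff.1 hσ i (Finset.mem_univ _)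
  have hex : ∃ σ : Equiv.Perm (Fin n), (∏ i, wronskiMatrix g (σ i) i) ≠ 0 := by
    by_contra! hall
    exact h (by rw [Matrix.det_apply]; simp [hall])
  obtain ⟨σ₀, hσ₀⟩ := hex
  have h0 := hperm σ₀ hσ₀
  have : (wronskiMatrix g).det.natDegree ≤ ∑ i, (g i).natDegree - ∑ i ∈ Finset.range n, i := by
    rw [Matrix.det_apply]
    refine natDegree_sum_le_of_forall_le _ _ fun σ _ => ?_
    refine (natDegree_smul_le _ _).trans ?_
    by_cases hσ : (∏ i, wronskiMatrix g (σ i) i) = 0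
    · simp [hσ]
    · have := hperm σ hσ; omega
  omega

theorem pow_dvd_iterate_derivative {g : F[X]} {a : F} {m k : ℕ} (h : (X - C a) ^ m ∣ g) :
    (X - C a) ^ (m - k) ∣ derivative^[k] g :=
  pow_sub_dvd_iterate_derivative_of_pow_dvd k h

theorem prod_dvd_det_wronskiMatrix {n : ℕ} (g : Fin n → F[X]) (k : Fin n → ℕ) (z : F)
    (h : ∀ i (j : Fin n), (X - C z) ^ k i ∣ derivative^[(j : ℕ)] (g i)) :
    (X - C z) ^ (∑ i, k i) ∣ (wronskiMatrix g).det := by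
  choose N hN using h
  have : wronskiMatrix g = Matrix.of fun i j => (X - C z) ^ k i * (Matrix.of N) i j := by
    ext1 i j; simp [wronskiMatrix, hN]
  rw [this, Matrix.det_mul_column, Finset.prod_pow_eq_pow_sum]
  exact dvd_mul_right _ _

/-- The main inequality. In a minimal linear relation `g₀ = ∑ c i * g i` between polynomials that
vanish to high order at given nodes, not all equal, the vanishing orders cannot be too large: every
`n` of the `n + 1` polynomials have the same Wronskian up to a constant, so that it vanishes to high
order at every node, while its degree is at most `∑ D i - n (n - 1) / 2`. -/
theorem order_le_of_minimal_relation [CharZero F] {n : ℕ} {g : Fin n → F[X]} (hg : LinearIndependent F g)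
    {g₀ : F[X]} {c : Fin n → F} (hc : ∀ i, c i ≠ 0) (hrel : g₀ = ∑ i, C (c i) * g i)
    {a : Fin n → F} {a₀ : F} (ha : ∃ i, a i ≠ a₀) {m D : Fin n → ℕ} {m₀ : ℕ}
    (hm : ∀ i, (X - C (a i)) ^ m i ∣ g i) (hm₀ : (X - C a₀) ^ m₀ ∣ g₀)
    (hD : ∀ i, (g i).natDegree ≤ D i) :
    m₀ + ∑ i, m i + ∑ i ∈ Finset.range n, i ≤ ∑ i, D i + (n + 1) * (n - 1) := by
  classical
  have hW := det_wronskiMatrix_ne_zero hg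
  set W := (wronskiMatrix g).det with hWdef
  have hdeg := natDegree_det_wronskiMatrix_le g hW
  have hDsum : ∑ i, (g i).natDegree ≤ ∑ i, D i := Finset.sum_le_sum fun i _ => hD i
  have hdvd : ∀ {p : F[X]} {b : F} {e : ℕ} (j : Fin n), (X - C b) ^ e ∣ p →
      (X - C b) ^ (e - (n - 1)) ∣ derivative^[(j : ℕ)] p := fun {p b e} j h =>
    (pow_dvd_pow _ (by have := j.2; omega)).trans (pow_dvd_iterate_derivative h)
  -- Vanishing order of the Wronskian at each node.
  have hroot : ∀ z : F, (if a₀ = z then m₀ - (n - 1) else 0) +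
      ∑ i, (if a i = z then m i - (n - 1) else 0) ≤ W.rootMultiplicity z := by
    intro z
    rw [le_rootMultiplicity_iff hW]
    by_cases hz : a₀ = z
    · subst hz
      obtain ⟨i₀, hi₀⟩ := ha
      set g' := Function.update g i₀ g₀ with hg'
      have hdet : (wronskiMatrix g').det = C (c i₀) * W := by
        have : wronskiMatrix g' = (wronskiMatrix g).updateRow i₀
            (∑ k, (C (c k)) • (wronskiMatrix g) k) := by
          ext1 i j
          by_cases hi : i = i₀
          · subst hi
            simp [wronskiMatrix, hg', hrel, iterate_derivative_sum, Finset.sum_apply]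
          · simp [wronskiMatrix, hg', hi]
        rw [this, Matrix.det_updateRow_sum, smul_eq_mul]
      have h1 : (X - C a₀) ^ (∑ i, if i = i₀ then m₀ - (n - 1) else
          if a i = a₀ then m i - (n - 1) else 0) ∣ (wronskiMatrix g').det := by
        refine prod_dvd_det_wronskiMatrix g' _ a₀ fun i j => ?_
        by_cases hi : i = i₀
        · subst hi; simpa [hg'] using hdvd j hm₀
        · by_cases hia : a i = a₀
          · simpa [hg', hi, hia] using hdvd j (hia ▸ hm i)
          · simp [hi, hia]
      rw [hdet] at h1
      have h2 : (∑ i, if i = i₀ then m₀ - (n - 1) else if a i = a₀ then m i - (n - 1) else 0) =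
          (if a₀ = a₀ then m₀ - (n - 1) else 0) + ∑ i, (if a i = a₀ then m i - (n - 1) else 0) := by
        rw [← Finset.add_sum_erase _ _ (Finset.mem_univ i₀),
          ← Finset.add_sum_erase Finset.univ (fun i => if a i = a₀ then m i - (n - 1) else 0)
            (Finset.mem_univ i₀), if_pos rfl, if_pos rfl, if_neg hi₀, zero_add]
        congr 1
        refine Finset.sum_congr rfl fun i hi => ?_
        rw [if_neg (Finset.ne_of_mem_erase hi)]
      rw [h2] at h1
      exact ((isUnit_C.2 (isUnit_iff_ne_zero.2 (hc i₀))).dvd_mul_left).1 h1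
    · rw [if_neg hz, zero_add]
      refine prod_dvd_det_wronskiMatrix g _ z fun i j => ?_
      by_cases hia : a i = z
      · simpa [hia] using hdvd j (hia ▸ hm i)
      · simp [hia]
  have hsum : (m₀ - (n - 1)) + ∑ i, (m i - (n - 1)) ≤ W.natDegree := by
    set Z : Finset F := insert a₀ (Finset.univ.image a) with hZ
    have h1 : ∑ z ∈ Z, ((if a₀ = z then m₀ - (n - 1) else 0) +
        ∑ i, (if a i = z then m i - (n - 1) else 0)) ≤ ∑ z ∈ Z, W.rootMultiplicity z :=
      Finset.sum_le_sum fun z _ => hroot z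
    rw [Finset.sum_add_distrib, Finset.sum_comm, Finset.sum_ite_eq, if_pos (by simp [hZ])] at h1
    have h2 : ∀ i, ∑ z ∈ Z, (if a i = z then m i - (n - 1) else 0) = m i - (n - 1) := fun i => by
      rw [Finset.sum_ite_eq, if_pos (by simp [hZ])]
    simp only [h2] at h1
    refine h1.trans (le_trans ?_ (card_roots' W))
    simp only [← count_roots]
    calc ∑ z ∈ Z, W.roots.count z ≤ ∑ z ∈ Z ∪ W.roots.toFinset, W.roots.count z :=
          Finset.sum_le_sum_of_subset Finset.subset_union_left
      _ = W.roots.card := Multiset.sum_count_eq_card fun z hz => by simp at hz ⊢; tauto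
  have hm_le : ∑ i, m i ≤ ∑ i, (m i - (n - 1)) + n * (n - 1) := by
    have : ∑ i, m i ≤ ∑ i : Fin n, ((m i - (n - 1)) + (n - 1)) :=
      Finset.sum_le_sum fun i _ => by omega
    simpa [Finset.sum_add_distrib] using this
  have : (n + 1) * (n - 1) = n * (n - 1) + (n - 1) := by ring
  rw [← hWdef] at hdeg
  omega

end Wronskian

/-! ### Linear relations between affine powers -/

section Independence

variable {F : Type u} [Field F]

/-- In a vanishing sum of polynomials, every nonzero term lies in a minimal linear relation. -/
theorem exists_minimal_relation {ι : Type*} [DecidableEq ι] (J : Finset ι) (g : ι → F[X]) {i₀ : ι}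
    (hi₀ : i₀ ∈ J) (hsum : ∑ i ∈ J, g i = 0) :
    ∃ (n : ℕ) (σ : Fin n → ι) (c : Fin n → F), Function.Injective σ ∧ (∀ k, σ k ∈ J.erase i₀) ∧
      LinearIndependent F (fun k => g (σ k)) ∧ (∀ k, c k ≠ 0) ∧ g i₀ = ∑ k, C (c k) * g (σ k) := by
  classical
  obtain ⟨b, hb, hspan, hli⟩ := exists_linearIndependent F (g '' (J.erase i₀ : Set ι))
  have hmem : g i₀ ∈ Submodule.span F b := by
    rw [hspan]
    have : g i₀ = -∑ i ∈ J.erase i₀, g i := by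
      rw [← Finset.add_sum_erase _ _ hi₀] at hsum
      exact eq_neg_of_add_eq_zero_left hsum
    rw [this]
    exact neg_mem (sum_mem fun i hi => Submodule.subset_span ⟨i, hi, rfl⟩)
  obtain ⟨c, hc, hcs⟩ := Submodule.mem_span_set.1 hmem
  have hidx : ∀ p : c.support, ∃ i ∈ J.erase i₀, g i = p := fun p => hb (hc p.2)
  choose idx hidxJ hidxg using hidx
  refine ⟨c.support.card, fun k => idx (c.support.equivFin.symm k),
    fun k => c (c.support.equivFin.symm k), ?_, fun k => hidxJ _, ?_, ?_, ?_⟩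
  · intro k l h
    have : g (idx (c.support.equivFin.symm k)) = g (idx (c.support.equivFin.symm l)) := by
      simp only at h; rw [h]
    rw [hidxg, hidxg] at this
    exact c.support.equivFin.symm.injective (Subtype.ext this)
  · simp only [hidxg]
    exact hli.comp (fun k => (⟨c.support.equivFin.symm k, hc (c.support.equivFin.symm k).2⟩ : b))
      fun k l h => c.support.equivFin.symm.injective (Subtype.ext (by simpa using h))
  · intro k; exact Finsupp.mem_support_iff.1 (c.support.equivFin.symm k).2
  · simp only [hidxg]
    rw [← hcs, Finsupp.sum, ← Finset.sum_coe_sort,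
      ← Equiv.sum_comp c.support.equivFin.symm]
    refine Finset.sum_congr rfl fun k _ => ?_
    rw [smul_eq_C_mul]

theorem natDegree_X_sub_C_pow (a : F) (e : ℕ) : ((X - C a) ^ e).natDegree = e := by
  rw [natDegree_pow, natDegree_X_sub_C, mul_one]

/-- A nonzero multiple of a power of `X - a₀` is not a combination of other powers with the same
node. -/
theorem exists_node_ne {n : ℕ} {a₀ b₀ : F} {e₀ : ℕ} {a b : Fin n → F} {e : Fin n → ℕ} (hb₀ : b₀ ≠ 0)
    (hne : ∀ k, (a k, e k) ≠ (a₀, e₀))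
    (h : C b₀ * (X - C a₀) ^ e₀ = ∑ k, C (b k) * (X - C (a k)) ^ e k) :
    ∃ k, a k ≠ a₀ := by
  by_contra! hall
  have h1 := congrArg (fun p => (p.comp (X + C a₀)).coeff e₀) h
  simp only [hall, mul_comp, C_comp, pow_comp, sub_comp, X_comp, add_sub_cancel_right,
    Polynomial.sum_comp, finsetSum_coeff, coeff_C_mul, coeff_X_pow] at h1
  rw [if_pos trivial, mul_one, Finset.sum_eq_zero] at h1
  · exact hb₀ h1
  · intro k _
    rw [if_neg, mul_zero]
    rintro rfl
    exact hne k (by rw [hall])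

/-- The exponents in a linear relation between `r` different affine powers are less than
`r (r - 1) / 2`. -/
theorem exponent_le_of_relation [CharZero F] {Q : Finset (F × ℕ)} {c : F × ℕ → F}
    (hc : ∀ p ∈ Q, c p ≠ 0) (hsum : ∑ p ∈ Q, C (c p) * (X - C p.1) ^ p.2 = 0) {p : F × ℕ}
    (hp : p ∈ Q) : 2 * p.2 + 2 ≤ Q.card * (Q.card - 1) := by
  classical
  obtain ⟨n, σ, b, hσ, hσQ, hli, hb, hrel⟩ := exists_minimal_relation Q _ hp hsum
  have hσQ' : ∀ k, σ k ∈ Q := fun k => Finset.mem_of_mem_erase (hσQ k)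
  have hnode : ∃ k, (σ k).1 ≠ p.1 := by
    refine exists_node_ne (a := fun k => (σ k).1) (b := fun k => b k * c (σ k))
      (e := fun k => (σ k).2) (hc p hp) (fun k => ?_) (e₀ := p.2) ?_
    · exact Finset.ne_of_mem_erase (hσQ k)
    · rw [hrel]
      refine Finset.sum_congr rfl fun k _ => ?_
      rw [C_mul, mul_assoc]
  have hn : n + 1 ≤ Q.card := by
    have := Finset.card_le_card_of_injOn (s := Finset.univ) (t := Q.erase p) σ
      (fun k _ => hσQ k) hσ.injOn
    rw [Finset.card_erase_of_mem hp, Finset.card_fin] at this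
    have := Finset.card_pos.2 ⟨p, hp⟩
    omega
  have key := order_le_of_minimal_relation hli hb hrel hnode (m := fun k => (σ k).2)
    (D := fun k => (σ k).2) (m₀ := p.2) (fun k => dvd_mul_left _ _) (dvd_mul_left _ _)
    (fun k => (natDegree_C_mul_le _ _).trans (natDegree_X_sub_C_pow _ _).le)
  have hsum2 := Finset.sum_range_id_mul_two n
  obtain ⟨k, hk⟩ := hnode
  obtain ⟨m, rfl⟩ : ∃ m, n = m + 1 := ⟨n - 1, by have := k.2; omega⟩
  obtain ⟨r, hr⟩ : ∃ r, Q.card = m + 2 + r := ⟨Q.card - (m + 2), by omega⟩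
  have e1 : m + 2 + r - 1 = m + 1 + r := by omega
  rw [hr, e1]
  simp only [Nat.add_sub_cancel] at key hsum2
  nlinarith

/-- Affine powers of large exponents, compared with the square of their number, are independent. -/
theorem linearIndependent_affinePowers [CharZero F] {Q : Finset (F × ℕ)}
    (hQ : ∀ p ∈ Q, Q.card * (Q.card - 1) < 2 * p.2 + 2) {c : F × ℕ → F}
    (hsum : ∑ p ∈ Q, C (c p) * (X - C p.1) ^ p.2 = 0) : ∀ p ∈ Q, c p = 0 := by
  classical
  by_contra! hne
  obtain ⟨p, hp, hcp⟩ := hne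
  set Q' := Q.filter fun p => c p ≠ 0 with hQ'
  have hsum' : ∑ p ∈ Q', C (c p) * (X - C p.1) ^ p.2 = 0 := by
    rw [← hsum, hQ', Finset.sum_filter_of_ne]
    intro q _ hq hcq
    exact hq (by simp [hcq])
  have h1 := exponent_le_of_relation (fun q hq => (Finset.mem_filter.1 hq).2) hsum'
    (Finset.mem_filter.2 ⟨hp, hcp⟩)
  have h2 : Q'.card ≤ Q.card := Finset.card_filter_le _ _
  have h3 := hQ p hp
  have h4 : Q'.card * (Q'.card - 1) ≤ Q.card * (Q.card - 1) :=
    Nat.mul_le_mul h2 (Nat.sub_le_sub_right h2 1)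
  exact absurd (h1.trans h4) (not_le.2 h3)

/-- The solutions `(X - b) ^ d` with `2 * d ≥ (t + 1) ^ 2` of an equation of order `t` are
independent, hence there are at most `t` of them. -/
theorem card_affineSolutions_le [CharZero F] {t : ℕ} {P : ℕ → F[X]} (hP : ∃ i ≤ t, P i ≠ 0)
    {Q : Finset (F × ℕ)}
    (hQ : ∀ p ∈ Q, (t + 1) ^ 2 ≤ 2 * p.2 ∧ Satisfies t P ((X - C p.1) ^ p.2)) : Q.card ≤ t := by
  classical
  by_contra! hlt
  obtain ⟨R, hRQ, hR⟩ := Finset.exists_subset_card_eq (s := Q) (n := t + 1) hlt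
  have hli : LinearIndependent F (fun p : R => (X - C p.1.1) ^ p.1.2) := by
    rw [Fintype.linearIndependent_iff]
    intro c hc p
    have := linearIndependent_affinePowers (Q := R) (c := fun p => if h : p ∈ R then c ⟨p, h⟩ else 0)
      (fun q hq => ?_) ?_ p p.2
    · simpa using this
    · have := (hQ q (hRQ hq)).1
      rw [hR]; simp only [Nat.add_sub_cancel]; nlinarith
    · rw [← hc, ← Finset.sum_coe_sort]
      refine Finset.sum_congr rfl fun q _ => ?_
      rw [dif_pos q.2, smul_eq_C_mul]
  have := card_le_of_linearIndependent_of_diffOp_eq_zero hP (n := R.card)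
    (hli.comp R.equivFin.symm R.equivFin.symm.injective)
    (fun i => (satisfies_iff _ _ _).1 (hQ _ (hRQ (R.equivFin.symm i).2)).2)
  omega

end Independence

/-! ### Shifted differential equations of sums of affine powers -/

section Equations

variable {F : Type u} [Field F]

theorem natDegree_diffOp_le {t : ℕ} {P : ℕ → F[X]} (hP : ∀ i ≤ t, (P i).natDegree ≤ i) (g : F[X]) :
    (diffOp t P g).natDegree ≤ g.natDegree := by
  rw [diffOp_apply]
  refine natDegree_sum_le_of_forall_le _ _ fun i hi => ?_
  by_cases h : derivative^[i] g = 0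
  · simp [h]
  · have h1 := natDegree_iterate_derivative_add_le g i h
    have h2 := hP i (by simp at hi; omega)
    exact natDegree_mul_le.trans (by omega)

theorem pow_dvd_diffOp (t : ℕ) (P : ℕ → F[X]) {g : F[X]} {a : F} {e : ℕ}
    (h : (X - C a) ^ e ∣ g) : (X - C a) ^ (e - t) ∣ diffOp t P g := by
  rw [diffOp_apply]
  refine Finset.dvd_sum fun i hi => Dvd.dvd.mul_left ?_ _
  simp at hi
  exact (pow_dvd_pow _ (by omega)).trans (pow_dvd_iterate_derivative h)

theorem diffOp_C_mul (t : ℕ) (P : ℕ → F[X]) (c : F) (g : F[X]) :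
    diffOp t P (C c * g) = C c * diffOp t P g := by
  rw [← smul_eq_C_mul, map_smul, smul_eq_C_mul]

/-- If a combination of affine powers with different nodes satisfies an equation of shift `0`, then
the terms that do not satisfy it have small exponents. -/
theorem exponent_le_of_not_satisfies [CharZero F] {ι : Type*} {J : Finset ι} {α a : ι → F}
    {e : ι → ℕ} (ha : Set.InjOn a J) (hα : ∀ i ∈ J, α i ≠ 0) {t : ℕ} {P : ℕ → F[X]}
    (hP : ∀ i ≤ t, (P i).natDegree ≤ i)
    (hsat : Satisfies t P (∑ i ∈ J, C (α i) * (X - C (a i)) ^ e i)) {I : Finset ι} (hIJ : I ⊆ J)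
    (hI : ∀ i ∈ J, i ∈ I ↔ ¬ Satisfies t P ((X - C (a i)) ^ e i)) {i : ι} (hi : i ∈ I) :
    2 * e i + 2 ≤ 2 * I.card * t + I.card * (I.card - 1) := by
  classical
  have hsum : ∑ i ∈ I, diffOp t P (C (α i) * (X - C (a i)) ^ e i) = 0 := by
    rw [satisfies_iff, map_sum] at hsat
    rw [← hsat]
    refine Finset.sum_subset hIJ fun k hk hkI => ?_
    rw [hI k hk, not_not, satisfies_iff] at hkI
    rw [diffOp_C_mul, hkI, mul_zero]
  obtain ⟨n, σ, b, hσ, hσI, hli, hb, hrel⟩ := exists_minimal_relation I _ hi hsum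
  have hσI' : ∀ k, σ k ∈ I := fun k => Finset.mem_of_mem_erase (hσI k)
  have hn : n + 1 ≤ I.card := by
    have := Finset.card_le_card_of_injOn (s := Finset.univ) (t := I.erase i) σ
      (fun k _ => hσI k) hσ.injOn
    rw [Finset.card_erase_of_mem hi, Finset.card_fin] at this
    have := Finset.card_pos.2 ⟨i, hi⟩
    omega
  have hn0 : 0 < n := by
    by_contra! h0
    obtain rfl : n = 0 := by omega
    rw [Finset.univ_eq_empty, Finset.sum_empty, diffOp_C_mul, mul_eq_zero, C_eq_zero] at hrel
    exact ((hI i (hIJ hi)).1 hi) ((satisfies_iff _ _ _).2 (hrel.resolve_left (hα i (hIJ hi))))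
  have key := order_le_of_minimal_relation hli hb hrel (a := fun k => a (σ k)) (a₀ := a i)
    ⟨⟨0, hn0⟩, fun h => Finset.ne_of_mem_erase (hσI _) (ha (hIJ (hσI' _)) (hIJ hi) h)⟩
    (m := fun k => e (σ k) - t) (D := fun k => e (σ k)) (m₀ := e i - t)
    (fun k => pow_dvd_diffOp _ _ (dvd_mul_left _ _)) (pow_dvd_diffOp _ _ (dvd_mul_left _ _))
    (fun k => (natDegree_diffOp_le hP _).trans
      ((natDegree_C_mul_le _ _).trans (natDegree_X_sub_C_pow _ _).le))
  have hsum2 := Finset.sum_range_id_mul_two n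
  have hsum3 : ∑ k, e (σ k) ≤ ∑ k, (e (σ k) - t) + n * t := by
    have : ∑ k, e (σ k) ≤ ∑ k : Fin n, ((e (σ k) - t) + t) :=
      Finset.sum_le_sum fun i _ => by omega
    simpa [Finset.sum_add_distrib] using this
  obtain ⟨m, rfl⟩ : ∃ m, n = m + 1 := ⟨n - 1, by omega⟩
  obtain ⟨r, hr⟩ : ∃ r, I.card = m + 2 + r := ⟨I.card - (m + 2), by omega⟩
  have e1 : m + 2 + r - 1 = m + 1 + r := by omega
  have e2 : e i ≤ (e i - t) + t := by omega
  rw [hr, e1]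
  simp only [Nat.add_sub_cancel] at key hsum2
  nlinarith

/-- The products `X ^ k * f⁽ⁱ⁾` with `k ≤ i ≤ t` outnumber the dimension of a space containing them,
as soon as `t + 2 > 2 s`, where `s` is the number of affine powers that compose `f`. -/
theorem exists_isSDE {ι : Type*} (J : Finset ι) (α a : ι → F) (e : ι → ℕ) {t : ℕ}
    (ht : 2 * J.card < t + 2) :
    ∃ P, IsSDE t 0 P ∧ Satisfies t P (∑ i ∈ J, C (α i) * (X - C (a i)) ^ e i) := by
  classical
  set f := ∑ i ∈ J, C (α i) * (X - C (a i)) ^ e i with hf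
  let φ : (J → degreeLT F (t + 1)) →ₗ[F] F[X] :=
    ∑ i : J, LinearMap.mulLeft F ((X - C (a i)) ^ (e i - t)) ∘ₗ (degreeLT F (t + 1)).subtype ∘ₗ
      LinearMap.proj i
  have hφ : ∀ q, φ q = ∑ i : J, (X - C (a i)) ^ (e i - t) * (q i : F[X]) := by
    intro q; simp [φ, LinearMap.sum_apply]
  have : FiniteDimensional F (degreeLT F (t + 1)) :=
    (degreeLTEquiv F (t + 1)).symm.finiteDimensional
  have hrank : Module.finrank F (LinearMap.range φ) ≤ J.card * (t + 1) := by
    refine (LinearMap.finrank_range_le φ).trans ?_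
    rw [Module.finrank_pi_fintype]
    simp [(degreeLTEquiv F (t + 1)).finrank_eq]
  let v : (Σ i : Fin (t + 1), Fin (i + 1)) → F[X] := fun p => X ^ (p.2 : ℕ) * derivative^[(p.1 : ℕ)] f
  have hv : ∀ p, v p ∈ LinearMap.range φ := by
    rintro ⟨i, k⟩
    have hik : (k : ℕ) ≤ i := by have := k.2; omega
    have hit : (i : ℕ) ≤ t := by have := i.2; omega
    -- The contribution of one affine power.
    have hq : ∀ j : J, ∃ q : degreeLT F (t + 1),
        (X : F[X]) ^ (k : ℕ) * derivative^[(i : ℕ)] (C (α j) * (X - C (a j)) ^ e j) =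
          (X - C (a j)) ^ (e j - t) * (q : F[X]) := by
      intro j
      by_cases hje : e j < i
      · exact ⟨0, by rw [iterate_derivative_C_mul, iterate_derivative_X_sub_pow,
          Nat.descFactorial_of_lt hje]; simp⟩
      · push Not at hje
        refine ⟨⟨C (α j * ((e j).descFactorial i : F)) * (X ^ (k : ℕ) *
          (X - C (a j)) ^ (e j - i - (e j - t))), ?_⟩, ?_⟩
        · rw [mem_degreeLT]
          refine lt_of_le_of_lt degree_le_natDegree ?_
          norm_cast
          refine Nat.lt_succ_of_le ((natDegree_C_mul_le _ _).trans (natDegree_mul_le.trans ?_))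
          rw [natDegree_X_pow, natDegree_X_sub_C_pow]
          omega
        · have : (X - C (a j)) ^ (e j - i) =
              (X - C (a j)) ^ (e j - t) * (X - C (a j)) ^ (e j - i - (e j - t)) := by
            rw [← pow_add]; congr 1; omega
          have hcast : C (α j * ((e j).descFactorial i : F)) =
              C (α j) * ((e j).descFactorial i : F[X]) := by rw [C_mul, C_eq_natCast]
          simp only [hcast]
          rw [iterate_derivative_C_mul, iterate_derivative_X_sub_pow, this, nsmul_eq_mul]
          ring
    choose q hq using hq
    refine ⟨q, ?_⟩
    rw [hφ]
    simp only [← hq, v]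
    rw [Finset.sum_coe_sort J fun j =>
      (X : F[X]) ^ (k : ℕ) * derivative^[(i : ℕ)] (C (α j) * (X - C (a j)) ^ e j),
      ← Finset.mul_sum, hf, iterate_derivative_sum]
  have hcard : Fintype.card (Σ i : Fin (t + 1), Fin (i + 1)) * 2 = (t + 2) * (t + 1) := by
    rw [Fintype.card_sigma]
    simp only [Fintype.card_fin]
    rw [← Finset.sum_range fun i => i + 1]
    have h := Finset.sum_range_id_mul_two (t + 2)
    rw [Finset.sum_range_succ'] at h
    simpa using h
  have hnli : ¬ LinearIndependent F v := by
    intro hli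
    have : LinearIndependent F (fun p => (⟨v p, hv p⟩ : LinearMap.range φ)) :=
      LinearIndependent.of_comp (LinearMap.range φ).subtype hli
    have h1 := this.fintype_card_le_finrank
    nlinarith
  rw [Fintype.linearIndependent_iff] at hnli
  push Not at hnli
  obtain ⟨c, hc, ⟨i₀, k₀⟩, hc0⟩ := hnli
  let P : ℕ → F[X] := fun i => if h : i < t + 1 then
    ∑ k : Fin (i + 1), C (c ⟨⟨i, h⟩, k⟩) * X ^ (k : ℕ) else 0
  have hPi : ∀ i : Fin (t + 1), P i = ∑ k : Fin (i + 1), C (c ⟨i, k⟩) * X ^ (k : ℕ) := fun i => by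
    simp only [P]; rw [dif_pos i.2]
  refine ⟨P, ⟨⟨i₀, by omega, fun h0 => hc0 ?_⟩, fun i hi => ?_⟩, ?_⟩
  · rw [hPi] at h0
    have := congrArg (fun p => p.coeff (k₀ : ℕ)) h0
    simpa [finsetSum_coeff, coeff_X_pow, Fin.val_inj, eq_comm] using this
  · have := hPi ⟨i, by omega⟩
    simp only at this
    rw [this]
    refine natDegree_sum_le_of_forall_le _ _ fun k _ => (natDegree_C_mul_X_pow_le _ _).trans ?_
    have := k.2; omega
  · rw [Satisfies, Finset.sum_range, ← hc, Fintype.sum_sigma]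
    refine Finset.sum_congr rfl fun i _ => ?_
    rw [hPi, Finset.sum_mul]
    refine Finset.sum_congr rfl fun k _ => ?_
    rw [smul_eq_C_mul, mul_assoc]

/-- The node of an affine power of large exponent that satisfies an equation of order `t` is a root
of its leading coefficient. -/
theorem isRoot_of_satisfies [CharZero F] {t : ℕ} {P : ℕ → F[X]} {b : F} {d : ℕ} (hd : t ≤ d)
    (h : Satisfies t P ((X - C b) ^ d)) : (P t).IsRoot b := by
  have h1 : (X - C b) ^ (d - t) * ∑ i ∈ Finset.range (t + 1),
      P i * (C (d.descFactorial i : F) * (X - C b) ^ (t - i)) = 0 := by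
    rw [Satisfies] at h
    rw [← h, Finset.mul_sum]
    refine Finset.sum_congr rfl fun i hi => ?_
    have : d - i = (d - t) + (t - i) := by simp at hi; omega
    rw [iterate_derivative_X_sub_pow, this, pow_add, nsmul_eq_mul, C_eq_natCast]
    ring
  have h2 := (mul_eq_zero.1 h1).resolve_left (pow_ne_zero _ (X_sub_C_ne_zero b))
  have h3 := congrArg (eval b) h2
  rw [eval_finsetSum, Finset.sum_eq_single t] at h3
  · simp only [Nat.sub_self, pow_zero, mul_one, eval_mul, eval_C, eval_zero, mul_eq_zero] at h3
    refine h3.resolve_right ?_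
    exact_mod_cast (Nat.pos_of_ne_zero fun h => by
      rw [Nat.descFactorial_eq_zero_iff_lt] at h; omega).ne'
  · intro i hi hit
    have : t - i ≠ 0 := by simp at hi; omega
    simp [this]
  · simp

end Equations

/-! ### Sparse sums -/

section Sparse

variable {F : Type u} [Field F] {ι : Type*}

/-- The part of a sum of affine powers that is indexed by `J`. -/
noncomputable def sumOn (α a : ι → F) (e : ι → ℕ) (J : Finset ι) : F[X] :=
  ∑ i ∈ J, C (α i) * (X - C (a i)) ^ e i

/-- A sum of affine powers with different nodes and nonzero coefficients, few of which have small
exponents: if all the exponents in a nonempty set of `r` terms are at most `M`, then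
`r ≤ (3 M / 4) ^ (1 / 3) - 1`. Unlike the bound on the numbers of exponents at most `i`, this
condition visibly passes to subsets. -/
structure IsSparse (α a : ι → F) (e : ι → ℕ) (J : Finset ι) : Prop where
  injOn : Set.InjOn a J
  ne_zero : ∀ i ∈ J, α i ≠ 0
  spread : ∀ I ⊆ J, I.Nonempty → ∀ M, (∀ i ∈ I, e i ≤ M) → 4 * (I.card + 1) ^ 3 ≤ 3 * M

variable {α a : ι → F} {e : ι → ℕ} {J : Finset ι}

theorem IsSparse.mono {J' : Finset ι} (h : IsSparse α a e J) (hJ : J' ⊆ J) :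
    IsSparse α a e J' :=
  ⟨h.injOn.mono (by exact_mod_cast hJ), fun i hi => h.ne_zero i (hJ hi),
    fun I hI => h.spread I (hI.trans hJ)⟩

theorem exists_max_exponent (e : ι → ℕ) (hJ : J.Nonempty) : ∃ i ∈ J, ∀ k ∈ J, e k ≤ e i :=
  Finset.exists_max_image J e hJ

theorem natDegree_sumOn_le {M : ℕ} (hM : ∀ k ∈ J, e k ≤ M) : (sumOn α a e J).natDegree ≤ M :=
  natDegree_sum_le_of_forall_le _ _ fun i hi =>
    (natDegree_C_mul_le _ _).trans ((natDegree_X_sub_C_pow _ _).le.trans (hM i hi))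

theorem iterate_derivative_affinePower (c b : F) (d j : ℕ) :
    derivative^[j] (C c * (X - C b) ^ d) = C (c * (d.descFactorial j : F)) * (X - C b) ^ (d - j) := by
  rw [iterate_derivative_C_mul, iterate_derivative_X_sub_pow, nsmul_eq_mul, C_mul, C_eq_natCast,
    mul_assoc]

/-- Affine powers stay independent modulo polynomials of degree less than `j`, if their exponents
exceed `j` sufficiently. -/
theorem eq_zero_of_iterate_derivative_eq_zero [CharZero F] {Q : Finset (F × ℕ)} {j : ℕ}
    (hj : ∀ p ∈ Q, j ≤ p.2) (hQ : ∀ p ∈ Q, Q.card * (Q.card - 1) < 2 * (p.2 - j) + 2)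
    {c : F × ℕ → F} (h : derivative^[j] (∑ p ∈ Q, C (c p) * (X - C p.1) ^ p.2) = 0) :
    ∀ p ∈ Q, c p = 0 := by
  classical
  set shift : F × ℕ → F × ℕ := fun p => (p.1, p.2 - j) with hshift
  have hinj : Set.InjOn shift Q := by
    rintro ⟨x, m⟩ hp ⟨y, n⟩ hq hpq
    have h1 := hj _ hp
    have h2 := hj _ hq
    simp only [hshift, Prod.mk.injEq] at hpq h1 h2 ⊢
    exact ⟨hpq.1, by omega⟩
  have hcard : (Q.image shift).card = Q.card := Finset.card_image_of_injOn hinj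
  have key := linearIndependent_affinePowers (Q := Q.image shift)
    (c := fun p => c (p.1, p.2 + j) * ((p.2 + j).descFactorial j : F)) ?_ ?_
  · intro p hp
    have h1 := key (shift p) (Finset.mem_image_of_mem _ hp)
    simp only [hshift, Nat.sub_add_cancel (hj p hp), mul_eq_zero] at h1
    refine h1.resolve_right ?_
    have := hj p hp
    exact Nat.cast_ne_zero.2 (by rw [Ne, Nat.descFactorial_eq_zero_iff_lt]; omega)
  · intro p hp
    obtain ⟨q, hq, rfl⟩ := Finset.mem_image.1 hp
    rw [hcard]; exact hQ q hq
  · rw [Finset.sum_image hinj, ← h, iterate_derivative_sum]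
    refine Finset.sum_congr rfl fun p hp => ?_
    simp only [hshift, Nat.sub_add_cancel (hj p hp), iterate_derivative_affinePower]

/-- Cancellation lowers the degree of a sparse sum only little below its largest exponent. -/
theorem IsSparse.exponent_le [CharZero F] (h : IsSparse α a e J) {i : ι} (hi : i ∈ J)
    {j : ℕ} (hder : derivative^[j] (sumOn α a e J) = 0) :
    2 * e i ≤ 2 * (j - 1) + J.card * (J.card - 1) := by
  classical
  by_cases hlt : e i < j
  · omega
  push Not at hlt
  set K := J.filter fun i => j ≤ e i with hK
  have hKJ : K ⊆ J := Finset.filter_subset _ _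
  set sh : ι → F × ℕ := fun i => (a i, e i - j) with hsh
  have hinj : Set.InjOn sh K := fun x hx y hy hxy =>
    h.injOn (hKJ hx) (hKJ hy) (Prod.ext_iff.1 hxy).1
  -- The coefficient at a node is found by inverting the node map.
  set inv : F × ℕ → ι := fun p => if hp : ∃ k ∈ K, sh k = p then hp.choose else i with hinv
  have hinv' : ∀ k ∈ K, inv (sh k) = k := by
    intro k hk
    have hp : ∃ k' ∈ K, sh k' = sh k := ⟨k, hk, rfl⟩
    simp only [hinv]; rw [dif_pos hp]
    exact hinj hp.choose_spec.1 hk hp.choose_spec.2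
  have hle := exponent_le_of_relation (Q := K.image sh)
    (c := fun p => α (inv p) * ((e (inv p)).descFactorial j : F)) (p := sh i) ?_ ?_ ?_
  · rw [Finset.card_image_of_injOn hinj] at hle
    have h1 : K.card ≤ J.card := Finset.card_le_card hKJ
    have h2 : K.card * (K.card - 1) ≤ J.card * (J.card - 1) :=
      Nat.mul_le_mul h1 (Nat.sub_le_sub_right h1 1)
    simp only [hsh] at hle
    have := hle.trans h2
    omega
  · intro p hp
    obtain ⟨k, hk, rfl⟩ := Finset.mem_image.1 hp
    rw [hinv' k hk]
    refine mul_ne_zero (h.ne_zero k (hKJ hk)) ?_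
    have := (Finset.mem_filter.1 hk).2
    exact Nat.cast_ne_zero.2 (by rw [Ne, Nat.descFactorial_eq_zero_iff_lt]; omega)
  · rw [Finset.sum_image hinj, ← hder, sumOn, iterate_derivative_sum, hK, Finset.sum_filter]
    refine Finset.sum_congr rfl fun k hk => ?_
    rw [iterate_derivative_affinePower]
    split_ifs with hjk
    · rw [hinv' k (Finset.mem_filter.2 ⟨hk, hjk⟩)]
    · rw [Nat.descFactorial_of_lt (by omega)]; simp
  · exact Finset.mem_image_of_mem _ (Finset.mem_filter.2 ⟨hi, hlt⟩)

theorem IsSparse.exponent_le_natDegree [CharZero F] (h : IsSparse α a e J) {i : ι} (hi : i ∈ J) :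
    2 * e i ≤ 2 * (sumOn α a e J).natDegree + J.card * (J.card - 1) := by
  simpa using h.exponent_le hi (iterate_derivative_eq_zero (Nat.lt_succ_self _))

theorem IsSparse.card_bound (h : IsSparse α a e J) {i : ι} (hi : i ∈ J)
    (hmax : ∀ k ∈ J, e k ≤ e i) : 4 * (J.card + 1) ^ 3 ≤ 3 * e i :=
  h.spread J subset_rfl ⟨i, hi⟩ _ hmax

/-- The degree of a sparse sum is large compared with the number of terms. -/
theorem IsSparse.card_bound_natDegree [CharZero F] (h : IsSparse α a e J) (hJ : J.Nonempty) :
    8 * (J.card + 1) ^ 3 ≤ 6 * (sumOn α a e J).natDegree + 3 * (J.card * (J.card - 1)) := by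
  obtain ⟨i, hi, hmax⟩ := exists_max_exponent e hJ
  have h1 := h.card_bound hi hmax
  have h2 := h.exponent_le_natDegree hi
  omega

theorem IsSparse.sumOn_ne_zero [CharZero F] (h : IsSparse α a e J) (hJ : J.Nonempty) :
    sumOn α a e J ≠ 0 := by
  intro h0
  have h1 := h.card_bound_natDegree hJ
  rw [h0, natDegree_zero] at h1
  have h3 : J.card * (J.card - 1) ≤ J.card * J.card := Nat.mul_le_mul_left _ (Nat.sub_le _ _)
  nlinarith

/-- A term of large exponent satisfies every equation that the sum satisfies. -/
theorem IsSparse.satisfies [CharZero F] (h : IsSparse α a e J) {t : ℕ} {P : ℕ → F[X]}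
    (hP : IsSDE t 0 P) (hsat : Satisfies t P (sumOn α a e J)) {i : ι} (hi : i ∈ J)
    (hle : (t + 1) ^ 2 ≤ 2 * e i) : Satisfies t P ((X - C (a i)) ^ e i) := by
  classical
  by_contra hns
  set I := J.filter fun i => ¬ Satisfies t P ((X - C (a i)) ^ e i) with hI
  have hIJ : I ⊆ J := Finset.filter_subset _ _
  have hiI : i ∈ I := Finset.mem_filter.2 ⟨hi, hns⟩
  obtain ⟨m, hm, hmax⟩ := exists_max_exponent e ⟨i, hiI⟩
  have h1 := h.spread I hIJ ⟨m, hm⟩ _ hmax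
  have h2 := exponent_le_of_not_satisfies h.injOn h.ne_zero (fun i hi => by simpa using hP.2 i hi)
    hsat hIJ (fun k hk => by simp [hI, hk]) hm
  have h3 := hmax i hiI
  have hr := Finset.card_pos.2 ⟨i, hiI⟩
  obtain ⟨r, hr'⟩ : ∃ r, I.card = r + 1 := ⟨I.card - 1, by omega⟩
  rw [hr', Nat.add_sub_cancel] at h2
  rw [hr'] at h1
  have h4 : 3 * (r + 1) ≤ t + 1 := by
    by_contra! hlt
    have h5 : (r + 1) * t ≤ (r + 1) * (3 * r + 1) := Nat.mul_le_mul_left _ (by omega)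
    nlinarith [Nat.zero_le r]
  obtain ⟨w, hw⟩ : ∃ w, t + 1 = 3 * (r + 1) + w := ⟨t + 1 - 3 * (r + 1), by omega⟩
  have ht : t = 3 * r + 2 + w := by omega
  subst ht
  nlinarith

/-- A sequence that descends from at least `D` to far below `D` has a big drop. -/
theorem exists_drop (x : ℕ → ℚ) (l : ℕ) (D : ℚ) (h1 : D ≤ x 1)
    (hl : x (l + 1) + ∑ i ∈ Finset.range (l + 1), (i : ℚ) ^ 2 / 2 < D) :
    ∃ r, 1 ≤ r ∧ r ≤ l ∧ (r : ℚ) ^ 2 / 2 < x r - x (r + 1) ∧ x (r + 1) < D := by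
  by_contra! hno
  have key : ∀ k ≤ l, x (l + 1 - k) + ∑ i ∈ Finset.range (l + 1 - k), (i : ℚ) ^ 2 / 2 ≤
      x (l + 1) + ∑ i ∈ Finset.range (l + 1), (i : ℚ) ^ 2 / 2 := by
    intro k
    induction k with
    | zero => simp
    | succ k ih =>
      intro hk
      have h2 := ih (by omega)
      obtain ⟨m, hm⟩ : ∃ m, l + 1 - k = m + 1 := ⟨l - k, by omega⟩
      rw [hm, Finset.sum_range_succ] at h2
      have hm' : l + 1 - (k + 1) = m := by omega
      rw [hm']
      have hpos : 0 ≤ ∑ i ∈ Finset.range m, (i : ℚ) ^ 2 / 2 :=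
        Finset.sum_nonneg fun i _ => by positivity
      have hpos2 : 0 ≤ (m : ℚ) ^ 2 / 2 := by positivity
      have h3 := hno m (by omega) (by omega)
      by_cases hd : (m : ℚ) ^ 2 / 2 < x m - x (m + 1)
      · have := h3 hd; linarith
      · linarith
  have := key l le_rfl
  have hpos : 0 ≤ ∑ i ∈ Finset.range (l + 1 - l), (i : ℚ) ^ 2 / 2 :=
        Finset.sum_nonneg fun i _ => by positivity
  rw [Nat.add_sub_cancel_left] at this hpos
  linarith

theorem sum_sq_div_two (l : ℕ) :
    ∑ i ∈ Finset.range (l + 1), (i : ℚ) ^ 2 / 2 = (l : ℚ) * (l + 1) * (2 * l + 1) / 12 := by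
  induction l with
  | zero => simp
  | succ l ih => rw [Finset.sum_range_succ, ih]; push_cast; ring

/-- The numerical estimate behind the existence of an index at which the exponents drop: `D` is the
degree of a sparse sum of `s` terms, `t < 2 s` the order of its equation, `l ≤ t` the number of
solutions, and `θ` the threshold for their exponents. -/
theorem threshold_add_sum_lt {s t l D : ℕ} (hD : 8 * (s + 1) ^ 3 ≤ 6 * D + 3 * (s * (s - 1)))
    (hs : 1 ≤ s) (ht : t + 1 ≤ 2 * s) (hl : l ≤ t) {θ : ℚ}
    (hθ : 2 * θ ≤ (t + 1) * (t + 2) + 2) :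
    θ + ∑ i ∈ Finset.range (l + 1), (i : ℚ) ^ 2 / 2 < D := by
  rw [sum_sq_div_two]
  have hD' : (8 * (s + 1) ^ 3 : ℚ) ≤ 6 * D + 3 * (s * (s - 1)) := by
    have : ((s - 1 : ℕ) : ℚ) = s - 1 := by rw [Nat.cast_sub hs, Nat.cast_one]
    rw [← this]; exact_mod_cast hD
  have hs' : (1 : ℚ) ≤ s := by exact_mod_cast hs
  have ht' : (t : ℚ) + 1 ≤ 2 * s := by exact_mod_cast ht
  have hl' : (l : ℚ) ≤ 2 * s - 1 := by
    have : (l : ℚ) ≤ t := by exact_mod_cast hl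
    linarith
  have hl0 : (0 : ℚ) ≤ l := Nat.cast_nonneg l
  have ht0 : (0 : ℚ) ≤ t := Nat.cast_nonneg t
  have h1 : (l : ℚ) * (l + 1) * (2 * l + 1) ≤ (2 * s - 1) * (2 * s) * (4 * s - 1) := by
    have e1 : (l : ℚ) * (l + 1) ≤ (2 * s - 1) * (2 * s) :=
      mul_le_mul hl' (by linarith) (by linarith) (by linarith)
    exact mul_le_mul e1 (by linarith) (by linarith) (by nlinarith)
  have h2 : ((t : ℚ) + 1) * (t + 2) ≤ (2 * s) * (2 * s + 1) :=
    mul_le_mul ht' (by linarith) (by linarith) (by linarith)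
  nlinarith

/-! ### The coefficient of an affine power in a sum -/

open Classical in
/-- The coefficient of the affine power `(X - p.1) ^ p.2` in the sum indexed by `J`. -/
noncomputable def coefOn (α a : ι → F) (e : ι → ℕ) (J : Finset ι) (p : F × ℕ) : F :=
  ∑ i ∈ J with (a i, e i) = p, α i

theorem IsSparse.coefOn_eq (h : IsSparse α a e J) {i : ι} (hi : i ∈ J) :
    coefOn α a e J (a i, e i) = α i := by
  classical
  rw [coefOn, Finset.sum_eq_single_of_mem i]
  · simp [hi]
  · intro k hk hki
    rw [Finset.mem_filter] at hk
    exact absurd (h.injOn hk.1 hi (Prod.ext_iff.1 hk.2).1) hki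

theorem IsSparse.coefOn_ne_zero (h : IsSparse α a e J) {p : F × ℕ} :
    coefOn α a e J p ≠ 0 ↔ ∃ i ∈ J, (a i, e i) = p := by
  classical
  constructor
  · intro hp
    obtain ⟨i, hi, _⟩ := Finset.exists_ne_zero_of_sum_ne_zero hp
    rw [Finset.mem_filter] at hi
    exact ⟨i, hi.1, hi.2⟩
  · rintro ⟨i, hi, rfl⟩
    rw [h.coefOn_eq hi]; exact h.ne_zero i hi

open Classical in
theorem sumOn_sub_sum_coefOn (α a : ι → F) (e : ι → ℕ) (J : Finset ι) (Q : Finset (F × ℕ)) :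
    sumOn α a e J - ∑ p ∈ Q, C (coefOn α a e J p) * (X - C p.1) ^ p.2 =
      sumOn α a e (J.filter fun i => (a i, e i) ∉ Q) := by
  have h1 : ∑ p ∈ Q, C (coefOn α a e J p) * (X - C p.1) ^ p.2 =
      sumOn α a e (J.filter fun i => (a i, e i) ∈ Q) := by
    simp only [coefOn, map_sum, Finset.sum_mul]
    rw [Finset.sum_comm' (t' := J.filter fun i => (a i, e i) ∈ Q) (s' := fun i => {(a i, e i)})]
    · simp [sumOn]
    · intro p i
      simp only [Finset.mem_filter, Finset.mem_singleton]
      constructor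
      · rintro ⟨hp, hi, rfl⟩; exact ⟨rfl, hi, hp⟩
      · rintro ⟨rfl, hi, hp⟩; exact ⟨hp, hi, rfl⟩
  rw [h1, sub_eq_iff_eq_add, add_comm, sumOn, sumOn, sumOn, Finset.sum_filter_add_sum_filter_not]

/-- Removing the terms of exponent at least `j`. -/
theorem sumOn_sub_top [DecidableEq ι] {Q : Finset (F × ℕ)} {j : ℕ}
    (hQ : ∀ i ∈ J, (a i, e i) ∈ Q ↔ j ≤ e i) :
    sumOn α a e J - ∑ p ∈ Q, C (coefOn α a e J p) * (X - C p.1) ^ p.2 =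
      sumOn α a e (J.filter fun i => e i < j) := by
  classical
  rw [sumOn_sub_sum_coefOn]
  congr 1
  exact Finset.filter_congr fun i hi => by rw [hQ i hi, not_le]

theorem iterate_derivative_sumOn_eq_zero {j : ℕ} (h : ∀ i ∈ J, e i < j) :
    derivative^[j] (sumOn α a e J) = 0 := by
  rw [sumOn, iterate_derivative_sum]
  refine Finset.sum_eq_zero fun i hi => ?_
  rw [iterate_derivative_affinePower, Nat.descFactorial_of_lt (h i hi)]; simp

end Sparse

/-! ### Lists and listings -/

section Lists

variable {F : Type u} {ι : Type*}

theorem filter_val_add (J : Finset ι) (j : ℕ) (α a : ι → F) (e : ι → ℕ) :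
    (J.val.map fun i => (α i, a i, e i)) =
      ((J.filter fun i => j ≤ e i).val.map fun i => (α i, a i, e i)) +
      ((J.filter fun i => e i < j).val.map fun i => (α i, a i, e i)) := by
  classical
  rw [← Multiset.map_add, Finset.filter_val, Finset.filter_val]
  congr 1
  conv_lhs => rw [← Multiset.filter_add_not (fun i => j ≤ e i) J.val]
  simp only [not_le]

theorem filter_eq_takeWhile {β : Type*} {p : β → Bool} {L : List β}
    (h : L.Pairwise fun x y => p y = true → p x = true) : L.filter p = L.takeWhile p := by
  induction L with
  | nil => rfl
  | cons x L ih =>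
    rw [List.pairwise_cons] at h
    by_cases hx : p x = true
    · rw [List.filter_cons_of_pos hx, List.takeWhile_cons_of_pos hx, ih h.2]
    · rw [List.filter_cons_of_neg hx, List.takeWhile_cons_of_neg hx, List.filter_eq_nil_iff]
      exact fun y hy hpy => hx (h.1 y hy hpy)

/-- A list sorted by decreasing exponents can be extended to a sorted list of all elements of a
finite set, without changing the order of its elements. -/
theorem exists_sorted_extension {S : Set (F × ℕ)} (hS : S.Finite) {A : List (F × ℕ)} (hA : A.Nodup)
    (hAS : ∀ p ∈ A, p ∈ S) (hs : A.Pairwise fun p q => q.2 ≤ p.2) :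
    ∃ ℓ : List (F × ℕ), ℓ.Nodup ∧ (∀ p, p ∈ ℓ ↔ p ∈ S) ∧ (ℓ.Pairwise fun p q => q.2 ≤ p.2) ∧
      ∀ f : F × ℕ → Bool, (∀ p ∈ S, f p = true ↔ p ∈ A) → ℓ.filter f = A := by
  classical
  set r : F × ℕ → F × ℕ → Prop := fun p q => q.2 ≤ p.2
  have : Std.Total r := ⟨fun p q => le_total q.2 p.2⟩
  have : IsTrans (F × ℕ) r := ⟨fun p q s h1 h2 => le_trans h2 h1⟩
  set B := (hS.toFinset \ A.toFinset).toList with hB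
  have hBmem : ∀ p, p ∈ B ↔ p ∈ S ∧ p ∉ A := fun p => by simp [hB]
  have key : ∀ B : List (F × ℕ), (B.foldr (List.orderedInsert r) A).Perm (B ++ A) ∧
      (B.foldr (List.orderedInsert r) A).Pairwise r ∧
      A.Sublist (B.foldr (List.orderedInsert r) A) := by
    intro B
    induction B with
    | nil => exact ⟨List.Perm.refl _, hs, List.Sublist.refl _⟩
    | cons x B ih =>
      refine ⟨(List.perm_orderedInsert r x _).trans (ih.1.cons x), ih.2.1.orderedInsert x _,
        ih.2.2.trans (List.sublist_orderedInsert x _)⟩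
  obtain ⟨hperm, hsort, hsub⟩ := key B
  refine ⟨_, ?_, ?_, hsort, ?_⟩
  · rw [hperm.nodup_iff]
    exact (Finset.nodup_toList _).append hA fun p hp hpA => ((hBmem p).1 hp).2 hpA
  · intro p
    rw [hperm.mem_iff, List.mem_append, hBmem]
    have := hAS p
    tauto
  · intro f hf
    have hAf : A.filter f = A := List.filter_eq_self.2 fun p hp => (hf p (hAS p hp)).2 hp
    have hBf : B.filter f = [] := List.filter_eq_nil_iff.2 fun p hp hfp =>
      ((hBmem p).1 hp).2 ((hf p ((hBmem p).1 hp).1).1 hfp)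
    refine (List.Sublist.eq_of_length (l₁ := A) ?_ ?_).symm
    · have := hsub.filter f
      rwa [hAf] at this
    · rw [(hperm.filter f).length_eq, List.filter_append, hAf, hBf, List.nil_append]

theorem map_range'_getD {β : Type*} (ℓ : List β) (x : β) {r : ℕ} (hr : r ≤ ℓ.length) :
    ((List.range' 1 r).map fun i => ℓ.getD (i - 1) x) = ℓ.take r := by
  refine List.ext_getElem (by simp [hr]) fun n h1 h2 => ?_
  simp only [List.length_map, List.length_range'] at h1
  simp [List.getElem_range', List.getElem?_eq_getElem (show n < ℓ.length by omega)]

end Lists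

/-! ### Runs of the algorithm -/

section Build

variable {F : Type u} [Field F] {ι : Type*} {α a : ι → F} {e : ι → ℕ} {J : Finset ι}

theorem order_lt_of_isMinimalSDE (hJ : J.Nonempty) {t : ℕ}
    {P : ℕ → F[X]} (hmin : IsMinimalSDE (sumOn α a e J) t P) : t + 1 ≤ 2 * J.card := by
  have hpos := Finset.card_pos.2 hJ
  obtain ⟨Q, hQ, hQs⟩ := exists_isSDE J α a e (t := 2 * J.card - 1) (by omega)
  have := hmin.2.2 _ Q hQ hQs
  omega

theorem exists_isMinimalSDE (α a : ι → F) (e : ι → ℕ) (J : Finset ι) :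
    ∃ t P, IsMinimalSDE (sumOn α a e J) t P := by
  classical
  have hex : ∃ t, ∃ P, IsSDE t 0 P ∧ Satisfies t P (sumOn α a e J) :=
    ⟨2 * J.card, exists_isSDE J α a e (by omega)⟩
  obtain ⟨P, hP, hPs⟩ := Nat.find_spec hex
  exact ⟨Nat.find hex, P, hP, hPs, fun k Q hQ hQs => Nat.find_min' hex ⟨Q, hQ, hQs⟩⟩

theorem two_mul_le_of_mem_affineSolutions {f : F[X]} {t : ℕ} {P : ℕ → F[X]} {p : F × ℕ}
    (hp : p ∈ affineSolutions f t P) : (t + 1) ^ 2 ≤ 2 * p.2 := by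
  have := hp.1
  have : ((t : ℚ) + 1) ^ 2 ≤ 2 * p.2 := by linarith
  exact_mod_cast this

theorem finite_affineSolutions [CharZero F] {f : F[X]} {t : ℕ} {P : ℕ → F[X]}
    (hP : IsSDE t 0 P) : (affineSolutions f t P).Finite := by
  by_contra hinf
  obtain ⟨Q, hQ, hcard⟩ := Set.Infinite.exists_subset_card_eq hinf (t + 1)
  have := card_affineSolutions_le hP.1 (Q := Q) fun p hp =>
    ⟨two_mul_le_of_mem_affineSolutions (hQ hp), (hQ hp).2.2⟩
  omega

theorem IsSparse.mem_affineSolutions [CharZero F] (h : IsSparse α a e J) {t : ℕ} {P : ℕ → F[X]}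
    (hP : IsSDE t 0 P) (hsat : Satisfies t P (sumOn α a e J)) {i : ι} (hi : i ∈ J)
    (hle : ((t : ℚ) + 1) ^ 2 / 2 ≤ e i) :
    (a i, e i) ∈ affineSolutions (sumOn α a e J) t P := by
  have hle' : (t + 1) ^ 2 ≤ 2 * e i := by
    have : ((t : ℚ) + 1) ^ 2 ≤ 2 * e i := by linarith
    exact_mod_cast this
  refine ⟨hle, ?_, h.satisfies hP hsat hi hle'⟩
  have h1 := h.exponent_le_natDegree hi
  have h2 := h.card_bound_natDegree ⟨i, hi⟩
  set s := J.card
  set D := (sumOn α a e J).natDegree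
  have h3 : s * (s - 1) ≤ s * s := Nat.mul_le_mul_left _ (Nat.sub_le _ _)
  have h4 : 2 * s ≤ D := by nlinarith
  have h5 : 8 * e i ≤ 8 * D + (D + 2) ^ 2 := by nlinarith
  have h6 : (8 * e i : ℚ) ≤ 8 * D + (D + 2) ^ 2 := by exact_mod_cast h5
  simp only
  linarith

/-- The listing of a set that is given by a list. -/
theorem isListing_of_list {S : Set (F × ℕ)} {ℓ : List (F × ℕ)} (hnd : ℓ.Nodup)
    (hmem : ∀ p, p ∈ ℓ ↔ p ∈ S) (hs : ℓ.Pairwise fun p q => q.2 ≤ p.2) :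
    IsListing S ℓ.length (fun i => (ℓ.getD (i - 1) (0, 0)).1)
      (fun i => (ℓ.getD (i - 1) (0, 0)).2) := by
  have hget : ∀ i (hi : i ∈ Set.Icc 1 ℓ.length),
      ℓ.getD (i - 1) (0, 0) = ℓ[i - 1]'(by have := hi.1; have := hi.2; omega) := by
    intro i hi
    rw [List.getD_eq_getElem]
  refine ⟨⟨?_, ?_, ?_⟩, ?_⟩
  · intro i hi
    simp only [Prod.mk.eta, hget i hi]
    exact (hmem _).1 (List.getElem_mem _)
  · intro i hi k hk hik
    simp only [Prod.mk.eta, hget i hi, hget k hk] at hik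
    have := (hnd.getElem_inj_iff).1 hik
    have := hi.1; have := hk.1
    omega
  · intro p hp
    obtain ⟨n, hn, rfl⟩ := List.getElem_of_mem ((hmem p).2 hp)
    refine ⟨n + 1, ⟨by omega, by omega⟩, ?_⟩
    simp only [Prod.mk.eta, Nat.add_sub_cancel]
    exact List.getD_eq_getElem _ _ hn
  · intro i hi k hk hik
    simp only [hget i hi, hget k hk]
    rcases hik.eq_or_lt with rfl | hlt
    · exact le_rfl
    · have := hi.1
      exact List.pairwise_iff_getElem.1 hs (i - 1) (k - 1) _ _ (by omega)

theorem exists_isListing {S : Set (F × ℕ)} (hS : S.Finite) :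
    ∃ l b d, IsListing S l b d := by
  classical
  set r : F × ℕ → F × ℕ → Prop := fun p q => q.2 ≤ p.2
  have : Std.Total r := ⟨fun p q => le_total q.2 p.2⟩
  have : IsTrans (F × ℕ) r := ⟨fun p q s h1 h2 => le_trans h2 h1⟩
  set ℓ := hS.toFinset.toList.insertionSort r with hℓ
  refine ⟨_, _, _, isListing_of_list (ℓ := ℓ) ?_ ?_ (List.pairwise_insertionSort r _)⟩
  · exact (List.perm_insertionSort r _).nodup_iff.2 (Finset.nodup_toList _)
  · intro p; rw [(List.perm_insertionSort r _).mem_iff]; simp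

/-- What makes Steps 3, 4 and 5 of the algorithm work, for a fixed choice of the equation, of the
listing and of the cut. -/
structure CutSpec (α a : ι → F) (e : ι → ℕ) (J : Finset ι) (b : ℕ → F) (d : ℕ → ℕ) (r : ℕ) :
    Prop where
  injOn : Set.InjOn (fun k => (b k, d k)) (Finset.Icc 1 r : Finset ℕ)
  mem_iff : ∀ i ∈ J, (∃ k ∈ Finset.Icc 1 r, (b k, d k) = (a i, e i)) ↔ cutOrder d r ≤ e i
  cutOrder_le : ∀ k ∈ Finset.Icc 1 r, cutOrder d r ≤ d k
  gap : ∀ k ∈ Finset.Icc 1 r, r * (r - 1) < 2 * (d k - cutOrder d r) + 2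
  progress : ∃ i ∈ J, cutOrder d r ≤ e i

theorem exponentAt_ge {f : F[X]} {t l : ℕ} {P : ℕ → F[X]} {b : ℕ → F} {d : ℕ → ℕ}
    (hlist : IsListing (affineSolutions f t P) l b d) {i : ℕ} (hi : 1 ≤ i) :
    ((t : ℚ) + 1) ^ 2 / 2 ≤ exponentAt t l d i := by
  rw [exponentAt]
  split_ifs with h
  · exact (hlist.1.mapsTo (⟨hi, h⟩ : i ∈ Set.Icc 1 l)).1
  · exact le_rfl

/-- At a cut, the terms of exponent at least the order of differentiation are all listed: such an
exponent exceeds the next exponent in the list. -/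
theorem IsSparse.cutSpec [CharZero F] (h : IsSparse α a e J) (hJ : J.Nonempty) {t l r : ℕ}
    {P : ℕ → F[X]} {b : ℕ → F} {d : ℕ → ℕ} (hmin : IsMinimalSDE (sumOn α a e J) t P)
    (hlist : IsListing (affineSolutions (sumOn α a e J) t P) l b d)
    (hcut : IsCut (sumOn α a e J) t l d r) : CutSpec α a e J b d r := by
  obtain ⟨hr1, hrl, hdrop, hdeg⟩ := hcut
  have hxr : exponentAt t l d r = d r := if_pos hrl
  have hge : ((t : ℚ) + 1) ^ 2 / 2 ≤ exponentAt t l d (r + 1) := exponentAt_ge hlist (by omega)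
  rw [hxr] at hdrop
  have hpos : 0 ≤ ((t : ℚ) + 1) ^ 2 / 2 := by positivity
  have hq : (0 : ℚ) ≤ (d r : ℚ) - (r : ℚ) ^ 2 / 2 := by linarith
  have hsub : ∀ k ∈ Finset.Icc 1 r, k ∈ Set.Icc 1 l := fun k hk => by
    rw [Finset.mem_Icc] at hk; exact ⟨hk.1, hk.2.trans hrl⟩
  have hdk : ∀ k ∈ Finset.Icc 1 r, d r ≤ d k := fun k hk =>
    hlist.2 (hsub k hk) ⟨hr1, hrl⟩ (Finset.mem_Icc.1 hk).2
  have hjr : cutOrder d r ≤ d r := by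
    rw [cutOrder, Nat.ceil_le]
    have : (0 : ℚ) ≤ (r : ℚ) ^ 2 / 2 := by positivity
    linarith
  have hjlt : (cutOrder d r : ℚ) < d r - (r : ℚ) ^ 2 / 2 + 1 := Nat.ceil_lt_add_one hq
  -- A term whose exponent exceeds the next one in the list is listed before the cut.
  have hlisted : ∀ i ∈ J, exponentAt t l d (r + 1) < e i →
      ∃ k ∈ Finset.Icc 1 r, (b k, d k) = (a i, e i) := by
    intro i hi hlt
    have hS := h.mem_affineSolutions hmin.1 hmin.2.1 hi (hge.trans hlt.le)
    obtain ⟨k, hk, hkeq⟩ := hlist.1.surjOn hS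
    refine ⟨k, Finset.mem_Icc.2 ⟨hk.1, ?_⟩, hkeq⟩
    by_contra! hrk
    have hrl' : r + 1 ≤ l := by have := hk.2; omega
    have h1 : d k ≤ d (r + 1) := hlist.2 ⟨by omega, hrl'⟩ hk hrk
    rw [exponentAt, if_pos hrl'] at hlt
    have h2 : d k = e i := (Prod.ext_iff.1 hkeq).2
    have h3 : d (r + 1) < e i := by exact_mod_cast hlt
    omega
  refine ⟨fun k hk k' hk' hkk => hlist.1.injOn (hsub k hk) (hsub k' hk') hkk, ?_, ?_, ?_, ?_⟩
  · intro i hi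
    constructor
    · rintro ⟨k, hk, hkeq⟩
      have h2 : d k = e i := (Prod.ext_iff.1 hkeq).2
      exact h2 ▸ hjr.trans (hdk k hk)
    · intro hj
      refine hlisted i hi ?_
      have : (d r : ℚ) - (r : ℚ) ^ 2 / 2 ≤ e i := Nat.ceil_le.1 hj
      linarith
  · exact fun k hk => hjr.trans (hdk k hk)
  · intro k hk
    have h1 := hdk k hk
    have h2 : (r : ℚ) ^ 2 < 2 * ((d k - cutOrder d r : ℕ) : ℚ) + 2 := by
      rw [Nat.cast_sub (hjr.trans h1)]
      have : (d r : ℚ) ≤ d k := by exact_mod_cast h1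
      linarith
    have h3 : r ^ 2 < 2 * (d k - cutOrder d r) + 2 := by exact_mod_cast h2
    have h4 : r * (r - 1) ≤ r * r := Nat.mul_le_mul_left _ (Nat.sub_le _ _)
    nlinarith
  · obtain ⟨i, hi, hmax⟩ := exists_max_exponent e hJ
    have hi' : (sumOn α a e J).natDegree ≤ e i := natDegree_sumOn_le hmax
    have h1 : exponentAt t l d (r + 1) < e i :=
      hdeg.trans_le (by exact_mod_cast hi')
    obtain ⟨k, hk, hkeq⟩ := hlisted i hi h1
    have h2 : d k = e i := (Prod.ext_iff.1 hkeq).2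
    exact ⟨i, hi, h2 ▸ hjr.trans (hdk k hk)⟩

/-- Step 3: an index with a sufficient drop exists, because the listed exponents descend from at least
`deg f` to the threshold in at most `t` steps. -/
theorem IsSparse.exists_isCut [CharZero F] (h : IsSparse α a e J) (hJ : J.Nonempty) {t l : ℕ}
    {P : ℕ → F[X]} {b : ℕ → F} {d : ℕ → ℕ} (hmin : IsMinimalSDE (sumOn α a e J) t P)
    (hlist : IsListing (affineSolutions (sumOn α a e J) t P) l b d) :
    ∃ r, IsCut (sumOn α a e J) t l d r := by
  classical
  have ht := order_lt_of_isMinimalSDE hJ hmin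
  have hD := h.card_bound_natDegree hJ
  have hs := Finset.card_pos.2 hJ
  have hl : l ≤ t := by
    have := card_affineSolutions_le hmin.1.1 (Q := (Finset.Icc 1 l).image fun k => (b k, d k)) ?_
    · rwa [Finset.card_image_of_injOn (by simpa using hlist.1.injOn), Nat.card_Icc,
        Nat.add_sub_cancel] at this
    · intro p hp
      obtain ⟨k, hk, rfl⟩ := Finset.mem_image.1 hp
      have := hlist.1.mapsTo (Finset.mem_Icc.1 hk : k ∈ Set.Icc 1 l)
      exact ⟨two_mul_le_of_mem_affineSolutions this, this.2.2⟩
  set θ : ℚ := ((t : ℚ) + 1) ^ 2 / 2 with hθ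
  have hθ' : 2 * θ ≤ (t + 1) * (t + 2) + 2 := by
    have : (0 : ℚ) ≤ t := Nat.cast_nonneg t
    rw [hθ]; nlinarith
  have hsum := threshold_add_sum_lt hD hs ht hl hθ'
  obtain ⟨i, hi, hmax⟩ := exists_max_exponent e hJ
  have hi' : ((sumOn α a e J).natDegree : ℚ) ≤ e i := by exact_mod_cast natDegree_sumOn_le hmax
  have hθe : θ ≤ e i := by
    have : 0 ≤ ∑ i ∈ Finset.range (l + 1), (i : ℚ) ^ 2 / 2 :=
      Finset.sum_nonneg fun i _ => by positivity
    linarith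
  obtain ⟨k, hk, hkeq⟩ := hlist.1.surjOn (h.mem_affineSolutions hmin.1 hmin.2.1 hi hθe)
  have hl1 : 1 ≤ l := hk.1.trans hk.2
  have hx1 : ((sumOn α a e J).natDegree : ℚ) ≤ exponentAt t l d 1 := by
    rw [exponentAt, if_pos hl1]
    have h1 : d k ≤ d 1 := hlist.2 ⟨le_rfl, hl1⟩ hk hk.1
    have h2 : d k = e i := (Prod.ext_iff.1 hkeq).2
    have h3 : (e i : ℚ) ≤ d 1 := by exact_mod_cast h2 ▸ h1
    linarith
  have hxl : exponentAt t l d (l + 1) = θ := if_neg (by omega)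
  obtain ⟨r, hr1, hrl, hdrop, hdeg⟩ := exists_drop (exponentAt t l d) l _ hx1 (hxl ▸ hsum)
  exact ⟨r, hr1, hrl, hdrop, hdeg⟩

theorem isExpression_iff (f : F[X]) (b : ℕ → F) (d : ℕ → ℕ) (r : ℕ) (β : ℕ → F) :
    IsExpression f b d r β ↔ derivative^[cutOrder d r] (remainder f b d r β) = 0 := by
  rw [IsExpression, remainder, iterate_derivative_sub, sub_eq_zero, iterate_derivative_sum]
  simp only [iterate_derivative_affinePower]

section Cut

variable {b : ℕ → F} {d : ℕ → ℕ} {r : ℕ}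

/-- With the coefficients of the sum, a pass removes the terms of exponent at least the order of
differentiation. -/
theorem CutSpec.remainder_eq [DecidableEq ι] (hc : CutSpec α a e J b d r) {β : ℕ → F}
    (hβ : ∀ k ∈ Finset.Icc 1 r, β k = coefOn α a e J (b k, d k)) :
    remainder (sumOn α a e J) b d r β =
      sumOn α a e (J.filter fun i => e i < cutOrder d r) := by
  classical
  rw [← sumOn_sub_top (Q := (Finset.Icc 1 r).image fun k => (b k, d k)) (j := cutOrder d r),
    remainder, Finset.sum_image hc.injOn]
  · congr 1
    exact Finset.sum_congr rfl fun k hk => by rw [hβ k hk]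
  · intro i hi
    rw [← hc.mem_iff i hi, Finset.mem_image]

theorem CutSpec.isExpression (hc : CutSpec α a e J b d r) :
    IsExpression (sumOn α a e J) b d r fun k => coefOn α a e J (b k, d k) := by
  classical
  rw [isExpression_iff, hc.remainder_eq fun _ _ => rfl]
  exact iterate_derivative_sumOn_eq_zero fun i hi => (Finset.mem_filter.1 hi).2

/-- Step 4 has a unique solution: the listed powers are independent modulo polynomials of degree less
than the order of differentiation. -/
theorem CutSpec.eq_coefOn [CharZero F] (hc : CutSpec α a e J b d r) {β : ℕ → F}
    (hβ : IsExpression (sumOn α a e J) b d r β) :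
    ∀ k ∈ Finset.Icc 1 r, β k = coefOn α a e J (b k, d k) := by
  classical
  set g : ℕ → F × ℕ := fun k => (b k, d k) with hg
  set inv := Function.invFunOn g (Finset.Icc 1 r : Finset ℕ) with hinv
  have hinv' : ∀ k ∈ Finset.Icc 1 r, inv (g k) = k := fun k hk =>
    hc.injOn.leftInvOn_invFunOn (Finset.mem_coe.2 hk)
  have hcard : ((Finset.Icc 1 r).image g).card = r := by
    rw [Finset.card_image_of_injOn hc.injOn, Nat.card_Icc, Nat.add_sub_cancel]
  have key := eq_zero_of_iterate_derivative_eq_zero (Q := (Finset.Icc 1 r).image g)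
    (j := cutOrder d r) (c := fun p => coefOn α a e J p - β (inv p)) ?_ ?_ ?_
  · intro k hk
    have := key (g k) (Finset.mem_image_of_mem _ hk)
    rw [hinv' k hk] at this
    exact (sub_eq_zero.1 this).symm
  · intro p hp
    obtain ⟨k, hk, rfl⟩ := Finset.mem_image.1 hp
    exact hc.cutOrder_le k hk
  · intro p hp
    obtain ⟨k, hk, rfl⟩ := Finset.mem_image.1 hp
    rw [hcard]; exact hc.gap k hk
  · have h1 := (isExpression_iff _ _ _ _ _).1 hβ
    have h2 := (isExpression_iff _ _ _ _ _).1 hc.isExpression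
    rw [Finset.sum_image hc.injOn]
    have : ∑ k ∈ Finset.Icc 1 r, C (coefOn α a e J (g k) - β (inv (g k))) *
        (X - C (g k).1) ^ (g k).2 =
        remainder (sumOn α a e J) b d r β -
          remainder (sumOn α a e J) b d r (fun k => coefOn α a e J (b k, d k)) := by
      rw [remainder, remainder, sub_sub_sub_cancel_left, ← Finset.sum_sub_distrib]
      refine Finset.sum_congr rfl fun k hk => ?_
      rw [hinv' k hk, C_sub, sub_mul]
    rw [this, iterate_derivative_sub, h1, h2, sub_zero]

theorem IsSparse.nodup_triples (h : IsSparse α a e J) {K : Finset ι} (hK : K ⊆ J) :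
    (K.val.map fun i => (α i, a i, e i)).Nodup := by
  refine Multiset.Nodup.map_on ?_ K.nodup
  intro x hx y hy hxy
  simp only [Prod.mk.injEq] at hxy
  exact h.injOn (hK hx) (hK hy) hxy.2.1

theorem CutSpec.extracted_eq (hc : CutSpec α a e J b d r) (h : IsSparse α a e J) {β : ℕ → F}
    (hβ : ∀ k ∈ Finset.Icc 1 r, β k = coefOn α a e J (b k, d k)) :
    (extracted b d r β : Multiset (F × F × ℕ)) =
      (J.filter fun i => cutOrder d r ≤ e i).val.map fun i => (α i, a i, e i) := by
  classical
  have hmem : ∀ k, k ∈ List.range' 1 r ↔ k ∈ Finset.Icc 1 r := fun k => by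
    rw [List.mem_range'_1, Finset.mem_Icc]; omega
  refine (Multiset.Nodup.ext ?_ (h.nodup_triples (Finset.filter_subset _ _))).2 ?_
  · rw [Multiset.coe_nodup, extracted]
    refine List.Nodup.map_on ?_ (List.Nodup.filter _ List.nodup_range')
    intro x hx y hy hxy
    rw [List.mem_filter, hmem] at hx hy
    simp only [Prod.mk.injEq] at hxy
    exact hc.injOn (Finset.mem_coe.2 hx.1) (Finset.mem_coe.2 hy.1) (Prod.ext hxy.2.1 hxy.2.2)
  · intro x
    simp only [extracted, Multiset.mem_coe, List.mem_map, List.mem_filter, hmem, decide_eq_true_eq,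
      Multiset.mem_map, Finset.mem_val, Finset.mem_filter]
    constructor
    · rintro ⟨k, ⟨hk, hk0⟩, rfl⟩
      rw [hβ k hk] at hk0 ⊢
      obtain ⟨i, hi, hik⟩ := h.coefOn_ne_zero.1 hk0
      refine ⟨i, ⟨hi, (hc.mem_iff i hi).1 ⟨k, hk, hik.symm⟩⟩, ?_⟩
      rw [← hik, h.coefOn_eq hi]
    · rintro ⟨i, ⟨hi, hj⟩, rfl⟩
      obtain ⟨k, hk, hik⟩ := (hc.mem_iff i hi).2 hj
      have hb : β k = α i := by rw [hβ k hk, hik, h.coefOn_eq hi]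
      refine ⟨k, ⟨hk, hb ▸ h.ne_zero i hi⟩, ?_⟩
      simp only [Prod.mk.injEq] at hik ⊢
      exact ⟨hb, hik⟩

end Cut

theorem card_filter_lt {j : ℕ} (h : ∃ i ∈ J, j ≤ e i) :
    (J.filter fun i => e i < j).card < J.card := by
  obtain ⟨i, hi, hj⟩ := h
  exact Finset.card_lt_card (Finset.filter_ssubset.2 ⟨i, hi, by omega⟩)

/-- Whatever the choices, the algorithm finds the terms of a sparse sum, in as many passes as there
are terms, at most. -/
theorem IsSparse.buildsTo [CharZero F] (n : ℕ) :
    ∀ J : Finset ι, IsSparse α a e J → J.card ≤ n →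
      BuildsTo n (sumOn α a e J) (J.val.map fun i => (α i, a i, e i)) := by
  classical
  induction n with
  | zero =>
    intro J _ hn
    obtain rfl := Finset.card_eq_zero.1 (Nat.le_zero.1 hn)
    exact ⟨by simp [sumOn], by simp⟩
  | succ n ih =>
    intro J h hn
    rcases J.eq_empty_or_nonempty with rfl | hJ
    · exact Or.inl ⟨by simp [sumOn], by simp⟩
    refine Or.inr ⟨h.sumOn_ne_zero hJ, ⟨exists_isMinimalSDE α a e J, ?_⟩, ?_⟩
    · intro t P hmin
      refine ⟨exists_isListing (finite_affineSolutions hmin.1), ?_⟩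
      intro l b d hlist
      exact ⟨h.exists_isCut hJ hmin hlist, fun r hr =>
        ⟨_, (h.cutSpec hJ hmin hlist hr).isExpression⟩⟩
    · rintro A g ⟨t, P, l, b, d, r, β, hmin, hlist, hcut, hβ, rfl, rfl⟩
      have hc := h.cutSpec hJ hmin hlist hcut
      have hβ' := hc.eq_coefOn hβ
      refine ⟨(J.filter fun i => e i < cutOrder d r).val.map fun i => (α i, a i, e i),
        (filter_val_add J (cutOrder d r) α a e).trans ?_, ?_⟩
      · rw [hc.extracted_eq h hβ']
      · rw [hc.remainder_eq hβ']
        have := card_filter_lt hc.progress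
        exact ih _ (h.mono (Finset.filter_subset _ _)) (by omega)

/-- Every list of the terms by decreasing exponents is the output of some run: the order of the
terms of equal exponent can be prescribed. -/
theorem IsSparse.buildRun [CharZero F] (n : ℕ) :
    ∀ (J : Finset ι) (L : List (F × F × ℕ)), IsSparse α a e J → J.card ≤ n →
      (L : Multiset (F × F × ℕ)) = (J.val.map fun i => (α i, a i, e i)) →
      (L.Pairwise fun p q => q.2.2 ≤ p.2.2) → BuildRun (sumOn α a e J) L := by
  classical
  induction n with
  | zero =>
    intro J L _ hn hL _
    obtain rfl := Finset.card_eq_zero.1 (Nat.le_zero.1 hn)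
    simp only [Finset.empty_val, Multiset.map_zero, Multiset.coe_eq_zero] at hL
    subst hL
    simpa [sumOn] using BuildRun.done (F := F)
  | succ n ih =>
    intro J L h hn hL hsort
    rcases J.eq_empty_or_nonempty with rfl | hJ
    · simp only [Finset.empty_val, Multiset.map_zero, Multiset.coe_eq_zero] at hL
      subst hL
      simpa [sumOn] using BuildRun.done (F := F)
    obtain ⟨t, P, hmin⟩ := exists_isMinimalSDE α a e J
    set f := sumOn α a e J with hf
    have hS := finite_affineSolutions (f := f) hmin.1
    have hmemL : ∀ x, x ∈ L ↔ ∃ i ∈ J, (α i, a i, e i) = x := fun x => by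
      rw [← Multiset.mem_coe, hL]; simp
    -- The terms of `L` that satisfy the equation form an initial segment of `L`.
    set big : F × F × ℕ → Bool := fun x => decide ((t + 1) ^ 2 ≤ 2 * x.2.2) with hbig
    have htw : L.filter big = L.takeWhile big := by
      refine filter_eq_takeWhile (hsort.imp ?_)
      intro x y hxy hy
      simp only [hbig, decide_eq_true_eq] at hy ⊢
      omega
    set A := (L.filter big).map Prod.snd with hA
    have hLnd : L.Nodup := by
      rw [← Multiset.coe_nodup, hL]; exact h.nodup_triples subset_rfl
    have hinj : Set.InjOn (Prod.snd : F × F × ℕ → F × ℕ) {x | x ∈ L} := by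
      intro x hx y hy hxy
      obtain ⟨i, hi, rfl⟩ := (hmemL x).1 hx
      obtain ⟨k, hk, rfl⟩ := (hmemL y).1 hy
      simp only [Prod.mk.injEq] at hxy
      rw [h.injOn hi hk hxy.1]
    have hAmem : ∀ p, p ∈ A ↔ ∃ i ∈ J, (a i, e i) = p ∧ (t + 1) ^ 2 ≤ 2 * p.2 := by
      intro p
      simp only [hA, List.mem_map, List.mem_filter, hmemL, hbig, decide_eq_true_eq]
      constructor
      · rintro ⟨x, ⟨⟨i, hi, rfl⟩, hx⟩, rfl⟩; exact ⟨i, hi, rfl, hx⟩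
      · rintro ⟨i, hi, rfl, hx⟩; exact ⟨_, ⟨⟨i, hi, rfl⟩, hx⟩, rfl⟩
    have hAnd : A.Nodup := List.Nodup.map_on
      (fun x hx y hy hxy => hinj (List.mem_filter.1 hx).1 (List.mem_filter.1 hy).1 hxy)
      (hLnd.filter _)
    have hq : ∀ m : ℕ, (t + 1) ^ 2 ≤ 2 * m → ((t : ℚ) + 1) ^ 2 / 2 ≤ m := by
      intro m hm
      have : ((t : ℚ) + 1) ^ 2 ≤ 2 * m := by exact_mod_cast hm
      linarith
    have hAS : ∀ p ∈ A, p ∈ affineSolutions f t P := by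
      intro p hp
      obtain ⟨i, hi, rfl, hle⟩ := (hAmem p).1 hp
      exact h.mem_affineSolutions hmin.1 hmin.2.1 hi (hq _ hle)
    have hAsort : A.Pairwise fun p q => q.2 ≤ p.2 :=
      List.pairwise_map.2 (hsort.filter _)
    obtain ⟨ℓ, hnd, hmem, hsrt, hfil⟩ := exists_sorted_extension hS hAnd hAS hAsort
    have hfA := hfil (fun p => decide (coefOn α a e J p ≠ 0)) (by
      intro p hp
      rw [decide_eq_true_eq, h.coefOn_ne_zero, hAmem]
      have := two_mul_le_of_mem_affineSolutions hp
      constructor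
      · rintro ⟨i, hi, hip⟩; exact ⟨i, hi, hip, this⟩
      · rintro ⟨i, hi, hip, _⟩; exact ⟨i, hi, hip⟩)
    have hlist := isListing_of_list hnd hmem hsrt
    obtain ⟨r, hcut⟩ := h.exists_isCut hJ hmin hlist
    have hc := h.cutSpec hJ hmin hlist hcut
    set b : ℕ → F := fun i => (ℓ.getD (i - 1) (0, 0)).1 with hb
    set d : ℕ → ℕ := fun i => (ℓ.getD (i - 1) (0, 0)).2 with hd
    set β : ℕ → F := fun k => coefOn α a e J (b k, d k) with hβ
    -- The extracted triples are an initial segment of `L`.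
    have hext : extracted b d r β =
        ((ℓ.take r).filter fun p => decide (coefOn α a e J p ≠ 0)).map
          fun p => (coefOn α a e J p, p) := by
      rw [← map_range'_getD ℓ (0, 0) hcut.2.1, List.filter_map, List.map_map, extracted]
      rfl
    have hpre : extracted b d r β <+: L := by
      have h1 : (ℓ.take r).filter (fun p => decide (coefOn α a e J p ≠ 0)) <+: A :=
        hfA ▸ (List.take_prefix r ℓ).filter _
      have h2 := h1.map fun p => (coefOn α a e J p, p)
      rw [← hext, hA, List.map_map] at h2
      have h3 : (L.filter big).map ((fun p => (coefOn α a e J p, p)) ∘ Prod.snd) = L.filter big := by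
        conv_rhs => rw [← List.map_id (L.filter big)]
        refine List.map_congr_left fun x hx => ?_
        obtain ⟨i, hi, rfl⟩ := (hmemL x).1 (List.mem_filter.1 hx).1
        simp [h.coefOn_eq hi]
      rw [h3, htw] at h2
      exact h2.trans (List.takeWhile_prefix _)
    obtain ⟨L', hL'⟩ := hpre
    have hβ' : ∀ k ∈ Finset.Icc 1 r, β k = coefOn α a e J (b k, d k) := fun _ _ => rfl
    rw [← hL']
    refine BuildRun.pass (h.sumOn_ne_zero hJ)
      ⟨t, P, ℓ.length, b, d, r, β, hmin, hlist, hcut, hc.isExpression, rfl, rfl⟩ ?_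
    rw [hc.remainder_eq hβ']
    have hlt := card_filter_lt hc.progress
    refine ih _ _ (h.mono (Finset.filter_subset _ _)) (by omega) ?_ ?_
    · rw [← hL', ← Multiset.coe_add, hc.extracted_eq h hβ', filter_val_add J (cutOrder d r)] at hL
      exact add_left_cancel hL
    · rw [← hL'] at hsort
      exact (List.pairwise_append.1 hsort).2.1

theorem coefOn_eq_zero [DecidableEq F] {p : F × ℕ} (hp : p ∉ J.image fun i => (a i, e i)) :
    coefOn α a e J p = 0 := by
  unfold coefOn
  refine Finset.sum_eq_zero fun i hi => absurd ?_ hp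
  simp only [Finset.mem_filter] at hi
  exact Finset.mem_image.2 ⟨i, hi⟩

theorem sumOn_eq_sum_coefOn [DecidableEq F] (α a : ι → F) (e : ι → ℕ) {W : Finset (F × ℕ)}
    (hW : J.image (fun i => (a i, e i)) ⊆ W) :
    sumOn α a e J = ∑ p ∈ W, C (coefOn α a e J p) * (X - C p.1) ^ p.2 := by
  classical
  have := sumOn_sub_top (α := α) (a := a) (e := e) (J := J) (Q := W) (j := 0)
    (fun i hi => by simpa using hW (Finset.mem_image_of_mem _ hi))
  simpa [sumOn, sub_eq_zero] using this

/-- A sparse sum is not a combination of fewer affine powers. -/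
theorem IsSparse.card_le_of_eq_affineSum [CharZero F] (h : IsSparse α a e J) {m : ℕ}
    {α' a' : Fin m → F} {e' : Fin m → ℕ} (heq : sumOn α a e J = affineSum α' a' e') :
    J.card ≤ m := by
  classical
  by_contra! hlt
  set U : Finset (F × ℕ) := J.image fun i => (a i, e i) with hU
  set V : Finset (F × ℕ) := Finset.univ.image fun i => (a' i, e' i) with hV
  set c : F × ℕ → F := fun p => coefOn α a e J p - coefOn α' a' e' Finset.univ p with hc
  have hUcard : U.card = J.card :=
    Finset.card_image_of_injOn fun x hx y hy hxy => h.injOn hx hy (Prod.ext_iff.1 hxy).1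
  have hVcard : V.card ≤ m := Finset.card_image_le.trans (by simp)
  have hrel : ∑ p ∈ U ∪ V, C (c p) * (X - C p.1) ^ p.2 = 0 := by
    have h1 := sumOn_eq_sum_coefOn α a e (J := J) (W := U ∪ V) Finset.subset_union_left
    have h2 := sumOn_eq_sum_coefOn α' a' e' (J := Finset.univ) (W := U ∪ V) Finset.subset_union_right
    have h3 : affineSum α' a' e' = sumOn α' a' e' Finset.univ := rfl
    rw [h3, h1, h2] at heq
    simp only [hc, C_sub, sub_mul, Finset.sum_sub_distrib, heq, sub_self]
  set R := (U ∪ V).filter fun p => c p ≠ 0 with hR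
  have hrel' : ∑ p ∈ R, C (c p) * (X - C p.1) ^ p.2 = 0 := by
    rw [← hrel, hR, Finset.sum_filter_of_ne]
    intro q _ hq hcq
    exact hq (by simp [hcq])
  -- The indices of the terms that survive, and their number compared with that of the others.
  set I := J.filter fun i => (a i, e i) ∈ R with hI
  have hUR : (U ∩ R).card = I.card := by
    have : U ∩ R = I.image fun i => (a i, e i) := by
      ext p
      simp only [hU, hI, Finset.mem_inter, Finset.mem_image, Finset.mem_filter]
      constructor
      · rintro ⟨⟨i, hi, rfl⟩, hp⟩; exact ⟨i, ⟨hi, hp⟩, rfl⟩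
      · rintro ⟨i, ⟨hi, hp⟩, rfl⟩; exact ⟨⟨i, hi, rfl⟩, hp⟩
    rw [this, Finset.card_image_of_injOn]
    exact fun x hx y hy hxy => h.injOn (Finset.mem_filter.1 hx).1 (Finset.mem_filter.1 hy).1
      (Prod.ext_iff.1 hxy).1
  have hUV : (U \ V) ⊆ U ∩ R := by
    intro p hp
    rw [Finset.mem_sdiff] at hp
    refine Finset.mem_inter.2 ⟨hp.1, Finset.mem_filter.2 ⟨Finset.mem_union_left _ hp.1, ?_⟩⟩
    have h1 : coefOn α' a' e' Finset.univ p = 0 := coefOn_eq_zero hp.2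
    simp only [hc, h1, sub_zero]
    obtain ⟨i, hi, rfl⟩ := Finset.mem_image.1 hp.1
    exact h.coefOn_ne_zero.2 ⟨i, hi, rfl⟩
  have hcardR : R.card ≤ (U ∩ R).card + (V \ U).card := by
    refine (Finset.card_le_card ?_).trans (Finset.card_union_le _ _)
    intro p hp
    have := (Finset.mem_filter.1 hp).1
    simp only [Finset.mem_union, Finset.mem_inter, Finset.mem_sdiff] at this ⊢
    tauto
  have h1 := Finset.card_le_card hUV
  have h2 := Finset.card_sdiff_add_card_inter U V
  have h3 := Finset.card_sdiff_add_card_inter V U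
  rw [Finset.inter_comm] at h3
  have hIpos : 0 < I.card := by omega
  obtain ⟨i, hi, hmax⟩ := exists_max_exponent e (Finset.card_pos.1 hIpos)
  have h4 := h.spread I (Finset.filter_subset _ _) ⟨i, hi⟩ _ hmax
  have h5 := exponent_le_of_relation (fun p hp => (Finset.mem_filter.1 hp).2) hrel'
    (Finset.mem_filter.1 hi).2
  simp only at h5
  have h6 : R.card * (R.card - 1) ≤ (2 * I.card) * (2 * I.card) :=
    Nat.mul_le_mul (by omega) (by omega)
  nlinarith

end Build

/-- If few exponents are at most `i`, for every `i ≥ 2`, then the sum is sparse. For a part whose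
exponents are at most `1`, the condition at `i = 2` applies, and no term can be there. -/
theorem isSparse_of_card_le {F : Type u} [Field F] {s : ℕ} {α a : Fin s → F} {e : Fin s → ℕ}
    (ha : Function.Injective a) (hα : ∀ i, α i ≠ 0)
    (hn : ∀ i : ℕ, 2 ≤ i →
      ((Finset.univ.filter fun j => e j ≤ i).card : ℝ) ≤ (3 * (i : ℝ) / 4) ^ ((1 : ℝ) / 3) - 1) :
    IsSparse α a e Finset.univ := by
  refine ⟨ha.injOn, fun i _ => hα i, fun I _ hI M hM => ?_⟩
  have key : ∀ N : ℕ, 2 ≤ N → (∀ i ∈ I, e i ≤ N) → 4 * (I.card + 1) ^ 3 ≤ 3 * N := by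
    intro N hN hIN
    have h1 : I.card ≤ (Finset.univ.filter fun j => e j ≤ N).card :=
      Finset.card_le_card fun i hi => Finset.mem_filter.2 ⟨Finset.mem_univ _, hIN i hi⟩
    have h2 : ((I.card : ℝ) + 1) ≤ (3 * (N : ℝ) / 4) ^ ((1 : ℝ) / 3) := by
      have := hn N hN
      have h1' : (I.card : ℝ) ≤ ((Finset.univ.filter fun j => e j ≤ N).card : ℝ) := by
        exact_mod_cast h1
      linarith
    have h3 : ((I.card : ℝ) + 1) ^ 3 ≤ 3 * (N : ℝ) / 4 := by
      refine (pow_le_pow_left₀ (by positivity) h2 3).trans (le_of_eq ?_)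
      rw [← Real.rpow_natCast, ← Real.rpow_mul (by positivity)]
      norm_num
    have h4 : (4 : ℝ) * ((I.card : ℝ) + 1) ^ 3 ≤ 3 * N := by linarith
    exact_mod_cast h4
  by_cases hM2 : 2 ≤ M
  · exact key M hM2 hM
  · have := key 2 le_rfl fun i hi => (hM i hi).trans (by omega)
    have hpos := Finset.card_pos.2 hI
    have : 2 ^ 3 ≤ (I.card + 1) ^ 3 := Nat.pow_le_pow_left (by omega) 3
    omega

/-! ### A functional evaluator with a time bound -/

section Evaluator

variable {F : Type u}

/-- Iteration of `step` from `v` for as long as `cond` gives a pair, at most `n` times. -/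
def runLoop (cond step : Val F → Option (Val F)) : ℕ → Val F → Option (Val F)
  | n, v => match cond v with
    | none => none
    | some (.cons _ _) => match n with
      | 0 => none
      | n + 1 => (step v).bind (runLoop cond step n)
    | some _ => some v

/-- The field elements in a tree that encodes a list of field elements. -/
def decodeList : Val F → Option (List F)
  | .nil => some []
  | .elt _ => none
  | .cons (.elt x) w => (decodeList w).map (x :: ·)
  | .cons _ _ => none

theorem ofList_of_decodeList {v : Val F} {cs : List F} (h : decodeList v = some cs) :
    v = Val.ofList (cs.map .elt) := by
  induction v generalizing cs with
  | nil => simp only [decodeList, Option.some.injEq] at h; subst h; rfl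
  | elt x => simp [decodeList] at h
  | cons x w ihx ihw =>
    cases x with
    | elt x =>
      simp only [decodeList, Option.map_eq_some_iff] at h
      obtain ⟨ds, hds, rfl⟩ := h
      rw [ihw hds]; rfl
    | _ => simp [decodeList] at h

theorem decodeList_ofList (cs : List F) :
    decodeList (Val.ofList (cs.map Val.elt)) = some cs := by
  induction cs with
  | nil => rfl
  | cons x cs ih => simp [Val.ofList, decodeList, ih]

variable [Field F]

open Classical in
/-- A functional evaluator of programs. It refuses loops of more than `S` passes and the search for
the roots of polynomials with more than `S` coefficients, so that the time of a successful
evaluation is bounded by a polynomial in `S` that depends on the program alone. -/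
noncomputable def ev (ρ : F[X] → List F) (D S : ℕ) : List (Val F) → Prog → Option (Val F)
  | env, .var i => env[i]?
  | _, .nil => some .nil
  | _, .zero => some (.elt 0)
  | _, .one => some (.elt 1)
  | env, .cons p q => (ev ρ D S env p).bind fun v => (ev ρ D S env q).map fun w => .cons v w
  | env, .fst p => match ev ρ D S env p with
    | some (.cons v _) => some v
    | _ => none
  | env, .snd p => match ev ρ D S env p with
    | some (.cons _ w) => some w
    | _ => none
  | env, .add p q => match ev ρ D S env p, ev ρ D S env q with
    | some (.elt x), some (.elt y) => some (.elt (x + y))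
    | _, _ => none
  | env, .sub p q => match ev ρ D S env p, ev ρ D S env q with
    | some (.elt x), some (.elt y) => some (.elt (x - y))
    | _, _ => none
  | env, .mul p q => match ev ρ D S env p, ev ρ D S env q with
    | some (.elt x), some (.elt y) => some (.elt (x * y))
    | _, _ => none
  | env, .div p q => match ev ρ D S env p, ev ρ D S env q with
    | some (.elt x), some (.elt y) => if y = 0 then none else some (.elt (x / y))
    | _, _ => none
  | env, .ifEq p q a b => match ev ρ D S env p, ev ρ D S env q with
    | some (.elt x), some (.elt y) => if x = y then ev ρ D S env a else ev ρ D S env b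
    | _, _ => none
  | env, .ifPair p a b => match ev ρ D S env p with
    | none => none
    | some (.cons _ _) => ev ρ D S env a
    | some _ => ev ρ D S env b
  | env, .letIn p q => (ev ρ D S env p).bind fun v => ev ρ D S (v :: env) q
  | [], .loop _ _ => none
  | v :: env, .loop c p =>
    runLoop (fun v => ev ρ D S (v :: env) c) (fun v => ev ρ D S (v :: env) p) S v
  | env, .roots p => match (ev ρ D S env p).bind decodeList with
    | none => none
    | some cs => if cs.length ≤ D + 1 ∧ cs.length ≤ S ∧ polyOfList cs ≠ 0 then
        some (Val.ofList ((ρ (polyOfList cs)).map .elt)) else none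

/-- A bound on the time of a program, in terms of the bound on the number of passes of its loops. -/
noncomputable def timeBound : Prog → ℕ[X]
  | .var _ | .nil | .zero | .one => 1
  | .fst p | .snd p => timeBound p + 1
  | .cons p q | .add p q | .sub p q | .mul p q | .div p q | .letIn p q =>
    timeBound p + timeBound q + 1
  | .ifEq p q a b => timeBound p + timeBound q + timeBound a + timeBound b + 1
  | .ifPair p a b => timeBound p + timeBound a + timeBound b + 1
  | .loop c p => X * (timeBound c + timeBound p + 1) + timeBound c + 1
  | .roots p => timeBound p + X + 1

theorem eval_of_runLoop {ρ : F[X] → List F} {D : ℕ} {env : List (Val F)} {c p : Prog}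
    {cond step : Val F → Option (Val F)} {A B : ℕ}
    (hc : ∀ v u, cond v = some u → ∃ n ≤ A, Eval ρ D (v :: env) c u n)
    (hp : ∀ v u, step v = some u → ∃ n ≤ B, Eval ρ D (v :: env) p u n) (S : ℕ) (v w : Val F)
    (h : runLoop cond step S v = some w) :
    ∃ n ≤ S * (A + B + 1) + A + 1, Eval ρ D (v :: env) (.loop c p) w n := by
  induction S generalizing v with
  | zero =>
    unfold runLoop at h
    split at h
    · simp at h
    · simp at h
    · rename_i u hu hcv
      obtain ⟨n, hn, hev⟩ := hc _ _ hcv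
      simp only [Option.some.injEq] at h
      subst h
      refine ⟨n + 1, by omega, ?_⟩
      constructor
      · exact hev
      · exact fun x y hxy => hu x y (by rw [hxy])
  | succ S ih =>
    unfold runLoop at h
    split at h
    · simp at h
    · rename_i x y hcv
      obtain ⟨n, hn, hev⟩ := hc _ _ hcv
      simp only [Option.bind_eq_some_iff] at h
      obtain ⟨v', hv', hw⟩ := h
      obtain ⟨m, hm, hevp⟩ := hp _ _ hv'
      obtain ⟨k, hk, hevk⟩ := ih _ hw
      refine ⟨n + m + k + 1, ?_, .loop_step hev hevp hevk⟩
      have : (S + 1) * (A + B + 1) = S * (A + B + 1) + (A + B + 1) := by ring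
      omega
    · rename_i u hu hcv
      obtain ⟨n, hn, hev⟩ := hc _ _ hcv
      simp only [Option.some.injEq] at h
      subst h
      refine ⟨n + 1, by omega, ?_⟩
      constructor
      · exact hev
      · exact fun x y hxy => hu x y (by rw [hxy])

/-- The functional evaluator is sound, within the time bound. -/
theorem eval_of_ev {ρ : F[X] → List F} {D S : ℕ} (p : Prog) :
    ∀ (env : List (Val F)) (v : Val F), ev ρ D S env p = some v →
      ∃ n ≤ (timeBound p).eval S, Eval ρ D env p v n := by
  induction p with
  | var i => intro env v h; exact ⟨1, by simp [timeBound], .var i (by simpa [ev] using h)⟩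
  | nil => intro env v h; simp only [ev, Option.some.injEq] at h; subst h
           exact ⟨1, by simp [timeBound], .nil⟩
  | zero => intro env v h; simp only [ev, Option.some.injEq] at h; subst h
            exact ⟨1, by simp [timeBound], .zero⟩
  | one => intro env v h; simp only [ev, Option.some.injEq] at h; subst h
           exact ⟨1, by simp [timeBound], .one⟩
  | cons p q ihp ihq =>
    intro env v h
    simp only [ev, Option.bind_eq_some_iff, Option.map_eq_some_iff] at h
    obtain ⟨x, hx, y, hy, rfl⟩ := h
    obtain ⟨m, hm, h1⟩ := ihp _ _ hx
    obtain ⟨n, hn, h2⟩ := ihq _ _ hy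
    exact ⟨m + n + 1, by simp [timeBound]; omega, .cons h1 h2⟩
  | fst p ihp =>
    intro env v h
    simp only [ev] at h
    split at h
    · rename_i x y hx
      simp only [Option.some.injEq] at h; subst h
      obtain ⟨m, hm, h1⟩ := ihp _ _ hx
      exact ⟨m + 1, by simp [timeBound]; omega, .fst h1⟩
    · simp at h
  | snd p ihp =>
    intro env v h
    simp only [ev] at h
    split at h
    · rename_i x y hx
      simp only [Option.some.injEq] at h; subst h
      obtain ⟨m, hm, h1⟩ := ihp _ _ hx
      exact ⟨m + 1, by simp [timeBound]; omega, .snd h1⟩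
    · simp at h
  | add p q ihp ihq =>
    intro env v h
    simp only [ev] at h
    split at h
    · rename_i x y hx hy
      simp only [Option.some.injEq] at h; subst h
      obtain ⟨m, hm, h1⟩ := ihp _ _ hx
      obtain ⟨n, hn, h2⟩ := ihq _ _ hy
      exact ⟨m + n + 1, by simp [timeBound]; omega, .add h1 h2⟩
    · simp at h
  | sub p q ihp ihq =>
    intro env v h
    simp only [ev] at h
    split at h
    · rename_i x y hx hy
      simp only [Option.some.injEq] at h; subst h
      obtain ⟨m, hm, h1⟩ := ihp _ _ hx
      obtain ⟨n, hn, h2⟩ := ihq _ _ hy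
      exact ⟨m + n + 1, by simp [timeBound]; omega, .sub h1 h2⟩
    · simp at h
  | mul p q ihp ihq =>
    intro env v h
    simp only [ev] at h
    split at h
    · rename_i x y hx hy
      simp only [Option.some.injEq] at h; subst h
      obtain ⟨m, hm, h1⟩ := ihp _ _ hx
      obtain ⟨n, hn, h2⟩ := ihq _ _ hy
      exact ⟨m + n + 1, by simp [timeBound]; omega, .mul h1 h2⟩
    · simp at h
  | div p q ihp ihq =>
    intro env v h
    simp only [ev] at h
    split at h
    · rename_i x y hx hy
      split_ifs at h with hy0
      simp only [Option.some.injEq] at h; subst h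
      obtain ⟨m, hm, h1⟩ := ihp _ _ hx
      obtain ⟨n, hn, h2⟩ := ihq _ _ hy
      exact ⟨m + n + 1, by simp [timeBound]; omega, .div h1 h2 hy0⟩
    · simp at h
  | ifEq p q a b ihp ihq iha ihb =>
    intro env v h
    simp only [ev] at h
    split at h
    · rename_i x y hx hy
      obtain ⟨m, hm, h1⟩ := ihp _ _ hx
      obtain ⟨n, hn, h2⟩ := ihq _ _ hy
      split_ifs at h with hxy
      · subst hxy
        obtain ⟨k, hk, h3⟩ := iha _ _ h
        exact ⟨m + n + k + 1, by simp [timeBound]; omega, .ifEq_true h1 h2 h3⟩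
      · obtain ⟨k, hk, h3⟩ := ihb _ _ h
        exact ⟨m + n + k + 1, by simp [timeBound]; omega, .ifEq_false h1 h2 hxy h3⟩
    · simp at h
  | ifPair p a b ihp iha ihb =>
    intro env v h
    simp only [ev] at h
    split at h
    · simp at h
    · rename_i x y hx
      obtain ⟨m, hm, h1⟩ := ihp _ _ hx
      obtain ⟨k, hk, h3⟩ := iha _ _ h
      exact ⟨m + k + 1, by simp [timeBound]; omega, .ifPair_true h1 h3⟩
    · rename_i u hu hx
      obtain ⟨m, hm, h1⟩ := ihp _ _ hx
      obtain ⟨k, hk, h3⟩ := ihb _ _ h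
      exact ⟨m + k + 1, by simp [timeBound]; omega,
        .ifPair_false h1 (fun x y hxy => hu x y (by rw [hxy])) h3⟩
  | letIn p q ihp ihq =>
    intro env v h
    simp only [ev, Option.bind_eq_some_iff] at h
    obtain ⟨x, hx, hy⟩ := h
    obtain ⟨m, hm, h1⟩ := ihp _ _ hx
    obtain ⟨n, hn, h2⟩ := ihq _ _ hy
    exact ⟨m + n + 1, by simp [timeBound]; omega, .letIn h1 h2⟩
  | loop c p ihc ihp =>
    intro env v h
    cases env with
    | nil => simp [ev] at h
    | cons x env =>
      simp only [ev] at h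
      obtain ⟨n, hn, h1⟩ := eval_of_runLoop (fun v u => ihc (v :: env) u)
        (fun v u => ihp (v :: env) u) S x v h
      exact ⟨n, by simpa [timeBound] using hn, h1⟩
  | roots p ihp =>
    intro env v h
    simp only [ev] at h
    split at h
    · simp at h
    · rename_i cs hcs
      split_ifs at h with hcond
      simp only [Option.some.injEq] at h; subst h
      obtain ⟨u, hu, hcs⟩ := Option.bind_eq_some_iff.1 hcs
      obtain ⟨m, hm, h1⟩ := ihp _ _ hu
      rw [ofList_of_decodeList hcs] at h1
      exact ⟨m + cs.length + 1, by simp [timeBound]; omega,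
        .roots cs h1 hcond.1 hcond.2.2⟩

end Evaluator

/-! ### The program -/

section Programs

/-- The left fold over the list `l`, starting from `i`. The program `body` is evaluated in an
environment that starts with the current element, the accumulator, and the state of the loop. -/
def foldP (l i body : Prog) : Prog :=
  .snd (.letIn (.cons l i) (.loop (.fst (.var 0)) (.cons (.snd (.fst (.var 0)))
    (.letIn (.snd (.var 0)) (.letIn (.fst (.fst (.var 1))) body)))))

/-- Input `(l, m)`; output: the reversal of `l`, followed by `m`. -/
def revAppP : Prog := foldP (.fst (.var 0)) (.snd (.var 0)) (.cons (.var 0) (.var 1))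

/-- The reversal of the value of `p`. -/
def revP (p : Prog) : Prog := .letIn (.cons p .nil) revAppP

/-- Input `(j, l)`; output: `l` without its first `j` entries. -/
def dropP : Prog := foldP (.fst (.var 0)) (.snd (.var 0)) (.snd (.var 1))

/-- Input `(j, l)`; output: the first `j` entries of `l`. -/
def takeP : Prog :=
  revP (.snd (foldP (.fst (.var 0)) (.cons (.snd (.var 0)) .nil)
    (.cons (.snd (.fst (.var 1))) (.cons (.fst (.fst (.var 1))) (.snd (.var 1))))))

/-- Input `l`; output: a list of zeros of the same length. -/
def zerosP : Prog := foldP (.var 0) .nil (.cons .zero (.var 1))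

/-- Input `l`; output: the length of `l`. -/
def lengthP : Prog := foldP (.var 0) .nil (.cons .nil (.var 1))

/-- Input `(c, (u, v))`; output: the vector `u + c * v`. -/
def axpyP : Prog :=
  revP (.snd (foldP (.fst (.snd (.var 0))) (.cons (.snd (.snd (.var 0))) .nil)
    (.cons (.snd (.fst (.var 1)))
      (.cons (.add (.var 0) (.mul (.fst (.var 3)) (.fst (.fst (.var 1))))) (.snd (.var 1))))))

/-- Input: a vector `p`; output: `X * p`, truncated. -/
def mulXP : Prog := .cons .zero (revP (.snd (revP (.var 0))))

/-- Input: a vector `p`; output: the derivative of `p`. -/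
def derivP : Prog :=
  .snd (.letIn (.cons (.snd (foldP (.var 0) (.cons .zero .nil)
    (.cons (.add (.fst (.var 1)) .one) (.cons (.mul (.fst (.var 1)) (.var 0)) (.snd (.var 1))))))
    (.cons .zero .nil)) revAppP)

/-- Input: the rows of a matrix; output: the rows after elimination of the first column, without
that column and without the pivot row. -/
def elimP : Prog :=
  .snd (foldP (.var 0) (.cons .nil .nil)
    (.ifPair (.fst (.var 1))
      (.cons (.fst (.var 1)) (.cons (.letIn (.cons
        (.sub .zero (.div (.fst (.var 0)) (.fst (.fst (.var 1)))))
        (.cons (.snd (.var 0)) (.snd (.fst (.var 1))))) axpyP) (.snd (.var 1))))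
      (.ifEq (.fst (.var 0)) .zero
        (.cons .nil (.cons (.snd (.var 0)) (.snd (.var 1))))
        (.cons (.var 0) (.snd (.var 1))))))

/-- Input: a list of vectors; output: these vectors, continued by the vectors of a basis. -/
def augP : Prog :=
  .snd (foldP (.var 0) (.cons (.cons .one (.letIn (.var 0) zerosP)) .nil)
    (.cons (.letIn (.fst (.var 1)) mulXP)
      (.cons (.letIn (.cons (revP (.var 0)) (.fst (.var 1))) revAppP) (.snd (.var 1)))))

/-- Input `(k, vs)`, where `k` has the length of the vectors in `vs`; output: a basis of the linear
relations between these vectors. -/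
def relP : Prog :=
  foldP (.fst (.var 0)) (.letIn (.snd (.var 0)) augP) (.letIn (.var 1) elimP)

/-- Input `(g, n)`; output: the vectors `X ^ k * g⁽ⁱ⁾` for `k ≤ i < n`, those of largest `i`
first. -/
def colsP : Prog :=
  .snd (.snd (foldP (.snd (.var 0)) (.cons (.fst (.var 0)) (.cons .nil .nil))
    (.letIn (.cons .nil (.fst (.snd (.var 1))))
      (.cons (.letIn (.fst (.var 2)) derivP)
        (.cons (.var 0)
          (.letIn (.cons
            (.snd (foldP (.var 0) (.cons (.fst (.var 2)) .nil)
              (.cons (.letIn (.fst (.var 1)) mulXP) (.cons (.fst (.var 1)) (.snd (.var 1))))))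
            (.snd (.snd (.var 2)))) revAppP))))))

/-- Input: a vector `f`; output `(n, rs)`, where `n` is the least number such that there are linear
relations between the `X ^ k * f⁽ⁱ⁾` with `k ≤ i < n`, and `rs` is a basis of these relations. -/
def minP : Prog :=
  foldP (.var 0) (.cons .nil .nil)
    (.ifPair (.snd (.var 1)) (.var 1)
      (.letIn (.cons .nil (.fst (.var 1)))
        (.cons (.var 0)
          (.letIn (.cons (.var 4) (.letIn (.cons (.var 4) (.var 0)) colsP)) relP))))

/-- Input `(b, (d, 1))`; output: the vector `(X - b) ^ d`. -/
def powP : Prog :=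
  foldP (.fst (.snd (.var 0))) (.snd (.snd (.var 0)))
    (.letIn (.cons (.sub .zero (.fst (.var 3))) (.cons (.letIn (.var 1) mulXP) (.var 1))) axpyP)

/-- Input `(w, (n, v))`; output: `nil` if `w` is a relation between the `X ^ k * v⁽ⁱ⁾` with
`k ≤ i < n`, a pair otherwise. -/
def testP : Prog :=
  foldP
    (.snd (foldP (.letIn (.cons (.snd (.snd (.var 0))) (.fst (.snd (.var 0)))) colsP)
      (.cons (.fst (.var 0)) (.letIn (.snd (.snd (.var 0))) zerosP))
      (.cons (.snd (.fst (.var 1)))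
        (.letIn (.cons (.fst (.fst (.var 1))) (.cons (.snd (.var 1)) (.var 0))) axpyP))))
    .nil
    (.ifEq (.var 0) .zero (.var 1) (.cons .nil .nil))

/-- Input `(f, (w, n))`, where `w` is a relation between the `X ^ k * f⁽ⁱ⁾` with `k ≤ i < n`;
output: the list of the `(b, (d, (X - b) ^ d))` such that `w` is also a relation for
`(X - b) ^ d`, where `d` is at least the length of `w`. -/
def candP : Prog :=
  .letIn (.roots (.letIn (.cons (.snd (.snd (.var 0))) (.fst (.snd (.var 0)))) takeP))
    (.letIn (.letIn (.fst (.snd (.var 1))) lengthP)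
      (.letIn (.cons .one (.snd (.letIn (.fst (.var 2)) zerosP)))
        (.snd (foldP (.letIn (.cons (.var 1) (.fst (.var 3))) dropP) (.cons (.var 1) .nil)
          (.cons (.cons .nil (.fst (.var 1)))
            (foldP (.var 5) (.snd (.var 1))
              (.letIn (.letIn (.cons (.var 0) (.cons (.fst (.var 4)) (.var 6))) powP)
                (.ifPair (.letIn (.cons (.fst (.snd (.var 10))) (.cons (.snd (.snd (.var 10)))
                    (.var 0))) testP)
                  (.var 2)
                  (.cons (.cons (.var 1) (.cons (.fst (.var 5)) (.var 0))) (.var 2))))))))))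

/-- Input `(f, (n, cs))`, where `cs` is a list of triples `(b, (d, (X - b) ^ d))` by increasing `d`.
The first triples are dropped until `f` is uniquely a combination of the others, modulo polynomials
of degree less than `j`, where `j` is `n` or exceeds by `1` the exponent dropped last. Output:
`(cs', (j, r))`, where `r` is `nil`, or consists of a linear relation between `f` and the remaining
powers, and of the remaining triples. -/
def extrP : Prog :=
  foldP (.snd (.snd (.var 0))) (.cons (.snd (.snd (.var 0))) (.cons (.fst (.snd (.var 0))) .nil))
    (.ifPair (.snd (.snd (.var 1))) (.var 1)
      (.letIn (.letIn (.cons (.fst (.snd (.var 1))) (.fst (.var 3))) dropP)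
        (.letIn (.letIn (.cons (.var 0) (.cons (.var 0)
            (foldP (.fst (.var 2)) .nil
              (.cons (.letIn (.cons (.fst (.snd (.var 5))) (.snd (.snd (.var 0)))) dropP)
                (.var 1))))) relP)
          (.ifPair (.snd (.var 0))
            (.cons (.snd (.fst (.var 3))) (.cons (.cons .nil (.fst (.snd (.var 2)))) .nil))
            (.cons (.fst (.var 3)) (.cons (.fst (.snd (.var 3)))
              (.cons (.fst (.var 0)) (.fst (.var 3)))))))))

/-- Input `((f, out), (w, cs))`; output: `f` minus the combination given by `w`, and `out` together
with the terms of this combination. -/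
def updP : Prog :=
  .snd (foldP (revP (.snd (.snd (.var 0)))) (.cons (.snd (.fst (.snd (.var 0)))) (.fst (.var 0)))
    (.letIn (.div (.sub .zero (.fst (.fst (.var 1)))) (.fst (.fst (.snd (.var 3)))))
      (.cons (.snd (.fst (.var 2)))
        (.cons
          (.letIn (.cons (.sub .zero (.var 0)) (.cons (.fst (.snd (.var 2))) (.snd (.snd (.var 1)))))
            axpyP)
          (.ifEq (.var 0) .zero (.snd (.snd (.var 2)))
            (.cons (.cons (.var 0) (.cons (.fst (.var 1)) (.fst (.snd (.var 1)))))
              (.snd (.snd (.var 2)))))))))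

/-- Input `(f, out)`; output: the same after a pass, which subtracts terms from `f` and puts them in
front of `out`. -/
def passP : Prog :=
  .letIn (.letIn (.fst (.var 0)) minP)
    (.letIn (.fst (.snd (.var 0)))
      (.letIn (.letIn (.cons (.fst (.var 2)) (.cons (.var 0) (.fst (.var 1)))) candP)
        (.letIn (.snd (.snd (.letIn (.cons (.fst (.var 3))
            (.cons (.letIn (.var 1) lengthP) (revP (.var 0)))) extrP)))
          (.ifPair (.var 0) (.letIn (.cons (.var 4) (.var 0)) updP) (.var 4)))))

/-- The program: as many passes as the vectors have entries, starting from the input, extended by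
zeros to twice its length. -/
def buildP : Prog :=
  .letIn (.letIn (.cons (revP (.var 0)) (.letIn (.var 0) zerosP)) revAppP)
    (revP (.snd (foldP (.var 0) (.cons (.var 0) .nil) (.letIn (.var 1) passP))))

end Programs

/-! ### Encodings and folds -/

section Encodings

variable {F : Type u}

/-- The encoding of a list, from an encoding of its entries. -/
def encL {α : Type*} (ea : α → Val F) (l : List α) : Val F := Val.ofList (l.map ea)

variable {α : Type*} (ea : α → Val F)

@[simp] theorem encL_nil : encL ea [] = .nil := rfl

@[simp] theorem encL_cons (x : α) (l : List α) : encL ea (x :: l) = .cons (ea x) (encL ea l) := rfl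

@[simp] theorem ofNat_zero : (Val.ofNat 0 : Val F) = .nil := rfl

@[simp] theorem ofNat_succ (n : ℕ) : (Val.ofNat (n + 1) : Val F) = .cons .nil (Val.ofNat n) := rfl

theorem ofNat_eq_encL (n : ℕ) : (Val.ofNat n : Val F) = encL (fun _ : Unit => .nil)
    (List.replicate n ()) := by
  simp [encL, Val.ofNat]

variable [Field F] {ρ : F[X] → List F} {D S : ℕ} {env : List (Val F)}

/-- The rule for folds, with an invariant `M` that relates the entries still to come and the
accumulator. The new accumulator may depend on the state `st` of the loop. -/
theorem ev_foldP_of_state {σ : Type*} (es : σ → Val F) (M : List α → σ → Prop) {l : List α} {s : σ}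
    {lp ip body : Prog} (hlp : ev ρ D S env lp = some (encL ea l))
    (hip : ev ρ D S env ip = some (es s)) (hS : l.length ≤ S) (hM : M l s)
    (hstep : ∀ x rem s st, M (x :: rem) s → ∃ s', M rem s' ∧
      ev ρ D S (ea x :: es s :: st :: env) body = some (es s')) :
    ∃ s', M [] s' ∧ ev ρ D S env (foldP lp ip body) = some (es s') := by
  have key : ∀ (n : ℕ) (l : List α) (s : σ), l.length ≤ n → M l s → ∃ s', M [] s' ∧
      runLoop (fun v => ev ρ D S (v :: env) (.fst (.var 0)))
        (fun v => ev ρ D S (v :: env) (.cons (.snd (.fst (.var 0)))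
          (.letIn (.snd (.var 0)) (.letIn (.fst (.fst (.var 1))) body)))) n
        (.cons (encL ea l) (es s)) = some (.cons .nil (es s')) := by
    intro n l
    induction l generalizing n with
    | nil =>
      intro s _ hM
      exact ⟨s, hM, by unfold runLoop; simp [ev]⟩
    | cons x rem ih =>
      intro s hn hM
      obtain ⟨n, rfl⟩ : ∃ m, n = m + 1 := ⟨n - 1, by simp at hn; omega⟩
      obtain ⟨s', hM', hs'⟩ := hstep x rem s (.cons (.cons (ea x) (encL ea rem)) (es s)) hM
      obtain ⟨s'', hM'', hs''⟩ := ih n s' (by simpa using hn) hM'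
      refine ⟨s'', hM'', ?_⟩
      rw [← hs'']
      conv_lhs => unfold runLoop
      simp [ev, hs']
  obtain ⟨s', hM', hs'⟩ := key S l s hS hM
  refine ⟨s', hM', ?_⟩
  simp only [foldP, ev, hlp, hip, Option.bind_some, Option.map_some]
  simp only [ev] at hs'
  rw [hs']

theorem ev_foldP {σ : Type*} (es : σ → Val F) (M : List α → σ → Prop) {l : List α} {s : σ}
    {lp ip body : Prog} (hlp : ev ρ D S env lp = some (encL ea l))
    (hip : ev ρ D S env ip = some (es s)) (hS : l.length ≤ S) (hM : M l s)
    (hstep : ∀ x rem s, M (x :: rem) s → ∃ s', M rem s' ∧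
      ∀ st, ev ρ D S (ea x :: es s :: st :: env) body = some (es s')) :
    ∃ s', M [] s' ∧ ev ρ D S env (foldP lp ip body) = some (es s') :=
  ev_foldP_of_state ea es M hlp hip hS hM fun x rem s st h =>
    let ⟨s', h1, h2⟩ := hstep x rem s h
    ⟨s', h1, h2 st⟩

/-- A fold over a list whose entries do not matter. -/
theorem ev_foldP_nat {σ : Type*} (es : σ → Val F) (f : σ → σ) (inv : ℕ → σ → Prop) {n : ℕ} {s : σ}
    {lp ip body : Prog} (hlp : ev ρ D S env lp = some (Val.ofNat n))
    (hip : ev ρ D S env ip = some (es s)) (hS : n ≤ S) (hM : inv n s)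
    (hstep : ∀ m s, inv (m + 1) s → inv m (f s) ∧
      ∀ st, ev ρ D S (.nil :: es s :: st :: env) body = some (es (f s))) :
    ev ρ D S env (foldP lp ip body) = some (es (f^[n] s)) := by
  rw [ofNat_eq_encL] at hlp
  obtain ⟨s', hs', h⟩ := ev_foldP (fun _ : Unit => .nil) es
    (fun rem t => inv rem.length t ∧ f^[rem.length] t = f^[n] s) hlp hip (by simpa using hS)
    (by simpa using hM) (by
      rintro ⟨⟩ rem t ⟨ht, he⟩
      obtain ⟨h1, h2⟩ := hstep _ _ ht
      exact ⟨f t, ⟨h1, by simpa using he⟩, h2⟩)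
  rw [h, ← hs'.2]
  rfl

end Encodings

/-! ### Vectors of coefficients -/

section Vectors

variable {F : Type u} [Field F]

/-- The vector of the first `k` coefficients of `p`. -/
noncomputable def vec (k : ℕ) (p : F[X]) : List F := (List.range k).map p.coeff

/-- The encoding of the vector of the first `k` coefficients of `p`. -/
noncomputable def vecV (k : ℕ) (p : F[X]) : Val F := encL .elt (vec k p)

@[simp] theorem length_vec (k : ℕ) (p : F[X]) : (vec k p).length = k := by simp [vec]

@[simp] theorem vec_zero_length (p : F[X]) : vec 0 p = [] := rfl

theorem vec_succ (k : ℕ) (p : F[X]) : vec (k + 1) p = p.coeff 0 :: vec k p.divX := by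
  simp [vec, List.range_succ_eq_map, Function.comp_def]

theorem vec_succ_last (k : ℕ) (p : F[X]) : vec (k + 1) p = vec k p ++ [p.coeff k] := by
  simp [vec, List.range_succ]

theorem vecV_succ (k : ℕ) (p : F[X]) :
    vecV (k + 1) p = .cons (.elt (p.coeff 0)) (vecV k p.divX) := by
  simp [vecV, vec_succ]

theorem vec_congr {k : ℕ} {p q : F[X]} (h : ∀ i < k, p.coeff i = q.coeff i) : vec k p = vec k q :=
  List.map_congr_left fun i hi => h i (List.mem_range.1 hi)

theorem vec_append {k m : ℕ} {p q : F[X]} (hp : p.degree < k) :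
    vec k p ++ vec m q = vec (k + m) (p + X ^ k * q) := by
  rw [vec, vec, vec, List.range_add, List.map_append, List.map_map]
  congr 1
  · refine List.map_congr_left fun i hi => ?_
    have := List.mem_range.1 hi
    rw [coeff_add, coeff_X_pow_mul', if_neg (by omega), add_zero]
  · refine List.map_congr_left fun i _ => ?_
    simp only [Function.comp_apply, coeff_add]
    rw [coeff_eq_zero_of_degree_lt (lt_of_lt_of_le hp (by exact_mod_cast Nat.le_add_right k i)),
      zero_add, add_comm k i, coeff_X_pow_mul]

theorem coeff_divX_iterate (p : F[X]) (j i : ℕ) : (divX^[j] p).coeff i = p.coeff (i + j) := by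
  induction j generalizing p with
  | zero => rfl
  | succ j ih => rw [Function.iterate_succ_apply, ih, coeff_divX]; congr 1

theorem vec_drop (j k : ℕ) (p : F[X]) :
    (vec k p).drop j = vec (k - j) (divX^[j] p) := by
  refine List.ext_getElem (by simp) fun n h1 h2 => ?_
  simp [vec, coeff_divX_iterate, add_comm]

theorem vec_take {j k : ℕ} (hj : j ≤ k) (p : F[X]) : (vec k p).take j = vec j p := by
  refine List.ext_getElem (by simp [hj]) fun n h1 h2 => ?_
  simp [vec]

theorem vec_mulX (k : ℕ) (p : F[X]) : 0 :: (vec (k + 1) p).dropLast = vec (k + 1) (X * p) := by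
  rw [vec_succ_last, List.dropLast_concat, vec_succ]
  congr 1
  · simp
  · exact vec_congr fun i _ => by rw [coeff_divX, coeff_X_mul]

theorem vec_zero (k : ℕ) : vec k (0 : F[X]) = List.replicate k 0 :=
  List.eq_replicate_iff.2 ⟨by simp, fun x hx => by simp only [vec, List.mem_map, coeff_zero] at hx; tauto⟩

theorem vec_one (k : ℕ) : vec (k + 1) (1 : F[X]) = 1 :: List.replicate k 0 := by
  rw [vec_succ, ← C_1, divX_C, vec_zero]; simp

theorem vec_axpy (k : ℕ) (c : F) (p q : F[X]) :
    List.zipWith (fun x y => x + c * y) (vec k p) (vec k q) = vec k (p + C c * q) := by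
  simp only [vec, List.zipWith_map, List.zipWith_self]
  refine List.map_congr_left fun i _ => by simp

theorem polyOfList_vec {k : ℕ} {p : F[X]} : ∀ i, (polyOfList (vec k p)).coeff i =
    if i < k then p.coeff i else 0 := by
  induction k generalizing p with
  | zero => simp [polyOfList]
  | succ k ih =>
    intro i
    rw [vec_succ, polyOfList, coeff_add]
    cases i with
    | zero => simp
    | succ i => simp [coeff_X_mul, ih, coeff_divX]

end Vectors

/-! ### Programs on lists and vectors -/

section Routines

variable {F : Type u} {α : Type*} (ea : α → Val F) [Field F] {ρ : F[X] → List F} {D S : ℕ}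
  {env : List (Val F)}

theorem ev_revAppP (l m : List α) (hS : l.length ≤ S) :
    ev ρ D S (.cons (encL ea l) (encL ea m) :: env) revAppP = some (encL ea (l.reverse ++ m)) := by
  obtain ⟨s', hM, h⟩ := ev_foldP (ρ := ρ) (D := D) (S := S)
    (env := .cons (encL ea l) (encL ea m) :: env) (lp := .fst (.var 0)) (ip := .snd (.var 0))
    (body := .cons (.var 0) (.var 1)) ea (encL ea)
    (fun rem s => rem.reverse ++ s = l.reverse ++ m) (l := l) (s := m) (by simp [ev])
    (by simp [ev]) hS rfl (fun x rem s hs => ⟨x :: s, by simpa using hs, by simp [ev]⟩)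
  rw [revAppP, h, ← hM]; rfl

theorem ev_revP {p : Prog} {l : List α} (hp : ev ρ D S env p = some (encL ea l))
    (hS : l.length ≤ S) : ev ρ D S env (revP p) = some (encL ea l.reverse) := by
  have := ev_revAppP (ρ := ρ) (D := D) (env := env) ea l [] hS
  simp only [List.append_nil] at this
  simpa [revP, ev, hp] using this

theorem ev_zerosP (l : List α) (hS : l.length ≤ S) :
    ev ρ D S (encL ea l :: env) zerosP = some (vecV l.length 0) := by
  obtain ⟨s', hM, h⟩ := ev_foldP (ρ := ρ) (D := D) (S := S) (env := encL ea l :: env)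
    (lp := .var 0) (ip := .nil) (body := .cons .zero (.var 1)) ea (encL Val.elt)
    (fun rem s => List.replicate rem.length 0 ++ s = List.replicate l.length 0) (l := l) (s := [])
    (by simp [ev]) (by simp [ev]) hS (by simp)
    (fun x rem s hs => ⟨0 :: s, by
      rw [← hs, List.length_cons, List.replicate_succ']; simp, by simp [ev]⟩)
  rw [zerosP, h, vecV, vec_zero, ← hM]; rfl

theorem ev_lengthP (l : List α) (hS : l.length ≤ S) :
    ev ρ D S (encL ea l :: env) lengthP = some (Val.ofNat l.length) := by
  obtain ⟨s', hM, h⟩ := ev_foldP (ρ := ρ) (D := D) (S := S) (env := encL ea l :: env)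
    (lp := .var 0) (ip := .nil) (body := .cons .nil (.var 1)) ea Val.ofNat
    (fun rem s => rem.length + s = l.length) (l := l) (s := 0)
    (by simp [ev]) (by simp [ev]) hS (by simp)
    (fun x rem s hs => ⟨s + 1, by simp at hs; omega, by simp [ev]⟩)
  rw [lengthP, h, ← hM]; simp

theorem ev_dropP (j : ℕ) (l : List α) (hj : j ≤ l.length) (hS : j ≤ S) :
    ev ρ D S (.cons (.ofNat j) (encL ea l) :: env) dropP = some (encL ea (l.drop j)) := by
  have h := ev_foldP_nat (ρ := ρ) (D := D) (S := S)
    (env := .cons (.ofNat j) (encL ea l) :: env)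
    (lp := .fst (.var 0)) (ip := .snd (.var 0)) (body := .snd (.var 1)) (encL ea) List.tail
    (fun m s => m ≤ s.length) (n := j) (s := l) (by simp [ev]) (by simp [ev]) hS hj
    (by
      intro m s hm
      cases s with
      | nil => simp at hm
      | cons x s => exact ⟨by simpa using hm, by simp [ev]⟩)
  rw [dropP, h]
  congr 2
  clear h hj hS
  induction j generalizing l with
  | zero => rfl
  | succ j ih => rw [Function.iterate_succ_apply, ih]; simp

theorem ev_takeP (j : ℕ) (l : List α) (hj : j ≤ l.length) (hS : j ≤ S) :
    ev ρ D S (.cons (.ofNat j) (encL ea l) :: env) takeP = some (encL ea (l.take j)) := by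
  have hlp : ev ρ D S (.cons (.ofNat j) (encL ea l) :: env) (.fst (.var 0)) =
      some (encL (fun _ : Unit => .nil) (List.replicate j ())) := by
    simp [ev, ofNat_eq_encL]
  obtain ⟨⟨r, o⟩, hM, h⟩ := ev_foldP (fun _ : Unit => .nil)
    (fun s : List α × List α => .cons (encL ea s.1) (encL ea s.2))
    (ip := .cons (.snd (.var 0)) .nil)
    (body := .cons (.snd (.fst (.var 1))) (.cons (.fst (.fst (.var 1))) (.snd (.var 1))))
    (fun rem s => rem.length ≤ s.1.length ∧ s.2.reverse ++ s.1.take rem.length = l.take j)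
    (s := (l, [])) hlp (by simp [ev]) (by simpa using hS) (by simpa using hj) (by
      rintro ⟨⟩ rem ⟨r, o⟩ ⟨h1, h2⟩
      cases r with
      | nil => simp at h1
      | cons x r => exact ⟨(r, x :: o), ⟨by simpa using h1, by simpa using h2⟩, by simp [ev]⟩)
  have h2 : o.reverse = l.take j := by simpa using hM.2
  have hlen : o.length ≤ S := by
    rw [← List.length_reverse, h2, List.length_take]; omega
  rw [takeP, ev_revP ea (by simp only [ev, h]) hlen, h2]

theorem ev_axpyP (k : ℕ) (c : F) (p q : F[X]) (hS : k ≤ S) :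
    ev ρ D S (.cons (.elt c) (.cons (vecV k p) (vecV k q)) :: env) axpyP =
      some (vecV k (p + C c * q)) := by
  obtain ⟨⟨r, o⟩, hM, h⟩ := ev_foldP (ρ := ρ) (D := D) (S := S)
    (env := .cons (.elt c) (.cons (vecV k p) (vecV k q)) :: env) Val.elt
    (fun s : List F × List F => .cons (encL Val.elt s.1) (encL Val.elt s.2))
    (lp := .fst (.snd (.var 0))) (ip := .cons (.snd (.snd (.var 0))) .nil)
    (body := .cons (.snd (.fst (.var 1)))
      (.cons (.add (.var 0) (.mul (.fst (.var 3)) (.fst (.fst (.var 1))))) (.snd (.var 1))))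
    (fun rem s => rem.length = s.1.length ∧ s.2.reverse ++
      List.zipWith (fun x y => x + c * y) rem s.1 =
        List.zipWith (fun x y => x + c * y) (vec k p) (vec k q))
    (l := vec k p) (s := (vec k q, [])) (by simp [ev, vecV]) (by simp [ev, vecV])
    (by simpa using hS) (by simp) (by
      rintro x rem ⟨r, o⟩ ⟨h1, h2⟩
      cases r with
      | nil => simp at h1
      | cons y r =>
        exact ⟨(r, (x + c * y) :: o), ⟨by simpa using h1, by simpa using h2⟩, by simp [ev]⟩)
  have h2 : o.reverse = vec k (p + C c * q) := by
    rw [← vec_axpy]; simpa using hM.2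
  have hlen : o.length ≤ S := by
    rw [← List.length_reverse, h2, length_vec]; exact hS
  rw [axpyP, ev_revP Val.elt (by simp only [ev, h]) hlen, h2]; rfl

theorem ev_mulXP (k : ℕ) (p : F[X]) (hk : 0 < k) (hS : k ≤ S) :
    ev ρ D S (vecV k p :: env) mulXP = some (vecV k (X * p)) := by
  obtain ⟨k, rfl⟩ : ∃ m, k = m + 1 := ⟨k - 1, by omega⟩
  have h1 : ev ρ D S (vecV (k + 1) p :: env) (revP (.var 0)) =
      some (encL Val.elt (vec (k + 1) p).reverse) :=
    ev_revP Val.elt (by simp [ev, vecV]) (by simpa using hS)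
  have h2 : ev ρ D S (vecV (k + 1) p :: env) (.snd (revP (.var 0))) =
      some (encL Val.elt (vec k p).reverse) := by
    simp only [ev, h1, vec_succ_last, List.reverse_append, List.reverse_singleton,
      List.singleton_append, encL_cons]
  have h3 := ev_revP Val.elt h2 (by simp; omega)
  simp only [mulXP, ev, Option.bind_some]
  rw [h3, List.reverse_reverse, vecV, ← vec_mulX, vec_succ_last, List.dropLast_concat]
  rfl

theorem ev_derivP (k : ℕ) (p : F[X]) (hk : 0 < k) (hp : p.coeff k = 0) (hS : k ≤ S) :
    ev ρ D S (vecV k p :: env) derivP = some (vecV k (derivative p)) := by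
  obtain ⟨⟨x, o⟩, hM, h⟩ := ev_foldP (ρ := ρ) (D := D) (S := S)
    (env := vecV k p :: env) Val.elt
    (fun s : F × List F => .cons (.elt s.1) (encL Val.elt s.2))
    (lp := .var 0) (ip := .cons .zero .nil)
    (body := .cons (.add (.fst (.var 1)) .one)
      (.cons (.mul (.fst (.var 1)) (.var 0)) (.snd (.var 1))))
    (fun rem s => ∃ i, i + rem.length = k ∧ s.1 = (i : F) ∧ rem = (vec k p).drop i ∧
      s.2.reverse = (List.range i).map fun i : ℕ => (i : F) * p.coeff i)
    (l := vec k p) (s := (0, [])) (by simp [ev, vecV]) (by simp [ev])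
    (by simpa using hS) ⟨0, by simp⟩ (by
      rintro x rem ⟨y, o⟩ ⟨i, h1, h2, h3, h4⟩
      simp only at h2 h4
      have hx : x = p.coeff i := by
        have h5 := congrArg (fun l => l[0]?) h3
        simp [vec, List.getElem?_drop] at h5
        have : i < k := by simp at h1; omega
        have h6 : p.coeff i = x := by simpa [this] using h5
        exact h6.symm
      refine ⟨(y + 1, y * x :: o), ⟨i + 1, ?_, ?_, ?_, ?_⟩, by simp [ev]⟩
      · simp at h1 ⊢; omega
      · simp [h2]
      · have := congrArg List.tail h3
        simpa using this
      · rw [List.range_succ, List.map_append, ← h4, hx, h2]; simp)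
  obtain ⟨i, hi, _, _, ho⟩ := hM
  simp only [List.length_nil, add_zero] at hi ho
  subst hi
  have hlen : o.length ≤ S := by rw [← List.length_reverse, ho]; simpa using hS
  have h2 := ev_revAppP (ρ := ρ) (D := D) (env := vecV i p :: env) Val.elt o [0] hlen
  have h3 : o.reverse ++ [0] = 0 :: vec i (derivative p) := by
    have : (List.range (i + 1)).map (fun i : ℕ => (i : F) * p.coeff i) = o.reverse ++ [0] := by
      rw [List.range_succ, List.map_append, ho]; simp [hp]
    rw [← this, List.range_succ_eq_map]
    simp [vec, coeff_derivative, mul_comm, Function.comp_def]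
  rw [h3] at h2
  simp only [encL_cons, encL_nil] at h2
  simp only [derivP, ev, h, Option.bind_some, Option.map_some, h2]
  rfl

end Routines

/-! ### Gaussian elimination -/

section Elimination

variable {F : Type u} [Field F]

open Classical in
/-- One row `q` of an elimination step, on rows that are polynomials, the entry to eliminate being
the constant coefficient: the state consists of the pivot row, if one has been found, and of the
rows obtained so far. -/
noncomputable def elimStep : Option F[X] × List F[X] → F[X] → Option F[X] × List F[X]
  | (none, out), q => if q.coeff 0 = 0 then (none, q.divX :: out) else (some q, out)
  | (some p, out), q =>
    (some p, (q.divX + C (0 - q.coeff 0 / p.coeff 0) * p.divX) :: out)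

/-- An elimination step. -/
noncomputable def elim (rows : List F[X]) : List F[X] := (rows.foldl elimStep (none, [])).2

/-- The span of the entries of a list. -/
noncomputable def spanList (l : List F[X]) : Submodule F F[X] := Submodule.span F {x | x ∈ l}

@[simp] theorem spanList_nil : spanList ([] : List F[X]) = ⊥ := by simp [spanList]

@[simp] theorem spanList_cons (x : F[X]) (l : List F[X]) :
    spanList (x :: l) = F ∙ x ⊔ spanList l := by
  rw [spanList, spanList, ← Submodule.span_insert]
  congr 1
  ext y; simp

/-- The multiples `X * w` of the elements `w` of a space of polynomials. -/
noncomputable def shift (V : Submodule F F[X]) : Submodule F F[X] :=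
  V.map (LinearMap.mulLeft F (X : F[X]))

theorem shift_sup (V W : Submodule F F[X]) : shift (V ⊔ W) = shift V ⊔ shift W :=
  Submodule.map_sup _ _ _

theorem shift_span_singleton (x : F[X]) : shift (F ∙ x) = F ∙ (X * x) := by
  simp [shift, Submodule.map_span]

/-- The space spanned by the rows that a state of the elimination represents. -/
noncomputable def stateSpan (s : Option F[X] × List F[X]) : Submodule F F[X] :=
  spanList s.1.toList ⊔ shift (spanList s.2)

theorem span_sup_span_add_smul (p q : F[X]) (c : F) :
    F ∙ p ⊔ F ∙ (q + C c * p) = F ∙ p ⊔ F ∙ q := by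
  have hp : p ∈ F ∙ p := Submodule.mem_span_singleton_self p
  apply le_antisymm
  · refine sup_le le_sup_left ?_
    rw [Submodule.span_singleton_le_iff_mem, ← smul_eq_C_mul]
    exact add_mem (Submodule.mem_sup_right (Submodule.mem_span_singleton_self q))
      (Submodule.smul_mem _ _ (Submodule.mem_sup_left hp))
  · refine sup_le le_sup_left ?_
    rw [Submodule.span_singleton_le_iff_mem]
    have : q = (q + C c * p) + (-c) • p := by rw [smul_eq_C_mul, C_neg]; ring
    have h := add_mem (Submodule.mem_sup_right (S := F ∙ p)
      (Submodule.mem_span_singleton_self (R := F) (q + C c * p)))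
      (Submodule.smul_mem _ (-c) (Submodule.mem_sup_left hp))
    rwa [← this] at h

theorem elimStep_spec (s : Option F[X] × List F[X]) (q : F[X])
    (hs : ∀ p ∈ s.1, p.coeff 0 ≠ 0) :
    stateSpan (elimStep s q) = stateSpan s ⊔ F ∙ q ∧
      (elimStep s q).1.toList.length + (elimStep s q).2.length =
        s.1.toList.length + s.2.length + 1 ∧
      ∀ p ∈ (elimStep s q).1, p.coeff 0 ≠ 0 := by
  obtain ⟨piv, out⟩ := s
  cases piv with
  | none =>
    simp only [elimStep]
    split_ifs with h
    · have hq : X * q.divX = q := by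
        conv_rhs => rw [← X_mul_divX_add q, h]
        simp
      refine ⟨?_, by simp, by simp⟩
      simp only [stateSpan, spanList_cons, shift_sup, shift_span_singleton, hq]
      simp [sup_comm]
    · refine ⟨?_, by simp [add_comm], by simpa using h⟩
      simp [stateSpan, sup_comm]
  | some p =>
    have hp : p.coeff 0 ≠ 0 := hs p rfl
    refine ⟨?_, by simp [elimStep]; omega, by simpa [elimStep] using hp⟩
    set c := 0 - q.coeff 0 / p.coeff 0 with hc
    have hr : X * (q.divX + C c * p.divX) = q + C c * p := by
      have h1 := X_mul_divX_add q
      have h2 := X_mul_divX_add p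
      have h3 : C (q.coeff 0) + C c * C (p.coeff 0) = 0 := by
        rw [← C_mul, ← C_add, hc, zero_sub, neg_mul, div_mul_cancel₀ _ hp, add_neg_cancel, C_0]
      linear_combination h1 + C c * h2 - h3
    simp only [stateSpan, elimStep, ← hc, spanList_cons, shift_sup, shift_span_singleton, hr,
      Option.toList_some, spanList_nil, sup_bot_eq]
    rw [← sup_assoc, span_sup_span_add_smul, sup_right_comm]

theorem foldl_elimStep_spec (rows : List F[X]) (s : Option F[X] × List F[X])
    (hs : ∀ p ∈ s.1, p.coeff 0 ≠ 0) :
    stateSpan (rows.foldl elimStep s) = stateSpan s ⊔ spanList rows ∧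
      (rows.foldl elimStep s).1.toList.length + (rows.foldl elimStep s).2.length =
        s.1.toList.length + s.2.length + rows.length ∧
      ∀ p ∈ (rows.foldl elimStep s).1, p.coeff 0 ≠ 0 := by
  induction rows generalizing s with
  | nil => exact ⟨by simp, by simp, by simpa using hs⟩
  | cons q rows ih =>
    obtain ⟨h1, h2, h3⟩ := elimStep_spec s q hs
    obtain ⟨h4, h5, h6⟩ := ih _ h3
    rw [List.foldl_cons]
    exact ⟨by rw [h4, h1, spanList_cons, sup_assoc], by rw [h5, h2, List.length_cons]; omega, h6⟩

instance finiteDimensional_spanList (l : List F[X]) : FiniteDimensional F (spanList l) :=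
  FiniteDimensional.span_of_finite F l.finite_toSet

theorem finrank_shift (V : Submodule F F[X]) : Module.finrank F (shift V) = Module.finrank F V :=
  (Submodule.equivMapOfInjective _ (fun _ _ h => mul_left_cancel₀ X_ne_zero h) V).finrank_eq.symm

/-- The invariants of elimination: the rows stay independent, and span the quotients by `X` of the
elements of the former span whose constant coefficient vanishes. -/
theorem elim_spec {rows : List F[X]} (h : Module.finrank F (spanList rows) = rows.length) :
    Module.finrank F (spanList (elim rows)) = (elim rows).length ∧
      ∀ w, w ∈ spanList (elim rows) ↔ X * w ∈ spanList rows := by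
  obtain ⟨h1, h2, h3⟩ := foldl_elimStep_spec rows (none, []) (by simp)
  have h4 : stateSpan ((none, []) : Option F[X] × List F[X]) = ⊥ := by simp [stateSpan, shift]
  rw [h4, bot_sup_eq] at h1
  simp only [Option.toList_none, List.length_nil, zero_add] at h2
  have hmem : ∀ (V : Submodule F F[X]) (w : F[X]), X * w ∈ shift V ↔ w ∈ V := fun V w =>
    ⟨fun ⟨_, hy, h⟩ => mul_left_cancel₀ X_ne_zero h ▸ hy, fun h => ⟨w, h, rfl⟩⟩
  unfold elim
  rcases hs : rows.foldl elimStep (none, []) with ⟨piv, out⟩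
  rw [hs] at h1 h2 h3
  cases piv with
  | none =>
    simp only [stateSpan, Option.toList_none, spanList_nil, bot_sup_eq] at h1
    simp only [Option.toList_none, List.length_nil, zero_add] at h2
    refine ⟨?_, fun w => by rw [← h1, hmem]⟩
    rw [h2, ← h, ← h1, finrank_shift]
  | some p =>
    have hp : p.coeff 0 ≠ 0 := h3 p rfl
    simp only [stateSpan, Option.toList_some, spanList_cons, spanList_nil, sup_bot_eq] at h1
    simp only [Option.toList_some, List.length_singleton] at h2
    have hX : ∀ y ∈ shift (spanList out), y.coeff 0 = 0 := by
      rintro y ⟨z, _, rfl⟩; simp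
    have hfin : FiniteDimensional F (shift (spanList out)) := by
      unfold shift; infer_instance
    refine ⟨?_, fun w => ?_⟩
    · have hinf : F ∙ p ⊓ shift (spanList out) = ⊥ := by
        rw [eq_bot_iff]
        rintro y ⟨hy1, hy2⟩
        obtain ⟨c, rfl⟩ := Submodule.mem_span_singleton.1 hy1
        have := hX _ hy2
        rw [coeff_smul, smul_eq_mul] at this
        rw [(mul_eq_zero.1 this).resolve_right hp, zero_smul]
        exact zero_mem _
      have h5 := Submodule.finrank_sup_add_finrank_inf_eq (F ∙ p) (shift (spanList out))
      rw [hinf, h1, finrank_bot, finrank_shift, h,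
        finrank_span_singleton (by rintro rfl; simp at hp)] at h5
      simp only at h2 ⊢
      omega
    · rw [← h1, Submodule.mem_sup]
      constructor
      · intro hw
        exact ⟨0, zero_mem _, X * w, (hmem _ _).2 hw, zero_add _⟩
      · rintro ⟨y, hy, z, hz, hyz⟩
        obtain ⟨c, rfl⟩ := Submodule.mem_span_singleton.1 hy
        have := congrArg (fun p => p.coeff 0) hyz
        simp only [coeff_add, coeff_smul, smul_eq_mul, hX z hz, add_zero, mul_coeff_zero,
          coeff_X_zero, zero_mul] at this
        rw [(mul_eq_zero.1 this).resolve_right hp, zero_smul, zero_add] at hyz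
        rw [hyz] at hz
        exact (hmem _ _).1 hz

theorem iterate_elim_spec (n : ℕ) {rows : List F[X]}
    (h : Module.finrank F (spanList rows) = rows.length) :
    Module.finrank F (spanList (elim^[n] rows)) = (elim^[n] rows).length ∧
      ∀ w, w ∈ spanList (elim^[n] rows) ↔ X ^ n * w ∈ spanList rows := by
  induction n with
  | zero => exact ⟨h, fun w => by simp⟩
  | succ n ih =>
    obtain ⟨h1, h2⟩ := elim_spec ih.1
    rw [Function.iterate_succ_apply']
    exact ⟨h1, fun w => by rw [h2, ih.2, pow_succ, mul_assoc]⟩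

theorem length_elim_le (rows : List F[X]) : (elim rows).length ≤ rows.length := by
  have := (foldl_elimStep_spec rows (none, []) (by simp)).2.1
  simp only [Option.toList_none, List.length_nil, zero_add] at this
  unfold elim; omega

/-! ### Linear relations by elimination -/

/-- The combination of the entries of `vs` with the coefficients of `w`. -/
noncomputable def dot (w : F[X]) (vs : List F[X]) : F[X] :=
  ∑ i ∈ Finset.range vs.length, C (w.coeff i) * vs.getD i 0

@[simp] theorem dot_nil (w : F[X]) : dot w [] = 0 := by simp [dot]

theorem dot_cons (w v : F[X]) (vs : List F[X]) :
    dot w (v :: vs) = C (w.coeff 0) * v + dot w.divX vs := by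
  rw [dot, List.length_cons, Finset.sum_range_succ', add_comm]
  simp [dot, coeff_divX]

theorem dot_add (w w' : F[X]) (vs : List F[X]) : dot (w + w') vs = dot w vs + dot w' vs := by
  simp [dot, add_mul, Finset.sum_add_distrib]

theorem dot_smul (c : F) (w : F[X]) (vs : List F[X]) : dot (C c * w) vs = C c * dot w vs := by
  simp [dot, Finset.mul_sum, mul_assoc]

theorem degree_dot_lt {n : ℕ} (w : F[X]) {vs : List F[X]} (h : ∀ v ∈ vs, v.degree < n) :
    (dot w vs).degree < n := by
  rw [← mem_degreeLT]
  refine Submodule.sum_mem _ fun i hi => ?_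
  rw [← smul_eq_C_mul]
  refine Submodule.smul_mem _ _ (mem_degreeLT.2 (h _ ?_))
  rw [List.getD_eq_getElem _ _ (Finset.mem_range.1 hi)]
  exact List.getElem_mem _

/-- The vectors `vs` of length `n`, continued by the vectors of a basis, from index `i` on. -/
noncomputable def augFrom (n : ℕ) : ℕ → List F[X] → List F[X]
  | _, [] => []
  | i, v :: vs => (v + X ^ (n + i)) :: augFrom n (i + 1) vs

theorem length_augFrom (n i : ℕ) (vs : List F[X]) : (augFrom n i vs).length = vs.length := by
  induction vs generalizing i with
  | nil => rfl
  | cons v vs ih => simp [augFrom, ih]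

theorem mem_spanList_augFrom (n i : ℕ) (vs : List F[X]) (y : F[X]) :
    y ∈ spanList (augFrom n i vs) ↔
      ∃ w : F[X], w.degree < vs.length ∧ y = dot w vs + X ^ (n + i) * w := by
  induction vs generalizing i y with
  | nil =>
    simp only [augFrom, spanList_nil, Submodule.mem_bot, List.length_nil, Nat.cast_zero, dot_nil,
      zero_add]
    constructor
    · rintro rfl; exact ⟨0, by simp, by simp⟩
    · rintro ⟨w, hw, rfl⟩
      rw [← Nat.cast_zero, degree_lt_iff_coeff_zero] at hw
      have : w = 0 := by ext k; simpa using hw k (Nat.zero_le k)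
      simp [this]
  | cons v vs ih =>
    simp only [augFrom, spanList_cons, Submodule.mem_sup, Submodule.mem_span_singleton, ih]
    constructor
    · rintro ⟨_, ⟨c, rfl⟩, _, ⟨w, hw, rfl⟩, rfl⟩
      refine ⟨C c + X * w, ?_, ?_⟩
      · rw [degree_lt_iff_coeff_zero] at hw ⊢
        intro k hk
        obtain ⟨k, rfl⟩ : ∃ m, k = m + 1 := ⟨k - 1, by simp at hk; omega⟩
        simpa [coeff_C] using hw k (by simpa using hk)
      · have : (C c + X * w).divX = w := by
          ext k; simp [coeff_divX]
        rw [dot_cons, this, smul_eq_C_mul]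
        simp only [coeff_add, coeff_C_zero, mul_coeff_zero, coeff_X_zero, zero_mul, add_zero]
        ring
    · rintro ⟨w, hw, rfl⟩
      refine ⟨_, ⟨w.coeff 0, rfl⟩, _, ⟨w.divX, ?_, rfl⟩, ?_⟩
      · rw [degree_lt_iff_coeff_zero] at hw ⊢
        intro k hk
        rw [coeff_divX]
        exact hw (k + 1) (by simpa using hk)
      · rw [dot_cons, smul_eq_C_mul]
        have := X_mul_divX_add w
        linear_combination X ^ (n + i) * this

/-- The relations between the vectors `vs` of length `n`, as computed by elimination. -/
noncomputable def rels (n : ℕ) (vs : List F[X]) : List F[X] :=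
  elim^[n] (augFrom n 0 vs).reverse

theorem rels_nil (n : ℕ) : rels n ([] : List F[X]) = [] := by
  have : Function.IsFixedPt elim ([] : List F[X]) := rfl
  exact this.iterate n

theorem spanList_reverse (l : List F[X]) : spanList l.reverse = spanList l := by
  simp [spanList]

theorem finrank_spanList_le (l : List F[X]) : Module.finrank F (spanList l) ≤ l.length := by
  classical
  have h := finrank_span_finset_le_card (R := F) l.toFinset
  rw [Set.finrank, List.coe_toFinset] at h
  exact h.trans l.toFinset_card_le

/-- Elimination of the first `n` entries of the continued vectors leaves the combinations whose first
`n` entries vanish, each of them recorded in the remaining entries. -/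
theorem rels_spec {n : ℕ} {vs : List F[X]} (h : ∀ v ∈ vs, v.degree < n) :
    Module.finrank F (spanList (rels n vs)) = (rels n vs).length ∧
      ∀ w, w ∈ spanList (rels n vs) ↔ w.degree < vs.length ∧ dot w vs = 0 := by
  have hsplit : ∀ w y : F[X], dot w vs + X ^ n * y = 0 → dot w vs = 0 ∧ y = 0 := by
    intro w y hy
    have hlt := degree_dot_lt w h
    have hy0 : y = 0 := by
      ext k
      have h1 := congrArg (fun p => p.coeff (k + n)) hy
      simp only [coeff_add, coeff_X_pow_mul, coeff_zero] at h1
      rwa [coeff_eq_zero_of_degree_lt (hlt.trans_le (by exact_mod_cast Nat.le_add_left n k)),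
        zero_add] at h1
    exact ⟨by simpa [hy0] using hy, hy0⟩
  have hrank : Module.finrank F (spanList (augFrom n 0 vs).reverse) =
      (augFrom n 0 vs).reverse.length := by
    refine le_antisymm (finrank_spanList_le _) ?_
    rw [spanList_reverse, List.length_reverse, length_augFrom]
    have hmem : ∀ w : degreeLT F vs.length, dot (w : F[X]) vs + (X : F[X]) ^ n * (w : F[X]) ∈
        spanList (augFrom n 0 vs) := fun w =>
      (mem_spanList_augFrom n 0 vs _).2 ⟨w, mem_degreeLT.1 w.2, by simp⟩
    let φ : degreeLT F vs.length →ₗ[F] spanList (augFrom n 0 vs) :=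
      { toFun := fun w => ⟨dot (w : F[X]) vs + (X : F[X]) ^ n * (w : F[X]), hmem w⟩
        map_add' := fun w w' => Subtype.ext (by
          simp only [Submodule.coe_add, dot_add]; ring)
        map_smul' := fun c w => Subtype.ext (by
          simp only [Submodule.coe_smul, smul_eq_C_mul, dot_smul, RingHom.id_apply]; ring) }
    have hφ : Function.Injective φ := by
      rw [← LinearMap.ker_eq_bot, LinearMap.ker_eq_bot']
      intro w hw
      exact Subtype.ext (hsplit w w (by simpa [φ] using congrArg Subtype.val hw)).2
    have := LinearMap.finrank_le_finrank_of_injective hφ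
    rwa [(degreeLTEquiv F vs.length).finrank_eq, Module.finrank_fin_fun] at this
  obtain ⟨h1, h2⟩ := iterate_elim_spec n hrank
  refine ⟨h1, fun w => ?_⟩
  rw [rels, h2, spanList_reverse, mem_spanList_augFrom]
  constructor
  · rintro ⟨y, hy, hyw⟩
    have h3 : dot y vs + X ^ n * (y - w) = 0 := by
      rw [add_zero] at hyw; rw [mul_sub, hyw]; ring
    obtain ⟨h4, h5⟩ := hsplit _ _ h3
    rw [sub_eq_zero] at h5
    exact ⟨h5 ▸ hy, h5 ▸ h4⟩
  · rintro ⟨hw, h0⟩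
    exact ⟨w, hw, by rw [h0]; simp⟩

theorem mem_rels {n : ℕ} {vs : List F[X]} (h : ∀ v ∈ vs, v.degree < n) {w : F[X]}
    (hw : w ∈ rels n vs) : w ≠ 0 ∧ w.degree < vs.length ∧ dot w vs = 0 := by
  obtain ⟨h1, h2⟩ := rels_spec h
  refine ⟨?_, (h2 w).1 (Submodule.subset_span hw)⟩
  have hli : LinearIndependent F (rels n vs).get := by
    rw [linearIndependent_iff_card_eq_finrank_span, Fintype.card_fin, Set.range_list_get]
    exact h1.symm
  obtain ⟨i, hi⟩ := List.mem_iff_get.1 hw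
  rw [← hi]
  exact hli.ne_zero i

theorem rels_eq_nil_iff {n : ℕ} {vs : List F[X]} (h : ∀ v ∈ vs, v.degree < n) :
    rels n vs = [] ↔ ∀ w : F[X], w.degree < vs.length → dot w vs = 0 → w = 0 := by
  obtain ⟨h1, h2⟩ := rels_spec h
  constructor
  · intro h0 w hw hdot
    have := (h2 w).2 ⟨hw, hdot⟩
    rw [h0] at this
    simpa using this
  · intro hall
    have : spanList (rels n vs) = ⊥ := by
      rw [eq_bot_iff]
      intro w hw
      obtain ⟨h3, h4⟩ := (h2 w).1 hw
      exact hall w h3 h4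
    rw [this, finrank_bot] at h1
    exact List.length_eq_zero_iff.1 h1.symm

theorem eq_C_mul_of_rels_eq_singleton {n : ℕ} {vs : List F[X]} (h : ∀ v ∈ vs, v.degree < n)
    {w₀ : F[X]} (h0 : rels n vs = [w₀]) {w : F[X]} (hw : w.degree < vs.length)
    (hdot : dot w vs = 0) : ∃ c, w = C c * w₀ := by
  have := ((rels_spec h).2 w).2 ⟨hw, hdot⟩
  rw [h0, spanList_cons, spanList_nil, sup_bot_eq, Submodule.mem_span_singleton] at this
  obtain ⟨c, hc⟩ := this
  exact ⟨c, by rw [← hc, smul_eq_C_mul]⟩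

theorem length_rels_eq_one {n : ℕ} {vs : List F[X]} (h : ∀ v ∈ vs, v.degree < n) {w₀ : F[X]}
    (hw₀ : w₀ ≠ 0) (hdeg : w₀.degree < vs.length) (hdot₀ : dot w₀ vs = 0)
    (hall : ∀ w : F[X], w.degree < vs.length → dot w vs = 0 → ∃ c, w = C c * w₀) :
    (rels n vs).length = 1 := by
  obtain ⟨h1, h2⟩ := rels_spec h
  have : spanList (rels n vs) = F ∙ w₀ := by
    apply le_antisymm
    · intro w hw
      obtain ⟨h3, h4⟩ := (h2 w).1 hw
      obtain ⟨c, rfl⟩ := hall w h3 h4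
      exact Submodule.mem_span_singleton.2 ⟨c, smul_eq_C_mul _⟩
    · rw [Submodule.span_singleton_le_iff_mem, h2]
      exact ⟨hdeg, hdot₀⟩
  rw [← h1, this, finrank_span_singleton hw₀]

end Elimination

/-! ### Programs for elimination -/

section EliminationPrograms

variable {F : Type u} [Field F] {ρ : F[X] → List F} {D S : ℕ} {env : List (Val F)}

theorem ev_elimP (k : ℕ) (rows : List F[X]) (hk : k ≤ S) (hS : rows.length ≤ S) :
    ev ρ D S (encL (vecV (k + 1)) rows :: env) elimP = some (encL (vecV k) (elim rows)) := by
  obtain ⟨⟨piv, out⟩, ⟨hM, _⟩, h⟩ := ev_foldP (ρ := ρ) (D := D) (S := S)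
    (env := encL (vecV (k + 1)) rows :: env) (vecV (k + 1))
    (fun s : Option F[X] × List F[X] => .cons (s.1.elim .nil (vecV (k + 1))) (encL (vecV k) s.2))
    (lp := .var 0) (ip := .cons .nil .nil)
    (body := (.ifPair (.fst (.var 1))
      (.cons (.fst (.var 1)) (.cons (.letIn (.cons
        (.sub .zero (.div (.fst (.var 0)) (.fst (.fst (.var 1)))))
        (.cons (.snd (.var 0)) (.snd (.fst (.var 1))))) axpyP) (.snd (.var 1))))
      (.ifEq (.fst (.var 0)) .zero
        (.cons .nil (.cons (.snd (.var 0)) (.snd (.var 1))))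
        (.cons (.var 0) (.snd (.var 1))))))
    (fun rem s => rem.foldl elimStep s = rows.foldl elimStep (none, []) ∧
      ∀ p ∈ s.1, p.coeff 0 ≠ 0)
    (l := rows) (s := (none, [])) (by simp [ev]) (by simp [ev]) hS (by simp) (by
      rintro q rem ⟨piv, out⟩ ⟨h1, h2⟩
      refine ⟨elimStep (piv, out) q, ⟨by simpa using h1, (elimStep_spec _ q h2).2.2⟩, ?_⟩
      intro st
      cases piv with
      | none =>
        by_cases hq : q.coeff 0 = 0
        · simp [ev, elimStep, vecV_succ, hq]
        · simp [ev, elimStep, vecV_succ, hq]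
      | some p =>
        have hp : p.coeff 0 ≠ 0 := h2 p rfl
        simp only [ev, elimStep, vecV_succ, Option.elim_some, List.getElem?_cons_zero,
          List.getElem?_cons_succ, if_neg hp, Option.bind_some, Option.map_some,
          ev_axpyP _ _ _ _ hk, encL_cons])
  simp only [elimP, ev, h]
  simp only [List.foldl_nil] at hM
  rw [elim, ← hM]

theorem ev_augP (n : ℕ) (vs : List F[X]) (h : ∀ v ∈ vs, v.degree < n)
    (hS : n + (vs.length + 1) ≤ S) :
    ev ρ D S (encL (vecV n) vs :: env) augP =
      some (encL (vecV (n + (vs.length + 1))) (augFrom n 0 vs).reverse) := by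
  have hz := ev_zerosP (vecV n) (ρ := ρ) (D := D) (S := S) (env := encL (vecV n) vs :: env) vs
    (by omega)
  obtain ⟨⟨i, out⟩, hM, h⟩ := ev_foldP (ρ := ρ) (D := D) (S := S)
    (env := encL (vecV n) vs :: env) (vecV n)
    (fun s : ℕ × List F[X] => .cons (vecV (vs.length + 1) (X ^ s.1))
      (encL (vecV (n + (vs.length + 1))) s.2))
    (lp := .var 0) (ip := .cons (.cons .one (.letIn (.var 0) zerosP)) .nil)
    (body := (.cons (.letIn (.fst (.var 1)) mulXP)
      (.cons (.letIn (.cons (revP (.var 0)) (.fst (.var 1))) revAppP) (.snd (.var 1)))))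
    (fun rem s => (∀ v ∈ rem, v.degree < n) ∧
      (augFrom n s.1 rem).reverse ++ s.2 = (augFrom n 0 vs).reverse)
    (l := vs) (s := (0, [])) (by simp [ev]) (by
      simp only [ev, List.getElem?_cons_zero, Option.bind_some, hz, Option.map_some]
      simp only [pow_zero, encL_nil, vecV, vec_one, vec_zero, encL_cons]) (by omega)
    ⟨h, by simp⟩ (by
      rintro v rem ⟨i, out⟩ ⟨h1, h2⟩
      refine ⟨(i + 1, (v + X ^ (n + i)) :: out),
        ⟨fun v hv => h1 v (List.mem_cons_of_mem _ hv), by simpa [augFrom] using h2⟩, ?_⟩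
      intro st
      have e1 := fun env => ev_mulXP (ρ := ρ) (D := D) (S := S) (env := env) (vs.length + 1)
        ((X : F[X]) ^ i) (by omega) (by omega)
      have e2 := fun env (hv : ev ρ D S env (.var 0) = some (encL Val.elt (vec n v))) =>
        ev_revP (ρ := ρ) (D := D) (S := S) (env := env) Val.elt hv (by simp; omega)
      have e3 := fun env => ev_revAppP (ρ := ρ) (D := D) (S := S) (env := env) Val.elt
        (vec n v).reverse (vec (vs.length + 1) (X ^ i)) (by simp; omega)
      have e4 := vec_append (m := vs.length + 1) (q := X ^ i) (h1 v List.mem_cons_self)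
      rw [← pow_add] at e4
      simp only [ev, List.getElem?_cons_zero, List.getElem?_cons_succ, Option.bind_some, e1,
        Option.map_some, pow_succ']
      rw [e2 _ (by simp [ev, vecV])]
      simp only [Option.bind_some, Option.map_some, vecV, e3, List.reverse_reverse, e4, encL_cons])
  simp only [augP, ev, h]
  simp only [augFrom, List.reverse_nil, List.nil_append] at hM
  rw [← hM.2]

/-- Only the length of the list `clock` matters: it is the number of elimination steps. -/
theorem ev_relP {α : Type*} (ea : α → Val F) (clock : List α) (vs : List F[X])
    (h : ∀ v ∈ vs, v.degree < clock.length) (hS : clock.length + (vs.length + 1) ≤ S) :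
    ev ρ D S (.cons (encL ea clock) (encL (vecV clock.length) vs) :: env) relP =
      some (encL (vecV (vs.length + 1)) (rels clock.length vs)) := by
  have ha := fun env => ev_augP (ρ := ρ) (D := D) (S := S) (env := env) _ vs h hS
  obtain ⟨⟨k, rows⟩, hM, h⟩ := ev_foldP (ρ := ρ) (D := D) (S := S)
    (env := .cons (encL ea clock) (encL (vecV clock.length) vs) :: env) ea
    (fun s : ℕ × List F[X] => encL (vecV s.1) s.2)
    (lp := .fst (.var 0)) (ip := .letIn (.snd (.var 0)) augP) (body := .letIn (.var 1) elimP)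
    (fun rem s => s.1 = rem.length + (vs.length + 1) ∧ s.2.length ≤ vs.length ∧
      elim^[rem.length] s.2 = rels clock.length vs ∧ rem.length ≤ clock.length)
    (l := clock) (s := (clock.length + (vs.length + 1), (augFrom clock.length 0 vs).reverse))
    (by simp [ev]) (by simp [ev, ha]) (by omega)
    ⟨rfl, by simp [length_augFrom], rfl, le_rfl⟩ (by
      rintro x rem ⟨k, rows⟩ ⟨h1, h2, h3, h4⟩
      simp only [List.length_cons] at h1 h2 h3 h4
      subst h1
      refine ⟨(rem.length + (vs.length + 1), elim rows), ⟨rfl, (length_elim_le _).trans h2,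
        by simpa using h3, by omega⟩, ?_⟩
      intro st
      have e := fun env => ev_elimP (ρ := ρ) (D := D) (env := env)
        (rem.length + (vs.length + 1)) rows (S := S) (by omega) (by omega)
      rw [show rem.length + 1 + (vs.length + 1) = rem.length + (vs.length + 1) + 1 by omega]
      simp [ev, e])
  simp only [relP, h]
  simp only [List.length_nil, zero_add, Function.iterate_zero, id] at hM
  rw [hM.1, hM.2.2.1]

end EliminationPrograms

/-! ### The products of the derivatives of a polynomial with powers of `X` -/

section Columns

variable {F : Type u} [Field F]

/-- The polynomials `X ^ k * g⁽ⁱ⁾` with `k ≤ i < n`, those of largest `i` first. The differential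
equations of shift `0` and order less than `n` that `g` satisfies are the linear relations between
these polynomials. -/
noncomputable def cols (g : F[X]) : ℕ → List F[X]
  | 0 => []
  | n + 1 => (List.range (n + 1)).map (fun k => X ^ k * derivative^[n] g) ++ cols g n

theorem two_mul_length_cols (g : F[X]) (n : ℕ) : 2 * (cols g n).length = n * (n + 1) := by
  induction n with
  | zero => rfl
  | succ n ih =>
    rw [cols, List.length_append, mul_add, ih, List.length_map, List.length_range]; ring

theorem length_cols_eq (g g' : F[X]) (n : ℕ) : (cols g n).length = (cols g' n).length := by
  have h1 := two_mul_length_cols g n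
  have h2 := two_mul_length_cols g' n
  omega

theorem degree_lt_of_mem_cols {g : F[X]} {K n : ℕ} (hg : g.degree < K) :
    ∀ v ∈ cols g n, v.degree < K := by
  induction n with
  | zero => simp [cols]
  | succ n ih =>
    intro v hv
    rw [cols, List.mem_append, List.mem_map] at hv
    rcases hv with ⟨k, hk, rfl⟩ | hv
    · rw [List.mem_range] at hk
      rw [degree_lt_iff_coeff_zero] at hg ⊢
      intro i hi
      rw [coeff_X_pow_mul']
      split_ifs with hki
      · rw [coeff_iterate_derivative, hg _ (by omega), smul_zero]
      · rfl
    · exact ih v hv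

end Columns

/-! ### Programs for differential equations -/

section ColumnPrograms

variable {F : Type u} [Field F] {ρ : F[X] → List F} {D S : ℕ} {env : List (Val F)}

theorem ev_colsP {K : ℕ} (n : ℕ) (g : F[X]) (hK : 0 < K) (hg : g.degree < K) (hKS : K ≤ S)
    (hn : n ≤ S) :
    ev ρ D S (.cons (vecV K g) (.ofNat n) :: env) colsP = some (encL (vecV K) (cols g n)) := by
  have hinner : ∀ (p : F[X]) (m : ℕ) (l : List F[X]),
      (fun s : F[X] × List F[X] => (X * s.1, s.1 :: s.2))^[m] (p, l) =
        (X ^ m * p, ((List.range m).map fun k => X ^ k * p).reverse ++ l) := by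
    intro p m l
    induction m with
    | zero => simp
    | succ m ih =>
      rw [Function.iterate_succ_apply', ih, List.range_succ, List.map_append, List.reverse_append]
      simp only [Prod.mk.injEq]
      exact ⟨by ring, by simp⟩
  have houter : ∀ m : ℕ,
      (fun s : F[X] × ℕ × List F[X] => (derivative s.1, s.2.1 + 1,
        (List.range (s.2.1 + 1)).map (fun k => X ^ k * s.1) ++ s.2.2))^[m] (g, 0, []) =
        (derivative^[m] g, m, cols g m) := by
    intro m
    induction m with
    | zero => rfl
    | succ m ih => rw [Function.iterate_succ_apply', ih, Function.iterate_succ_apply', cols]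
  have h := ev_foldP_nat (ρ := ρ) (D := D) (S := S)
    (env := .cons (vecV K g) (.ofNat n) :: env)
    (lp := .snd (.var 0)) (ip := .cons (.fst (.var 0)) (.cons .nil .nil))
    (body := (.letIn (.cons .nil (.fst (.snd (.var 1))))
      (.cons (.letIn (.fst (.var 2)) derivP)
        (.cons (.var 0)
          (.letIn (.cons
            (.snd (foldP (.var 0) (.cons (.fst (.var 2)) .nil)
              (.cons (.letIn (.fst (.var 1)) mulXP) (.cons (.fst (.var 1)) (.snd (.var 1))))))
            (.snd (.snd (.var 2)))) revAppP)))))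
    (fun s : F[X] × ℕ × List F[X] =>
      .cons (vecV K s.1) (.cons (.ofNat s.2.1) (encL (vecV K) s.2.2)))
    (fun s => (derivative s.1, s.2.1 + 1,
        (List.range (s.2.1 + 1)).map (fun k => X ^ k * s.1) ++ s.2.2))
    (fun m s => m + s.2.1 = n ∧ s.1.degree < K) (n := n) (s := (g, 0, []))
    (by simp [ev]) (by simp [ev]) hn ⟨rfl, hg⟩ (by
      rintro m ⟨p, i, l⟩ ⟨h1, h2⟩
      simp only at h1 h2
      refine ⟨⟨by simp only; omega, degree_derivative_le.trans_lt h2⟩, ?_⟩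
      intro st
      have e1 := fun env => ev_derivP (ρ := ρ) (D := D) (S := S) (env := env) K p hK
        (coeff_eq_zero_of_degree_lt h2) hKS
      have e2 := fun env => ev_revAppP (ρ := ρ) (D := D) (S := S) (env := env) (vecV K)
        ((List.range (i + 1)).map fun k => X ^ k * p).reverse l (by simp; omega)
      have e3 := ev_foldP_nat (ρ := ρ) (D := D) (S := S)
        (env := .cons .nil (.ofNat i) :: .nil ::
          .cons (vecV K p) (.cons (.ofNat i) (encL (vecV K) l)) :: st ::
          .cons (vecV K g) (.ofNat n) :: env)
        (lp := .var 0) (ip := .cons (.fst (.var 2)) .nil)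
        (body := .cons (.letIn (.fst (.var 1)) mulXP) (.cons (.fst (.var 1)) (.snd (.var 1))))
        (fun s : F[X] × List F[X] => .cons (vecV K s.1) (encL (vecV K) s.2))
        (fun s => (X * s.1, s.1 :: s.2)) (fun _ _ => True) (n := i + 1) (s := (p, []))
        (by simp [ev]) (by simp [ev]) (by omega) trivial (by
          intro m s _
          exact ⟨trivial, fun st => by
            simp [ev, ev_mulXP K s.1 hK hKS]⟩)
      simp only [ev, List.getElem?_cons_zero, List.getElem?_cons_succ, Option.bind_some, e1,
        Option.map_some, e3, hinner, List.append_nil, e2, List.reverse_reverse, ofNat_succ])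
  simp only [colsP, ev, h, houter]

/-- The loop increases the order until there is a relation; `n₀` is an order for which there is one. -/
theorem ev_minP {K : ℕ} (f : F[X]) (hK : 0 < K) (hf : f.degree < K) (hS : (K + 1) ^ 2 ≤ S)
    {n₀ : ℕ} (hn₀ : n₀ ≤ K) (hex : rels K (cols f n₀) ≠ []) :
    ∃ n ≤ n₀, rels K (cols f n) ≠ [] ∧ (∀ m < n, rels K (cols f m) = []) ∧
      ev ρ D S (vecV K f :: env) minP = some (.cons (.ofNat n)
        (encL (vecV ((cols f n).length + 1)) (rels K (cols f n)))) := by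
  have hKS : K ≤ S := by nlinarith
  obtain ⟨⟨n, rs⟩, ⟨h1, h2, h3, _⟩, h⟩ := ev_foldP (ρ := ρ) (D := D) (S := S)
    (env := vecV K f :: env) Val.elt
    (lp := .var 0) (ip := .cons .nil .nil)
    (body := .ifPair (.snd (.var 1)) (.var 1)
      (.letIn (.cons .nil (.fst (.var 1)))
        (.cons (.var 0)
          (.letIn (.cons (.var 4) (.letIn (.cons (.var 4) (.var 0)) colsP)) relP))))
    (fun s : ℕ × List F[X] =>
      .cons (.ofNat s.1) (encL (vecV ((cols f s.1).length + 1)) s.2))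
    (fun rem s => s.2 = rels K (cols f s.1) ∧ (∀ m < s.1, rels K (cols f m) = []) ∧
      (s.2 = [] → s.1 + rem.length = K) ∧ s.1 + rem.length ≤ K)
    (l := vec K f) (s := (0, [])) (by simp [ev, vecV]) (by simp [ev]) (by simpa using hKS)
    ⟨(rels_nil K).symm, by simp, by simp, by simp⟩ (by
      rintro x rem ⟨n, rs⟩ ⟨h1, h2, h3, h4⟩
      simp only [List.length_cons] at h1 h2 h3 h4
      cases rs with
      | cons r rs =>
        exact ⟨(n, r :: rs), ⟨h1, h2, by simp, by simp only; omega⟩, by simp [ev]⟩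
      | nil =>
        refine ⟨(n + 1, rels K (cols f (n + 1))), ⟨rfl, ?_, fun _ => by simp at h3 ⊢; omega,
          by simp only; omega⟩, ?_⟩
        · intro m hm
          rcases Nat.lt_succ_iff_lt_or_eq.1 hm with h | rfl
          · exact h2 m h
          · exact h1.symm
        · intro st
          have hl := two_mul_length_cols f (n + 1)
          have hl2 : (n + 1) * (n + 1 + 1) ≤ K * (K + 1) := by gcongr <;> omega
          have e1 := fun env => ev_colsP (ρ := ρ) (D := D) (S := S) (env := env) (n + 1) f hK hf
            hKS (by omega)
          have e2 := fun env => ev_relP (ρ := ρ) (D := D) (S := S) (env := env) Val.elt (vec K f)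
            (cols f (n + 1)) (by simpa using degree_lt_of_mem_cols hf)
            (by rw [length_vec]; nlinarith)
          rw [length_vec] at e2
          change ∀ env, ev ρ D S (.cons (vecV K f) _ :: env) relP = _ at e2
          simp only [ofNat_succ] at e1
          simp only [ev, List.getElem?_cons_zero, List.getElem?_cons_succ, Option.bind_some, e1,
            Option.map_some, e2, ofNat_succ, encL_nil])
  simp only [List.length_nil, add_zero] at h3
  simp only at h1 h2
  have hn : n ≤ n₀ := by
    by_contra hlt
    exact hex (h2 n₀ (by omega))
  refine ⟨n, hn, ?_, h2, by rw [minP, h, h1]⟩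
  intro h0
  have : n = n₀ := by
    have := h3 (h1.trans h0)
    omega
  exact hex (this ▸ h0)

theorem ev_powP {K : ℕ} (b : F) (d : ℕ) (hK : 0 < K) (hKS : K ≤ S) (hd : d ≤ S) :
    ev ρ D S (.cons (.elt b) (.cons (.ofNat d) (vecV K 1)) :: env) powP =
      some (vecV K ((X - C b) ^ d)) := by
  have h := ev_foldP_nat (ρ := ρ) (D := D) (S := S)
    (env := .cons (.elt b) (.cons (.ofNat d) (vecV K 1)) :: env)
    (lp := .fst (.snd (.var 0))) (ip := .snd (.snd (.var 0)))
    (body := .letIn (.cons (.sub .zero (.fst (.var 3)))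
      (.cons (.letIn (.var 1) mulXP) (.var 1))) axpyP)
    (vecV K) (fun p => X * p + C (0 - b) * p) (fun _ _ => True) (n := d) (s := 1)
    (by simp [ev]) (by simp [ev]) hd trivial (by
      intro m s _
      exact ⟨trivial, fun st => by
        simp only [ev, List.getElem?_cons_zero, List.getElem?_cons_succ, Option.bind_some,
          Option.map_some, ev_mulXP K s hK hKS, ev_axpyP K _ _ _ hKS]⟩)
  rw [powP, h]
  congr 2
  clear h hd
  induction d with
  | zero => simp
  | succ d ih => rw [Function.iterate_succ_apply', ih, zero_sub, C_neg]; ring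

open Classical in
theorem ev_testP {K n : ℕ} (w v : F[X]) (hK : 0 < K) (hv : v.degree < K) (hKS : K ≤ S)
    (hn : n ≤ S) (hS : (cols v n).length ≤ S) :
    ev ρ D S (.cons (vecV ((cols v n).length + 1) w) (.cons (.ofNat n) (vecV K v)) :: env) testP =
      some (if dot w (cols v n) = 0 then .nil else .cons .nil .nil) := by
  obtain ⟨⟨k, w', p⟩, ⟨_, hM⟩, h⟩ := ev_foldP (ρ := ρ) (D := D) (S := S)
    (env := .cons (vecV ((cols v n).length + 1) w) (.cons (.ofNat n) (vecV K v)) :: env) (vecV K)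
    (lp := .letIn (.cons (.snd (.snd (.var 0))) (.fst (.snd (.var 0)))) colsP)
    (ip := .cons (.fst (.var 0)) (.letIn (.snd (.snd (.var 0))) zerosP))
    (body := .cons (.snd (.fst (.var 1)))
        (.letIn (.cons (.fst (.fst (.var 1))) (.cons (.snd (.var 1)) (.var 0))) axpyP))
    (fun s : ℕ × F[X] × F[X] => .cons (vecV (s.1 + 1) s.2.1) (vecV K s.2.2))
    (fun rem s => s.1 = rem.length ∧ s.2.2 + dot s.2.1 rem = dot w (cols v n))
    (l := cols v n) (s := ((cols v n).length, w, 0))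
    (by simp [ev, ev_colsP n v hK hv hKS hn])
    (by
      have e := fun env => ev_zerosP (ρ := ρ) (D := D) (S := S) (env := env) Val.elt (vec K v)
        (by simpa using hKS)
      rw [length_vec] at e
      change ∀ env, ev ρ D S (vecV K v :: env) zerosP = _ at e
      simp [ev, e])
    hS ⟨rfl, by simp⟩ (by
      rintro x rem ⟨k, w', p⟩ ⟨h1, h2⟩
      simp only [List.length_cons] at h1 h2
      subst h1
      refine ⟨(rem.length, w'.divX, p + C (w'.coeff 0) * x), ⟨rfl, ?_⟩, ?_⟩
      · rw [← h2, dot_cons, add_assoc]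
      · intro st
        simp only [ev, List.getElem?_cons_zero, List.getElem?_cons_succ, Option.bind_some,
          Option.map_some, vecV_succ (rem.length + 1), ev_axpyP K _ _ _ hKS])
  simp only [dot_nil, add_zero] at hM
  obtain ⟨b, hb, h'⟩ := ev_foldP (ρ := ρ) (D := D) (S := S)
    (env := .cons (vecV ((cols v n).length + 1) w) (.cons (.ofNat n) (vecV K v)) :: env) Val.elt
    (lp := .snd (foldP (.letIn (.cons (.snd (.snd (.var 0))) (.fst (.snd (.var 0)))) colsP)
      (.cons (.fst (.var 0)) (.letIn (.snd (.snd (.var 0))) zerosP))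
      (.cons (.snd (.fst (.var 1)))
        (.letIn (.cons (.fst (.fst (.var 1))) (.cons (.snd (.var 1)) (.var 0))) axpyP))))
    (ip := .nil) (body := .ifEq (.var 0) .zero (.var 1) (.cons .nil .nil))
    (fun b : Bool => bif b then .nil else .cons .nil .nil)
    (fun rem b => (b = true ∧ ∀ x ∈ rem, x = 0) ↔ ∀ x ∈ vec K p, x = 0) (l := vec K p) (s := true)
    (by simp only [ev, h]; rfl) (by simp [ev]) (by simpa using hKS) (by simp) (by
      rintro x rem b hM
      by_cases hx : x = 0
      · exact ⟨b, by rw [← hM]; simp [hx], by simp [ev, hx]⟩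
      · exact ⟨false, by rw [← hM]; simp [hx], by simp [ev, hx]⟩)
  rw [testP, h', ← hM]
  have hp : (∀ x ∈ vec K p, x = 0) ↔ p = 0 := by
    constructor
    · intro hall
      have hdeg : p.degree < K := by
        rw [hM]; exact degree_dot_lt w (degree_lt_of_mem_cols hv)
      ext i
      by_cases hi : i < K
      · exact hall _ (List.mem_map.2 ⟨i, List.mem_range.2 hi, rfl⟩)
      · exact coeff_eq_zero_of_degree_lt (hdeg.trans_le (by exact_mod_cast not_lt.1 hi))
    · rintro rfl x hx
      rw [vec_zero] at hx
      exact List.eq_of_mem_replicate hx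
  rw [hp] at hb
  by_cases h0 : p = 0
  · rw [if_pos h0, (hb.2 h0).1]; rfl
  · rw [if_neg h0]
    cases b with
    | false => rfl
    | true => exact absurd (hb.1 ⟨rfl, by simp⟩) h0

end ColumnPrograms

/-! ### The program for the solutions of an equation -/

section Candidates

variable {F : Type u} [Field F] {ρ : F[X] → List F} {D S : ℕ} {env : List (Val F)}

/-- The encoding of a pair `(b, d)`, together with the vector of the coefficients of
`(X - b) ^ d`. -/
noncomputable def encCand (K : ℕ) (p : F × ℕ) : Val F :=
  .cons (.elt p.1) (.cons (.ofNat p.2) (vecV K ((X - C p.1) ^ p.2)))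

theorem degree_affinePower_lt {K : ℕ} (p : F × ℕ) (h : p.2 < K) :
    ((X - C p.1) ^ p.2 : F[X]).degree < K := by
  rw [degree_pow, degree_X_sub_C]
  simpa using h

open Classical in
/-- The candidates: the exponents range from the length of the relation to `K - 1`, and the nodes over
the roots of the leading coefficient of the equation. -/
theorem ev_candP {K n : ℕ} (f w : F[X]) (hK : 0 < K) (hKS : K ≤ S) (hn : n ≤ (cols f n).length + 1)
    (hm : (cols f n).length + 1 ≤ K) (hnD : n ≤ D + 1) (hw : polyOfList (vec n w) ≠ 0)
    (hnodup : (ρ (polyOfList (vec n w))).Nodup) (hlen : (ρ (polyOfList (vec n w))).length ≤ S) :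
    ∃ cs : List (F × ℕ), cs.Nodup ∧ cs.Pairwise (fun p q => q.2 ≤ p.2) ∧
      (∀ p, p ∈ cs ↔ ((cols f n).length + 1 ≤ p.2 ∧ p.2 < K) ∧
        p.1 ∈ ρ (polyOfList (vec n w)) ∧ dot w (cols ((X - C p.1) ^ p.2) n) = 0) ∧
      ev ρ D S (.cons (vecV K f) (.cons (vecV ((cols f n).length + 1) w) (.ofNat n)) :: env) candP =
        some (encL (encCand K) cs) := by
  set R := ρ (polyOfList (vec n w)) with hR
  set thr := (cols f n).length + 1 with hthr
  set arg : Val F := .cons (vecV K f) (.cons (vecV thr w) (.ofNat n)) with harg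
  have eroots : ev ρ D S (arg :: env) (.roots (.letIn (.cons (.snd (.snd (.var 0)))
      (.fst (.snd (.var 0)))) takeP)) = some (encL Val.elt R) := by
    have e := fun env => ev_takeP (ρ := ρ) (D := D) (S := S) (env := env) Val.elt n (vec thr w)
      (by simpa using hn) (by omega)
    rw [vec_take hn] at e
    change ∀ env, ev ρ D S (.cons (.ofNat n) (vecV thr w) :: env) takeP = _ at e
    simp only [ev, List.getElem?_cons_zero, harg, Option.bind_some, Option.map_some, e]
    rw [encL, decodeList_ofList]
    simp only [length_vec]
    rw [if_pos ⟨hnD, by omega, hw⟩]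
    rfl
  have elen := fun env => ev_lengthP (ρ := ρ) (D := D) (S := S) (env := env) Val.elt (vec thr w)
    (by rw [length_vec]; omega)
  rw [length_vec] at elen
  change ∀ env, ev ρ D S (vecV thr w :: env) lengthP = _ at elen
  have ezeros := fun env => ev_zerosP (ρ := ρ) (D := D) (S := S) (env := env) Val.elt (vec K f)
    (by simpa using hKS)
  rw [length_vec] at ezeros
  change ∀ env, ev ρ D S (vecV K f :: env) zerosP = _ at ezeros
  have eone : (.cons (.elt 1) (vecV (K - 1) 0) : Val F) = vecV K 1 := by
    obtain ⟨k, rfl⟩ : ∃ k, K = k + 1 := ⟨K - 1, by omega⟩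
    simp [vecV, vec_one, vec_zero]
  have ezero : vecV K (0 : F[X]) = .cons (.elt 0) (vecV (K - 1) 0) := by
    obtain ⟨k, rfl⟩ : ∃ k, K = k + 1 := ⟨K - 1, by omega⟩
    simp [vecV_succ]
  have edrop := fun env => ev_dropP (ρ := ρ) (D := D) (S := S) (env := env) Val.elt thr (vec K f)
    (by simpa using hm) (by omega)
  let good : ℕ → F → Bool := fun d b => decide (dot w (cols ((X - C b) ^ d) n) = 0)
  let env₁ : List (Val F) := vecV K 1 :: .ofNat thr :: encL Val.elt R :: arg :: env
  obtain ⟨⟨d, cs⟩, ⟨⟨_, h1⟩, h2, h3, h4⟩, h⟩ := ev_foldP (ρ := ρ) (D := D) (S := S)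
    (env := env₁) Val.elt
    (lp := .letIn (.cons (.var 1) (.fst (.var 3))) dropP) (ip := .cons (.var 1) .nil)
    (body := .cons (.cons .nil (.fst (.var 1)))
            (foldP (.var 5) (.snd (.var 1))
              (.letIn (.letIn (.cons (.var 0) (.cons (.fst (.var 4)) (.var 6))) powP)
                (.ifPair (.letIn (.cons (.fst (.snd (.var 10))) (.cons (.snd (.snd (.var 10)))
                    (.var 0))) testP)
                  (.var 2)
                  (.cons (.cons (.var 1) (.cons (.fst (.var 5)) (.var 0))) (.var 2))))))
    (fun s : ℕ × List (F × ℕ) => .cons (.ofNat s.1) (encL (encCand K) s.2))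
    (fun rem s => (thr ≤ s.1 ∧ s.1 + rem.length = K) ∧ s.2.Nodup ∧ s.2.Pairwise (fun p q => q.2 ≤ p.2) ∧
      ∀ p, p ∈ s.2 ↔ (thr ≤ p.2 ∧ p.2 < s.1) ∧ p.1 ∈ R ∧ dot w (cols ((X - C p.1) ^ p.2) n) = 0)
    (l := (vec K f).drop thr) (s := (thr, []))
    (by
      simp only [ev, env₁, harg, List.getElem?_cons_zero, List.getElem?_cons_succ, Option.bind_some,
        Option.map_some]
      exact edrop _)
    (by simp [ev, env₁]) (by simp; omega) ⟨⟨le_rfl, by simp; omega⟩, by simp, by simp, by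
      intro p
      simp only [List.not_mem_nil, false_iff]
      omega⟩ (by
      rintro x rem ⟨d, out⟩ ⟨⟨htd, h1⟩, h2, h3, h4⟩
      simp only [List.length_cons] at htd h1 h2 h3 h4
      refine ⟨(d + 1, ((R.filter (good d)).map fun b => (b, d)).reverse ++ out),
        ⟨⟨by simp only; omega, by simp only; omega⟩, ?_, ?_, ?_⟩, ?_⟩
      · refine List.Nodup.append (List.nodup_reverse.2 ?_) h2 ?_
        · exact (hnodup.filter _).map fun b b' h => (Prod.mk.inj h).1
        · intro p hp hp'
          simp only [List.mem_reverse, List.mem_map] at hp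
          obtain ⟨b, _, rfl⟩ := hp
          exact absurd ((h4 _).1 hp').1.2 (lt_irrefl _)
      · refine List.pairwise_append.2 ⟨?_, h3, ?_⟩
        · refine List.pairwise_of_forall_mem_list ?_
          intro p hp q hq
          simp only [List.mem_reverse, List.mem_map] at hp hq
          obtain ⟨b, _, rfl⟩ := hp
          obtain ⟨b', _, rfl⟩ := hq
          exact le_rfl
        · intro p hp q hq
          simp only [List.mem_reverse, List.mem_map] at hp
          obtain ⟨b, _, rfl⟩ := hp
          exact ((h4 q).1 hq).1.2.le
      · rintro ⟨b, k⟩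
        simp only [List.mem_append, List.mem_reverse, List.mem_map, h4, List.mem_filter, good,
          decide_eq_true_eq, Prod.mk.injEq]
        constructor
        · rintro (⟨b', ⟨h5, h6⟩, rfl, rfl⟩ | ⟨h5, h6⟩)
          · exact ⟨⟨htd, by omega⟩, h5, h6⟩
          · exact ⟨⟨h5.1, by omega⟩, h6⟩
        · rintro ⟨⟨h5, h6⟩, h7, h8⟩
          rcases Nat.lt_succ_iff_lt_or_eq.1 h6 with h9 | rfl
          · exact Or.inr ⟨⟨h5, h9⟩, h7, h8⟩
          · exact Or.inl ⟨b, ⟨h7, h8⟩, rfl, rfl⟩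
      · intro st
        obtain ⟨out', hout, e⟩ := ev_foldP (ρ := ρ) (D := D) (S := S)
          (env := .elt x :: .cons (.ofNat d) (encL (encCand K) out) :: st :: env₁) Val.elt
          (lp := .var 5) (ip := .snd (.var 1))
          (body := .letIn (.letIn (.cons (.var 0) (.cons (.fst (.var 4)) (.var 6))) powP)
                (.ifPair (.letIn (.cons (.fst (.snd (.var 10))) (.cons (.snd (.snd (.var 10)))
                    (.var 0))) testP)
                  (.var 2)
                  (.cons (.cons (.var 1) (.cons (.fst (.var 5)) (.var 0))) (.var 2))))
          (encL (encCand K))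
          (fun rem s => ((rem.filter (good d)).map fun b => (b, d)).reverse ++ s =
            ((R.filter (good d)).map fun b => (b, d)).reverse ++ out)
          (l := R) (s := out)
          (by simp [ev, env₁]) (by simp [ev]) hlen rfl (by
            intro b rem s hs
            have e1 := fun env => ev_powP (ρ := ρ) (D := D) (S := S) (env := env) b d hK hKS
              (by omega)
            have hv := degree_affinePower_lt (b, d) (K := K) (by simp only; omega)
            have e2 := fun env => ev_testP (ρ := ρ) (D := D) (S := S) (env := env) (n := n) w
              ((X - C b) ^ d) hK hv hKS (by omega)
              (by rw [length_cols_eq _ f]; omega)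
            rw [length_cols_eq _ f, ← hthr] at e2
            by_cases hb : dot w (cols ((X - C b) ^ d) n) = 0
            · refine ⟨(b, d) :: s, by simpa [good, hb] using hs, fun st => ?_⟩
              simp [ev, env₁, harg, e1, e2, hb, encCand]
            · refine ⟨s, by simpa [good, hb] using hs, fun st => ?_⟩
              simp [ev, env₁, harg, e1, e2, hb])
        simp only [List.filter_nil, List.map_nil, List.reverse_nil, List.nil_append] at hout
        simp only [ev, e, hout, List.getElem?_cons_zero, List.getElem?_cons_succ, Option.bind_some,
          Option.map_some, ofNat_succ])
  simp only [List.length_nil, add_zero] at h1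
  simp only at h2 h3 h4
  subst h1
  refine ⟨cs, h2, h3, h4, ?_⟩
  have e : ev ρ D S (arg :: env) candP = ev ρ D S env₁ (.snd (foldP
      (.letIn (.cons (.var 1) (.fst (.var 3))) dropP) (.cons (.var 1) .nil)
      (.cons (.cons .nil (.fst (.var 1)))
            (foldP (.var 5) (.snd (.var 1))
              (.letIn (.letIn (.cons (.var 0) (.cons (.fst (.var 4)) (.var 6))) powP)
                (.ifPair (.letIn (.cons (.fst (.snd (.var 10))) (.cons (.snd (.snd (.var 10)))
                    (.var 0))) testP)
                  (.var 2)
                  (.cons (.cons (.var 1) (.cons (.fst (.var 5)) (.var 0))) (.var 2)))))))) := by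
    rw [candP, ev.eq_def]
    simp only [eroots, Option.bind_some]
    rw [ev.eq_def]
    simp only [ev, harg, List.getElem?_cons_zero, List.getElem?_cons_succ, Option.bind_some, elen]
    simp only [ezeros, ezero, Option.map_some, Option.bind_some, eone]
    rfl
  rw [e, ev, h]

end Candidates

/-! ### The search for a unique combination -/

section Extraction

variable {F : Type u} [Field F]

/-- The polynomial `f` and the powers `(X - b) ^ d` with `(b, d)` in `cs`, modulo polynomials of
degree less than `j`. -/
noncomputable def topParts (f : F[X]) (j : ℕ) (cs : List (F × ℕ)) : List F[X] :=
  divX^[j] f :: (cs.map fun p => divX^[j] ((X - C p.1) ^ p.2)).reverse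

@[simp] theorem length_topParts (f : F[X]) (j : ℕ) (cs : List (F × ℕ)) :
    (topParts f j cs).length = cs.length + 1 := by simp [topParts]

theorem degree_divX_iterate_lt {K : ℕ} (j : ℕ) {p : F[X]} (hp : p.degree < K) :
    (divX^[j] p).degree < (K - j : ℕ) := by
  rw [degree_lt_iff_coeff_zero] at hp ⊢
  intro i hi
  rw [coeff_divX_iterate]
  exact hp _ (by omega)

theorem degree_lt_of_mem_topParts {K j : ℕ} {f : F[X]} {cs : List (F × ℕ)} (hf : f.degree < K)
    (hcs : ∀ p ∈ cs, p.2 < K) : ∀ v ∈ topParts f j cs, v.degree < (K - j : ℕ) := by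
  intro v hv
  simp only [topParts, List.mem_cons, List.mem_reverse, List.mem_map] at hv
  rcases hv with rfl | ⟨p, hp, rfl⟩
  · exact degree_divX_iterate_lt j hf
  · exact degree_divX_iterate_lt j (degree_affinePower_lt p (hcs p hp))

/-- The search for the first end segment of the list such that `f` is uniquely a combination of its
powers, modulo polynomials of degree less than `j`, where `j` exceeds by `1` the exponent of the
entry dropped last. The result consists of `j`, of a linear relation, and of the end segment. -/
noncomputable def extr (K : ℕ) (f : F[X]) : ℕ → List (F × ℕ) → Option (ℕ × F[X] × List (F × ℕ))
  | _, [] => none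
  | j, c :: cs => match rels (K - j) (topParts f j (c :: cs)) with
    | [w] => some (j, w, c :: cs)
    | _ => extr K f (c.2 + 1) cs

theorem extr_cons_of_eq {K : ℕ} {f : F[X]} {j : ℕ} {c : F × ℕ} {cs : List (F × ℕ)} {w : F[X]}
    (h : rels (K - j) (topParts f j (c :: cs)) = [w]) :
    extr K f j (c :: cs) = some (j, w, c :: cs) := by
  rw [extr, h]

theorem extr_cons_of_length_ne {K : ℕ} {f : F[X]} {j : ℕ} {c : F × ℕ} {cs : List (F × ℕ)}
    (h : (rels (K - j) (topParts f j (c :: cs))).length ≠ 1) :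
    extr K f j (c :: cs) = extr K f (c.2 + 1) cs := by
  rw [extr]
  split
  · rename_i w hw
    simp [hw] at h
  · rfl

/-- The encoding of the result of `extr`. -/
noncomputable def encExtr (K : ℕ) : Option (ℕ × F[X] × List (F × ℕ)) → Val F
  | none => .nil
  | some r => .cons (vecV (r.2.2.length + 2) r.2.1) (encL (encCand K) r.2.2)

variable {ρ : F[X] → List F} {D S : ℕ} {env : List (Val F)}

/-- The search by the program. The predicate `G` holds in every state of the search; it bounds the data
and ensures that there is always a relation, so that a relation is unique as soon as the list of
relations has no second entry. -/
theorem ev_extrP {K : ℕ} {f : F[X]} (hf : f.degree < K) (G : ℕ → List (F × ℕ) → Prop)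
    (hG : ∀ j c cs, G j (c :: cs) → j ≤ K ∧ (∀ p ∈ c :: cs, p.2 < K) ∧
      rels (K - j) (topParts f j (c :: cs)) ≠ [] ∧ G (c.2 + 1) cs)
    {j₀ : ℕ} {asc : List (F × ℕ)} (h0 : G j₀ asc) (hS : K + (asc.length + 2) ≤ S) :
    ∃ u v, ev ρ D S (.cons (vecV K f) (.cons (.ofNat j₀) (encL (encCand K) asc)) :: env) extrP =
      some (.cons u (.cons v (encExtr K (extr K f j₀ asc)))) := by
  set arg : Val F := .cons (vecV K f) (.cons (.ofNat j₀) (encL (encCand K) asc)) with harg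
  obtain ⟨⟨suf, j, r⟩, hM, h⟩ := ev_foldP (ρ := ρ) (D := D) (S := S) (env := arg :: env)
    (encCand K) (lp := .snd (.snd (.var 0)))
    (ip := .cons (.snd (.snd (.var 0))) (.cons (.fst (.snd (.var 0))) .nil))
    (body := .ifPair (.snd (.snd (.var 1))) (.var 1)
      (.letIn (.letIn (.cons (.fst (.snd (.var 1))) (.fst (.var 3))) dropP)
        (.letIn (.letIn (.cons (.var 0) (.cons (.var 0)
            (foldP (.fst (.var 2)) .nil
              (.cons (.letIn (.cons (.fst (.snd (.var 5))) (.snd (.snd (.var 0)))) dropP)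
                (.var 1))))) relP)
          (.ifPair (.snd (.var 0))
            (.cons (.snd (.fst (.var 3))) (.cons (.cons .nil (.fst (.snd (.var 2)))) .nil))
            (.cons (.fst (.var 3)) (.cons (.fst (.snd (.var 3)))
              (.cons (.fst (.var 0)) (.fst (.var 3)))))))))
    (fun s : List (F × ℕ) × ℕ × Option F[X] => .cons (encL (encCand K) s.1)
      (.cons (.ofNat s.2.1) (encExtr K (s.2.2.map fun w => (s.2.1, w, s.1)))))
    (fun rem s => rem.length ≤ asc.length ∧ match s.2.2 with
      | none => s.1 = rem ∧ G s.2.1 rem ∧ extr K f s.2.1 rem = extr K f j₀ asc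
      | some w => extr K f j₀ asc = some (s.2.1, w, s.1))
    (l := asc) (s := (asc, j₀, none)) (by simp [ev, harg]) (by simp [ev, harg, encExtr])
    (by omega) ⟨le_rfl, rfl, h0, rfl⟩ (by
      rintro c rem ⟨suf, j, r⟩ ⟨hlen, hM⟩
      simp only [List.length_cons] at hlen
      cases r with
      | some w => exact ⟨(suf, j, some w), ⟨by omega, hM⟩, fun st => by simp [ev, encExtr]⟩
      | none =>
        obtain ⟨h1, h2, h3⟩ := hM
        simp only at h1 h2 h3
        subst h1
        obtain ⟨hj, hK, hne, hG'⟩ := hG _ _ _ h2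
        have e1 := fun env => ev_dropP (ρ := ρ) (D := D) (S := S) (env := env) Val.elt j (vec K f)
          (by simpa using hj) (by omega)
        rw [vec_drop] at e1
        change ∀ env, ev ρ D S (.cons (.ofNat j) (vecV K f) :: env) dropP =
          some (vecV (K - j) (divX^[j] f)) at e1
        have e3 := fun env => ev_relP (ρ := ρ) (D := D) (S := S) (env := env) Val.elt
          (vec (K - j) (divX^[j] f)) (topParts f j (c :: rem))
          (by rw [length_vec]; exact degree_lt_of_mem_topParts hf hK)
          (by rw [length_vec, length_topParts, List.length_cons]; omega)
        rw [length_vec] at e3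
        change ∀ env, ev ρ D S (.cons (vecV (K - j) (divX^[j] f)) _ :: env) relP = _ at e3
        rw [length_topParts] at e3
        have e2 : ∀ st, ev ρ D S (vecV (K - j) (divX^[j] f) :: encCand K c ::
            .cons (encL (encCand K) (c :: rem)) (.cons (.ofNat j) .nil) :: st :: arg :: env)
            (foldP (.fst (.var 2)) .nil
              (.cons (.letIn (.cons (.fst (.snd (.var 5))) (.snd (.snd (.var 0)))) dropP)
                (.var 1))) = some (encL (vecV (K - j)) ((c :: rem).map
                  fun p => divX^[j] ((X - C p.1) ^ p.2)).reverse) := by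
          intro st
          obtain ⟨acc, hacc, e⟩ := ev_foldP (ρ := ρ) (D := D) (S := S)
            (env := vecV (K - j) (divX^[j] f) :: encCand K c ::
              .cons (encL (encCand K) (c :: rem)) (.cons (.ofNat j) .nil) :: st :: arg :: env)
            (encCand K) (lp := .fst (.var 2)) (ip := .nil)
            (body := .cons (.letIn (.cons (.fst (.snd (.var 5))) (.snd (.snd (.var 0)))) dropP)
                (.var 1)) (encL (vecV (K - j)))
            (fun rem' s => (rem'.map fun p => divX^[j] ((X - C p.1) ^ p.2)).reverse ++ s =
              ((c :: rem).map fun p => divX^[j] ((X - C p.1) ^ p.2)).reverse)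
            (l := c :: rem) (s := []) (by simp [ev]) (by simp [ev])
            (by rw [List.length_cons]; omega) (by simp) (by
              intro p rem' s hs
              refine ⟨divX^[j] ((X - C p.1) ^ p.2) :: s, by simpa using hs, fun st => ?_⟩
              have e := fun env => ev_dropP (ρ := ρ) (D := D) (S := S) (env := env) Val.elt j
                (vec K ((X - C p.1) ^ p.2)) (by simpa using hj) (by omega)
              rw [vec_drop] at e
              change ∀ env, ev ρ D S (.cons (.ofNat j) (vecV K _) :: env) dropP =
                some (vecV (K - j) _) at e
              simp [ev, encCand, e])
          rw [e, ← hacc]; rfl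
        simp only [harg] at e2
        rcases hr : rels (K - j) (topParts f j (c :: rem)) with _ | ⟨w, _ | ⟨w', ws⟩⟩
        · exact absurd hr hne
        · refine ⟨(c :: rem, j, some w), ⟨by omega, ?_⟩, fun st => ?_⟩
          · rw [← h3]; exact extr_cons_of_eq hr
          · rw [hr, topParts, encL_cons] at e3
            simp only [Option.map_none, encExtr, Option.map_some]
            simp only [ev, harg, List.getElem?_cons_zero, List.getElem?_cons_succ, Option.bind_some,
              Option.map_some, e1, e2, e3]
            simp
        · refine ⟨(rem, c.2 + 1, none), ⟨by omega, rfl, hG', ?_⟩, fun st => ?_⟩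
          · rw [← h3]; exact (extr_cons_of_length_ne (by rw [hr]; simp)).symm
          · rw [hr, topParts, encL_cons] at e3
            simp only [Option.map_none, encExtr]
            simp only [ev, harg, List.getElem?_cons_zero, List.getElem?_cons_succ, Option.bind_some,
              Option.map_some, e1, e2, e3]
            simp [encCand])
  have : r.map (fun w => (j, w, suf)) = extr K f j₀ asc := by
    cases r with
    | none =>
      obtain ⟨_, h1, _, h2⟩ := hM
      simp only at h1 h2
      rw [← h2]; rfl
    | some w => exact hM.2.symm
  simp only [this] at h
  exact ⟨_, _, h⟩

end Extraction

/-! ### The program that removes a combination -/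

section Update

variable {F : Type u} [Field F] {ρ : F[X] → List F} {D S : ℕ} {env : List (Val F)}

theorem polyOfList_cons (c : F) (l : List F) :
    polyOfList (c :: l) = C c + X * polyOfList l := rfl

theorem divX_C_add_X_mul (c : F) (p : F[X]) : (C c + X * p).divX = p := by
  ext k; simp [coeff_divX]

open Classical in
/-- The removal of a combination whose coefficients `β` are given by a relation `w`, up to a factor `γ`:
the coefficient of the polynomial itself in `w` is `γ`, those of the powers are `-γ * β`. -/
theorem ev_updP {K : ℕ} (f w : F[X]) (β : F × ℕ → F) (γ : F) (cs : List (F × ℕ))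
    (out : List (F × F × ℕ)) (hγ : γ ≠ 0)
    (hw : w = C γ * (1 - X * polyOfList (cs.reverse.map β))) (hKS : K ≤ S) (hcs : cs.length ≤ S) :
    ev ρ D S (.cons (.cons (vecV K f) (encL Val.ofTriple out))
        (.cons (vecV (cs.length + 2) w) (encL (encCand K) cs)) :: env) updP =
      some (.cons (vecV K (f - (cs.map fun p => C (β p) * (X - C p.1) ^ p.2).sum))
        (encL Val.ofTriple
          (((cs.filter fun p => decide (β p ≠ 0)).map fun p => (β p, p.1, p.2)) ++ out))) := by
  set arg : Val F := .cons (.cons (vecV K f) (encL Val.ofTriple out))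
        (.cons (vecV (cs.length + 2) w) (encL (encCand K) cs)) with harg
  have hw0 : w.coeff 0 = γ := by rw [hw]; simp
  have hdiv : w.divX = C (-γ) * polyOfList (cs.reverse.map β) := by
    have : w = C γ + X * (C (-γ) * polyOfList (cs.reverse.map β)) := by
      rw [hw, C_neg]; ring
    rw [this, divX_C_add_X_mul]
  obtain ⟨⟨k, w', f', out'⟩, hM, h⟩ := ev_foldP (ρ := ρ) (D := D) (S := S) (env := arg :: env)
    (encCand K) (lp := revP (.snd (.snd (.var 0))))
    (ip := .cons (.snd (.fst (.snd (.var 0)))) (.fst (.var 0)))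
    (body := .letIn (.div (.sub .zero (.fst (.fst (.var 1)))) (.fst (.fst (.snd (.var 3)))))
      (.cons (.snd (.fst (.var 2)))
        (.cons
          (.letIn (.cons (.sub .zero (.var 0)) (.cons (.fst (.snd (.var 2))) (.snd (.snd (.var 1)))))
            axpyP)
          (.ifEq (.var 0) .zero (.snd (.snd (.var 2)))
            (.cons (.cons (.var 0) (.cons (.fst (.var 1)) (.fst (.snd (.var 1)))))
              (.snd (.snd (.var 2))))))))
    (fun s : ℕ × F[X] × F[X] × List (F × F × ℕ) => .cons (vecV (s.1 + 1) s.2.1)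
      (.cons (vecV K s.2.2.1) (encL Val.ofTriple s.2.2.2)))
    (fun rem s => s.1 = rem.length ∧ s.2.1 = C (-γ) * polyOfList (rem.map β) ∧
      s.2.2.1 - (rem.map fun p => C (β p) * (X - C p.1) ^ p.2).sum =
        f - (cs.map fun p => C (β p) * (X - C p.1) ^ p.2).sum ∧
      ((rem.reverse.filter fun p => decide (β p ≠ 0)).map fun p => (β p, p.1, p.2)) ++ s.2.2.2 =
        ((cs.filter fun p => decide (β p ≠ 0)).map fun p => (β p, p.1, p.2)) ++ out)
    (l := cs.reverse) (s := (cs.length, w.divX, f, out))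
    (ev_revP _ (by simp [ev, harg]) hcs) (by simp [ev, harg, vecV_succ (cs.length + 1)])
    (by simpa using hcs) ⟨by simp, hdiv, by simp [List.sum_reverse], by simp⟩ (by
      rintro p rem ⟨k, w', f', out'⟩ ⟨h1, h2, h3, h4⟩
      simp only [List.length_cons] at h1 h2 h3 h4
      subst h1
      have h5 : w' = C (-γ * β p) + X * (C (-γ) * polyOfList (rem.map β)) := by
        rw [h2, List.map_cons, polyOfList_cons, C_mul]; ring
      have h6 : w'.coeff 0 = -γ * β p := by rw [h5]; simp
      have h7 : w'.divX = C (-γ) * polyOfList (rem.map β) := by rw [h5, divX_C_add_X_mul]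
      have h8 : (0 - -γ * β p) / γ = β p := by field_simp; ring
      have e := fun env => ev_axpyP (ρ := ρ) (D := D) (S := S) (env := env) K (0 - β p) f'
        ((X - C p.1) ^ p.2) hKS
      refine ⟨(rem.length, w'.divX, f' + C (0 - β p) * (X - C p.1) ^ p.2,
        if β p = 0 then out' else (β p, p.1, p.2) :: out'), ⟨rfl, h7, ?_, ?_⟩, fun st => ?_⟩
      · rw [← h3, List.map_cons, List.sum_cons, zero_sub, C_neg]; ring
      · rw [← h4]
        by_cases hb : β p = 0 <;> simp [hb, List.filter_append]
      · simp only [ev, harg, List.getElem?_cons_zero, List.getElem?_cons_succ, Option.bind_some,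
          Option.map_some, vecV_succ (rem.length + 1), vecV_succ (cs.length + 1), hw0, h6,
          if_neg hγ, h8, encCand, e]
        by_cases hb : β p = 0
        · simp [hb]
        · simp [hb, Val.ofTriple])
  obtain ⟨_, _, h3, h4⟩ := hM
  simp only [List.map_nil, List.sum_nil, sub_zero, List.reverse_nil, List.filter_nil,
    List.nil_append] at h3 h4
  simp only [updP, ev, h]
  rw [h3, h4]

end Update

/-! ### Differential equations as linear relations -/

section Equations

variable {F : Type u} [Field F]

theorem dot_append (w : F[X]) (l l' : List F[X]) :
    dot w (l ++ l') = dot w l + dot (divX^[l.length] w) l' := by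
  induction l generalizing w with
  | nil => simp
  | cons v l ih => simp [dot_cons, ih, add_assoc]

theorem polyOfList_vec_eq_sum (k : ℕ) (w : F[X]) :
    polyOfList (vec k w) = ∑ i ∈ Finset.range k, C (w.coeff i) * X ^ i := by
  ext i
  rw [polyOfList_vec, finsetSum_coeff]
  simp [coeff_C_mul, coeff_X_pow]

theorem natDegree_polyOfList_vec_le (k : ℕ) (w : F[X]) :
    (polyOfList (vec (k + 1) w)).natDegree ≤ k := by
  rw [natDegree_le_iff_coeff_eq_zero]
  intro i hi
  rw [polyOfList_vec, if_neg (by omega)]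

theorem dot_map_X_pow_mul (w p : F[X]) (k : ℕ) :
    dot w ((List.range k).map fun i => X ^ i * p) = polyOfList (vec k w) * p := by
  rw [polyOfList_vec_eq_sum, Finset.sum_mul, dot, List.length_map, List.length_range]
  refine Finset.sum_congr rfl fun i hi => ?_
  rw [Finset.mem_range] at hi
  simp [hi, mul_assoc]

/-- The coefficients of the differential equation of order less than `n` that corresponds to a
linear relation `w` between the entries of `cols g n`. -/
noncomputable def eqn (w : F[X]) : ℕ → ℕ → F[X]
  | 0 => 0
  | n + 1 => Function.update (eqn (divX^[n + 1] w) n) n (polyOfList (vec (n + 1) w))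

theorem eqn_succ_self (w : F[X]) (n : ℕ) : eqn w (n + 1) n = polyOfList (vec (n + 1) w) := by
  simp [eqn]

theorem eqn_succ_of_lt (w : F[X]) {n i : ℕ} (h : i < n) :
    eqn w (n + 1) i = eqn (divX^[n + 1] w) n i := by
  simp [eqn, h.ne]

/-- A linear relation between the `X ^ k * g⁽ⁱ⁾` is a differential equation for `g`. -/
theorem dot_cols (w g : F[X]) (n : ℕ) :
    dot w (cols g n) = ∑ i ∈ Finset.range n, eqn w n i * derivative^[i] g := by
  induction n generalizing w with
  | zero => simp [cols]
  | succ n ih =>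
    rw [cols, dot_append, dot_map_X_pow_mul, List.length_map, List.length_range, ih,
      Finset.sum_range_succ, eqn_succ_self, add_comm]
    congr 1
    exact Finset.sum_congr rfl fun i hi => by rw [eqn_succ_of_lt _ (Finset.mem_range.1 hi)]

theorem natDegree_eqn_le (w : F[X]) {n i : ℕ} (h : i < n) : (eqn w n i).natDegree ≤ i := by
  induction n generalizing w with
  | zero => omega
  | succ n ih =>
    rcases Nat.lt_succ_iff_lt_or_eq.1 h with h | rfl
    · rw [eqn_succ_of_lt _ h]; exact ih _ h
    · rw [eqn_succ_self]; exact natDegree_polyOfList_vec_le _ _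

theorem length_cols_succ (g : F[X]) (n : ℕ) :
    (cols g (n + 1)).length = n + 1 + (cols g n).length := by simp [cols]

theorem degree_divX_iterate_lt_length_cols {w g : F[X]} {n : ℕ}
    (h : w.degree < (cols g (n + 1)).length) :
    (divX^[n + 1] w).degree < (cols g n).length := by
  have := degree_divX_iterate_lt (n + 1) h
  rwa [length_cols_succ, Nat.add_sub_cancel_left] at this

theorem eq_zero_of_polyOfList_vec {w : F[X]} {n : ℕ} (h1 : polyOfList (vec n w) = 0)
    (h2 : divX^[n] w = 0) : w = 0 := by
  ext i
  by_cases hi : i < n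
  · have := polyOfList_vec (k := n) (p := w) i
    rw [h1, if_pos hi] at this
    exact this.symm
  · have := coeff_divX_iterate w n (i - n)
    rw [h2, Nat.sub_add_cancel (not_lt.1 hi)] at this
    exact this.symm

theorem eq_zero_of_eqn_eq_zero {w g : F[X]} {n : ℕ} (hw : w.degree < (cols g n).length)
    (h : ∀ i < n, eqn w n i = 0) : w = 0 := by
  induction n generalizing w with
  | zero =>
    ext i
    exact coeff_eq_zero_of_degree_lt (hw.trans_le (by simp [cols]))
  | succ n ih =>
    refine eq_zero_of_polyOfList_vec (n := n + 1) ?_ (ih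
      (degree_divX_iterate_lt_length_cols hw) fun i hi => ?_)
    · rw [← eqn_succ_self]; exact h n (by omega)
    · rw [← eqn_succ_of_lt _ hi]; exact h i (by omega)

theorem eqn_zero (n i : ℕ) : eqn (0 : F[X]) n i = 0 := by
  have h0 : ∀ m, divX^[m] (0 : F[X]) = 0 := fun m => by ext; simp [coeff_divX_iterate]
  induction n with
  | zero => rfl
  | succ n ih =>
    by_cases h : i = n
    · subst h
      rw [eqn_succ_self, polyOfList_vec_eq_sum]; simp
    · rw [eqn, Function.update_of_ne h, h0, ih]

theorem exists_eqn_eq (g : F[X]) {n : ℕ} {P : ℕ → F[X]} (hP : ∀ i < n, (P i).natDegree ≤ i) :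
    ∃ w : F[X], w.degree < (cols g n).length ∧ ∀ i < n, eqn w n i = P i := by
  induction n with
  | zero => exact ⟨0, by simp [cols], by simp⟩
  | succ n ih =>
    obtain ⟨w, hw, hwP⟩ := ih fun i hi => hP i (by omega)
    have hc : ∀ i, n + 1 ≤ i → (P n).coeff i = 0 := fun i hi =>
      coeff_eq_zero_of_natDegree_lt (by have := hP n (by omega); omega)
    have hdiv : divX^[n + 1] (P n + X ^ (n + 1) * w) = w := by
      ext i
      rw [coeff_divX_iterate, coeff_add, coeff_X_pow_mul, hc _ (by omega), zero_add]
    refine ⟨P n + X ^ (n + 1) * w, ?_, ?_⟩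
    · rw [degree_lt_iff_coeff_zero] at hw ⊢
      intro i hi
      rw [length_cols_succ] at hi
      rw [coeff_add, coeff_X_pow_mul', if_pos (by omega), hc _ (by omega), hw _ (by omega), zero_add]
    · intro i hi
      rcases Nat.lt_succ_iff_lt_or_eq.1 hi with h | rfl
      · rw [eqn_succ_of_lt _ h, hdiv, hwP i h]
      · rw [eqn_succ_self]
        ext k
        rw [polyOfList_vec, coeff_add, coeff_X_pow_mul']
        split_ifs with h1 h2
        · omega
        · rw [add_zero]
        · exact (hc k (by omega)).symm

theorem satisfies_eqn_iff (w g : F[X]) (t : ℕ) :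
    Satisfies t (eqn w (t + 1)) g ↔ dot w (cols g (t + 1)) = 0 := by
  rw [dot_cols, Satisfies]

theorem isSDE_eqn {w g : F[X]} {t : ℕ} (hw : w.degree < (cols g (t + 1)).length) (h0 : w ≠ 0) :
    IsSDE t 0 (eqn w (t + 1)) := by
  refine ⟨?_, fun i hi => natDegree_eqn_le w (by omega)⟩
  by_contra! hall
  exact h0 (eq_zero_of_eqn_eq_zero hw fun i hi => hall i (by omega))

/-- An equation of order `t` gives a linear relation. -/
theorem rels_cols_ne_nil {f : F[X]} {K t : ℕ} (hf : f.degree < K) {P : ℕ → F[X]}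
    (hP : IsSDE t 0 P) (hsat : Satisfies t P f) : rels K (cols f (t + 1)) ≠ [] := by
  rw [Ne, rels_eq_nil_iff (degree_lt_of_mem_cols hf)]
  intro hall
  obtain ⟨w, hw, hwP⟩ := exists_eqn_eq f (n := t + 1) (P := P) fun i hi => hP.2 i (by omega)
  have hdot : dot w (cols f (t + 1)) = 0 := by
    rw [dot_cols, ← hsat]
    exact Finset.sum_congr rfl fun i hi => by rw [hwP i (Finset.mem_range.1 hi)]
  have h0 := hall w hw hdot
  obtain ⟨i, hi, hne⟩ := hP.1
  rw [← hwP i (by omega), h0, eqn_zero] at hne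
  exact hne rfl

/-- An equation of least order has a nonzero leading coefficient. -/
theorem polyOfList_vec_ne_zero {f w : F[X]} {K t : ℕ} (hf : f.degree < K)
    (hmin : rels K (cols f t) = []) (hw : w.degree < (cols f (t + 1)).length) (h0 : w ≠ 0)
    (hdot : dot w (cols f (t + 1)) = 0) : polyOfList (vec (t + 1) w) ≠ 0 := by
  intro hpoly
  rw [cols, dot_append, dot_map_X_pow_mul, hpoly, zero_mul, zero_add, List.length_map,
    List.length_range] at hdot
  exact h0 (eq_zero_of_polyOfList_vec hpoly ((rels_eq_nil_iff (degree_lt_of_mem_cols hf)).1 hmin _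
    (degree_divX_iterate_lt_length_cols hw) hdot))

end Equations

/-! ### Combinations of affine powers as linear relations -/

section Relations

variable {F : Type u} [Field F]

theorem dot_polyOfList {β : Type*} (c : β → F) (g : β → F[X]) (l : List β) :
    dot (polyOfList (l.map c)) (l.map g) = (l.map fun p => C (c p) * g p).sum := by
  induction l with
  | nil => simp
  | cons x l ih =>
    rw [List.map_cons, List.map_cons, dot_cons, polyOfList_cons, divX_C_add_X_mul, ih]
    simp

theorem degree_polyOfList_lt (l : List F) : (polyOfList l).degree < l.length := by
  rw [degree_lt_iff_coeff_zero]
  induction l with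
  | nil => simp [polyOfList]
  | cons c l ih =>
    intro i hi
    obtain ⟨i, rfl⟩ : ∃ k, i = k + 1 := ⟨i - 1, by simp at hi; omega⟩
    rw [polyOfList_cons, coeff_add, coeff_X_mul, coeff_C_succ, zero_add]
    exact ih i (by simpa using hi)

theorem exists_eq_polyOfList {β : Type*} {l : List β} (hl : l.Nodup) {v : F[X]}
    (hv : v.degree < l.length) : ∃ c : β → F, v = polyOfList (l.map c) := by
  classical
  induction l generalizing v with
  | nil =>
    refine ⟨fun _ => 0, ?_⟩
    ext i
    exact coeff_eq_zero_of_degree_lt (hv.trans_le (by simp))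
  | cons x l ih =>
    rw [List.nodup_cons] at hl
    obtain ⟨c, hc⟩ := ih hl.2 (v := v.divX) (by
      have := degree_divX_iterate_lt 1 hv
      simpa using this)
    refine ⟨Function.update c x (v.coeff 0), ?_⟩
    rw [List.map_cons, polyOfList_cons, Function.update_self, List.map_congr_left
      (g := c) (fun y hy => Function.update_of_ne (fun h => hl.1 (by rwa [h] at hy)) _ _), ← hc,
      add_comm, X_mul_divX_add]

theorem divX_iterate_sum_C_mul {β : Type*} (j : ℕ) (c : β → F) (g : β → F[X]) (l : List β) :
    divX^[j] (l.map fun p => C (c p) * g p).sum = (l.map fun p => C (c p) * divX^[j] (g p)).sum := by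
  induction l with
  | nil => ext; simp [coeff_divX_iterate]
  | cons x l ih =>
    rw [List.map_cons, List.map_cons, List.sum_cons, List.sum_cons, ← ih]
    ext i
    simp [coeff_divX_iterate]

theorem iterate_derivative_eq_zero_of_divX {p : F[X]} {j : ℕ} (h : divX^[j] p = 0) :
    derivative^[j] p = 0 := by
  ext i
  rw [coeff_iterate_derivative, ← coeff_divX_iterate, h]; simp

/-- The linear relation that expresses a polynomial as the combination of the powers in a list, with
coefficients `β`. -/
noncomputable def relOf (β : F × ℕ → F) (cs : List (F × ℕ)) : F[X] :=
  1 - X * polyOfList (cs.reverse.map β)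

theorem coeff_zero_relOf (β : F × ℕ → F) (cs : List (F × ℕ)) : (relOf β cs).coeff 0 = 1 := by
  simp [relOf]

theorem relOf_ne_zero (β : F × ℕ → F) (cs : List (F × ℕ)) : relOf β cs ≠ 0 := fun h => by
  have := coeff_zero_relOf β cs
  rw [h] at this
  simp at this

theorem degree_relOf_lt (β : F × ℕ → F) (cs : List (F × ℕ)) (f : F[X]) (j : ℕ) :
    (relOf β cs).degree < (topParts f j cs).length := by
  have h := degree_polyOfList_lt (cs.reverse.map β)
  rw [degree_lt_iff_coeff_zero] at h ⊢
  rw [List.length_map, List.length_reverse] at h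
  intro i hi
  rw [length_topParts] at hi
  obtain ⟨i, rfl⟩ : ∃ k, i = k + 1 := ⟨i - 1, by omega⟩
  rw [relOf, coeff_sub, coeff_X_mul, h i (by omega), ← C_1, coeff_C_succ, sub_zero]

theorem dot_relOf (β : F × ℕ → F) (cs : List (F × ℕ)) (f : F[X]) (j : ℕ) :
    dot (relOf β cs) (topParts f j cs) =
      divX^[j] (f - (cs.map fun p => C (β p) * (X - C p.1) ^ p.2).sum) := by
  have h1 : (relOf β cs).divX = C (-1) * polyOfList (cs.reverse.map β) := by
    have : relOf β cs = C 1 + X * (C (-1) * polyOfList (cs.reverse.map β)) := by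
      rw [relOf, C_neg, C_1]; ring
    rw [this, divX_C_add_X_mul]
  have h2 : divX^[j] (f - (cs.map fun p => C (β p) * (X - C p.1) ^ p.2).sum) =
      divX^[j] f - divX^[j] (cs.map fun p => C (β p) * (X - C p.1) ^ p.2).sum := by
    ext; simp [coeff_divX_iterate]
  rw [h2, divX_iterate_sum_C_mul, topParts, dot_cons, coeff_zero_relOf, h1, dot_smul,
    ← List.map_reverse, dot_polyOfList, List.map_reverse, List.sum_reverse, C_neg, C_1]
  ring

/-- If the powers in a list are independent modulo polynomials of degree less than `j`, then a
polynomial is a combination of them in at most one way. -/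
theorem eq_C_mul_relOf [CharZero F] {f : F[X]} {j : ℕ} {cs : List (F × ℕ)} (hnd : cs.Nodup)
    (hj : ∀ p ∈ cs, j ≤ p.2) (hgap : ∀ p ∈ cs, cs.length * (cs.length - 1) < 2 * (p.2 - j) + 2)
    {β : F × ℕ → F} (hβ : dot (relOf β cs) (topParts f j cs) = 0) {w : F[X]}
    (hw : w.degree < (topParts f j cs).length) (hdot : dot w (topParts f j cs) = 0) :
    ∃ c, w = C c * relOf β cs := by
  classical
  refine ⟨w.coeff 0, ?_⟩
  set v := w + C (-w.coeff 0) * relOf β cs with hv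
  have hv0 : v.coeff 0 = 0 := by rw [hv, coeff_add, coeff_C_mul, coeff_zero_relOf]; ring
  have hvdot : dot v (topParts f j cs) = 0 := by
    rw [hv, dot_add, dot_smul, hdot, hβ, mul_zero, add_zero]
  have hvdeg : v.divX.degree < cs.reverse.length := by
    have h2 : v.degree < (topParts f j cs).length := by
      rw [← mem_degreeLT] at hw ⊢
      rw [hv, ← smul_eq_C_mul]
      exact add_mem hw (Submodule.smul_mem _ _ (mem_degreeLT.2 (degree_relOf_lt β cs f j)))
    have := degree_divX_iterate_lt 1 h2
    simpa using this
  obtain ⟨c, hc⟩ := exists_eq_polyOfList (List.nodup_reverse.2 hnd) hvdeg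
  rw [topParts, dot_cons, hv0, C_0, zero_mul, zero_add, hc, ← List.map_reverse, dot_polyOfList,
    ← divX_iterate_sum_C_mul, List.map_reverse, List.sum_reverse] at hvdot
  have hder := iterate_derivative_eq_zero_of_divX hvdot
  rw [← List.sum_toFinset _ hnd] at hder
  have hcard := List.toFinset_card_of_nodup hnd
  have hc0 := eq_zero_of_iterate_derivative_eq_zero (Q := cs.toFinset)
    (fun p hp => hj p (List.mem_toFinset.1 hp))
    (fun p hp => by rw [hcard]; exact hgap p (List.mem_toFinset.1 hp)) hder
  have hzero : v.divX = 0 := by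
    rw [hc]
    have : cs.reverse.map c = cs.reverse.map fun _ => 0 :=
      List.map_congr_left fun p hp => hc0 p (by simpa using hp)
    rw [this]
    generalize cs.reverse = l
    induction l with
    | nil => rfl
    | cons x l ih => rw [List.map_cons, polyOfList_cons, ih]; simp
  have hvz : v = 0 := by
    rw [← X_mul_divX_add v, hzero, hv0]; simp
  rw [hv, C_neg] at hvz
  linear_combination hvz

end Relations

/-! ### Properties of the search -/

section Search

variable {F : Type u}

/-- The order up to which polynomials are disregarded, after the entries of the list have been
dropped. -/
def cutAfter : ℕ → List (F × ℕ) → ℕ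
  | j, [] => j
  | _, c :: cs => cutAfter (c.2 + 1) cs

theorem cutAfter_append (j : ℕ) (cs : List (F × ℕ)) (c : F × ℕ) :
    cutAfter j (cs ++ [c]) = c.2 + 1 := by
  induction cs generalizing j with
  | nil => rfl
  | cons d cs ih => exact ih _

theorem le_cutAfter {j : ℕ} {cs : List (F × ℕ)} (hs : cs.Pairwise fun p q => p.2 ≤ q.2)
    (hj : ∀ p ∈ cs, j ≤ p.2 + 1) : j ≤ cutAfter j cs := by
  induction cs generalizing j with
  | nil => exact le_rfl
  | cons c cs ih =>
    rw [List.pairwise_cons] at hs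
    exact (hj c List.mem_cons_self).trans (ih hs.2 fun p hp => by have := hs.1 p hp; omega)

variable [Field F]

/-- The search stops at a suitable end segment, at the latest. -/
theorem extr_le {K : ℕ} {f : F[X]} {j : ℕ} {pre suf : List (F × ℕ)}
    (hs : pre.Pairwise fun p q => p.2 ≤ q.2) (hj : ∀ p ∈ pre, j ≤ p.2 + 1) (hsuf : suf ≠ [])
    (hrel : (rels (K - cutAfter j pre) (topParts f (cutAfter j pre) suf)).length = 1) :
    ∃ j' w cs, extr K f j (pre ++ suf) = some (j', w, cs) ∧ j' ≤ cutAfter j pre := by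
  induction pre generalizing j with
  | nil =>
    obtain ⟨c, cs, rfl⟩ := List.exists_cons_of_ne_nil hsuf
    obtain ⟨w, hw⟩ := List.length_eq_one_iff.1 hrel
    exact ⟨j, w, c :: cs, extr_cons_of_eq hw, le_rfl⟩
  | cons c pre ih =>
    by_cases h : (rels (K - j) (topParts f j (c :: (pre ++ suf)))).length = 1
    · obtain ⟨w, hw⟩ := List.length_eq_one_iff.1 h
      exact ⟨j, w, _, extr_cons_of_eq hw, le_cutAfter hs hj⟩
    · rw [List.cons_append, extr_cons_of_length_ne h]
      rw [List.pairwise_cons] at hs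
      exact ih hs.2 (fun p hp => by have := hs.1 p hp; omega) hrel

/-- The result of the search inherits the properties that each step preserves. -/
theorem extr_spec {K : ℕ} {f : F[X]} {G : ℕ → List (F × ℕ) → Prop}
    (hG : ∀ j c cs, G j (c :: cs) → G (c.2 + 1) cs) {j : ℕ} {asc : List (F × ℕ)} (h0 : G j asc)
    {j' : ℕ} {w : F[X]} {cs : List (F × ℕ)} (h : extr K f j asc = some (j', w, cs)) :
    G j' cs ∧ rels (K - j') (topParts f j' cs) = [w] := by
  induction asc generalizing j with
  | nil => simp [extr] at h
  | cons c asc ih =>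
    by_cases hl : (rels (K - j) (topParts f j (c :: asc))).length = 1
    · obtain ⟨v, hv⟩ := List.length_eq_one_iff.1 hl
      rw [extr_cons_of_eq hv] at h
      simp only [Option.some.injEq, Prod.mk.injEq] at h
      obtain ⟨rfl, rfl, rfl⟩ := h
      exact ⟨h0, hv⟩
    · rw [extr_cons_of_length_ne hl] at h
      exact ih (hG _ _ _ h0) h

end Search

/-! ### The search on a sparse sum -/

section Pass

variable {F : Type u} {ι : Type*} {α a : ι → F} {e : ι → ℕ} {J : Finset ι}

/-- The state of the search in a pass: `cs` lists pairs by increasing exponent, and the terms of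
exponent at least `j` are among them. -/
structure Covers (a : ι → F) (e : ι → ℕ) (J : Finset ι) (K j : ℕ) (cs : List (F × ℕ)) : Prop where
  nodup : cs.Nodup
  sorted : cs.Pairwise fun p q => p.2 ≤ q.2
  lt : ∀ p ∈ cs, p.2 < K
  le : ∀ p ∈ cs, j ≤ p.2 + 1
  order_le : j ≤ K
  mem : ∀ i ∈ J, j ≤ e i → (a i, e i) ∈ cs

theorem Covers.tail {K j : ℕ} {c : F × ℕ} {cs : List (F × ℕ)} (h : Covers a e J K j (c :: cs)) :
    Covers a e J K (c.2 + 1) cs := by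
  have hs := List.pairwise_cons.1 h.sorted
  refine ⟨(List.nodup_cons.1 h.nodup).2, hs.2, fun p hp => h.lt p (List.mem_cons_of_mem _ hp),
    fun p hp => Nat.succ_le_succ (hs.1 p hp), h.lt c List.mem_cons_self, fun i hi hle => ?_⟩
  have h1 := h.le c List.mem_cons_self
  rcases List.mem_cons.1 (h.mem i hi (by omega)) with h2 | h2
  · rw [← h2] at hle; simp at hle
  · exact h2

variable [Field F]

open Classical in
theorem sumOn_sub_list_sum (α a : ι → F) (e : ι → ℕ) (J : Finset ι) {cs : List (F × ℕ)}
    (hnd : cs.Nodup) :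
    sumOn α a e J - (cs.map fun p => C (coefOn α a e J p) * (X - C p.1) ^ p.2).sum =
      sumOn α a e (J.filter fun i => (a i, e i) ∉ cs) := by
  rw [← List.sum_toFinset _ hnd, sumOn_sub_sum_coefOn]
  simp only [List.mem_toFinset]

theorem degree_sumOn_lt {K : ℕ} (he : ∀ i ∈ J, e i < K) : (sumOn α a e J).degree < K := by
  rw [← mem_degreeLT]
  refine Submodule.sum_mem _ fun i hi => ?_
  rw [← smul_eq_C_mul]
  exact Submodule.smul_mem _ _ (mem_degreeLT.2 (degree_affinePower_lt (a i, e i) (he i hi)))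

/-- The terms among the listed powers make up the sum, modulo polynomials of degree less than `j`. -/
theorem Covers.dot_relOf (α : ι → F) {K j : ℕ} {cs : List (F × ℕ)} (h : Covers a e J K j cs) :
    dot (relOf (coefOn α a e J) cs) (topParts (sumOn α a e J) j cs) = 0 := by
  classical
  rw [AffinePowers.dot_relOf, sumOn_sub_list_sum _ _ _ _ h.nodup]
  ext i
  rw [coeff_divX_iterate, coeff_zero]
  refine coeff_eq_zero_of_degree_lt ((degree_sumOn_lt (K := j) fun i hi => ?_).trans_le
    (by exact_mod_cast Nat.le_add_left j i))
  rw [Finset.mem_filter] at hi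
  by_contra hj
  exact hi.2 (h.mem i hi.1 (not_lt.1 hj))

theorem Covers.rels_ne_nil (α : ι → F) {K j : ℕ} {cs : List (F × ℕ)} (h : Covers a e J K j cs)
    (he : ∀ i ∈ J, e i < K) : rels (K - j) (topParts (sumOn α a e J) j cs) ≠ [] := by
  rw [Ne, rels_eq_nil_iff (degree_lt_of_mem_topParts (degree_sumOn_lt he) h.lt)]
  exact fun hall => relOf_ne_zero _ _ (hall _ (degree_relOf_lt _ _ _ _) (h.dot_relOf α))

/-- If the search ends, then the relation found has the coefficients of the sum, by uniqueness. -/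
theorem Covers.eq_C_mul_relOf {K j : ℕ} {cs : List (F × ℕ)} (h : Covers a e J K j cs)
    (he : ∀ i ∈ J, e i < K) {w : F[X]}
    (hw : rels (K - j) (topParts (sumOn α a e J) j cs) = [w]) :
    ∃ γ, γ ≠ 0 ∧ w = C γ * relOf (coefOn α a e J) cs := by
  obtain ⟨c, hc⟩ := eq_C_mul_of_rels_eq_singleton
    (degree_lt_of_mem_topParts (degree_sumOn_lt he) h.lt) hw
    (degree_relOf_lt (coefOn α a e J) cs _ _) (h.dot_relOf α)
  have hc0 : c ≠ 0 := by
    rintro rfl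
    rw [C_0, zero_mul] at hc
    exact relOf_ne_zero _ _ hc
  refine ⟨c⁻¹, inv_ne_zero hc0, ?_⟩
  rw [hc, ← mul_assoc, ← C_mul, inv_mul_cancel₀ hc0, C_1, one_mul]

/-- The search succeeds before `j` exceeds the degree of the polynomial. -/
theorem IsSparse.exists_extr [CharZero F] (h : IsSparse α a e J) (hJ : J.Nonempty) {K t thr : ℕ}
    (he : ∀ i ∈ J, e i < K) (ht : t + 1 ≤ 2 * J.card) (hthr : 2 * thr = (t + 1) * (t + 2) + 2)
    {cs : List (F × ℕ)} (hcov : Covers a e J K thr cs.reverse) (hlen : cs.length ≤ t)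
    (hge : ∀ p ∈ cs, thr ≤ p.2) :
    ∃ j w ds, extr K (sumOn α a e J) thr cs.reverse = some (j, w, ds) ∧
      j ≤ (sumOn α a e J).natDegree := by
  classical
  set D := (sumOn α a e J).natDegree with hD
  have hsum := threshold_add_sum_lt (h.card_bound_natDegree hJ) (Finset.card_pos.2 hJ) ht hlen
    (θ := thr) (by exact_mod_cast hthr.le)
  have hthrD : thr < D := by
    have : 0 ≤ ∑ i ∈ Finset.range (cs.length + 1), (i : ℚ) ^ 2 / 2 :=
      Finset.sum_nonneg fun i _ => by positivity
    have h2 : (thr : ℚ) < D := by linarith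
    exact_mod_cast h2
  have hsorted : cs.Pairwise fun p q => q.2 ≤ p.2 := List.pairwise_reverse.1 hcov.sorted
  obtain ⟨i, hi, hmax⟩ := exists_max_exponent e hJ
  have hDe : D ≤ e i := natDegree_sumOn_le hmax
  have hmem : (a i, e i) ∈ cs := List.mem_reverse.1 (hcov.mem i hi (by omega))
  obtain ⟨k, hk, hki⟩ := List.mem_iff_getElem.1 hmem
  have hanti : ∀ m n (hmn : m ≤ n) (hn : n < cs.length), cs[n].2 ≤ cs[m].2 := by
    intro m n hmn hn
    rcases hmn.eq_or_lt with rfl | hlt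
    · exact le_rfl
    · exact List.pairwise_iff_getElem.1 hsorted m n _ _ hlt
  let x : ℕ → ℚ := fun n => if h : n - 1 < cs.length then (cs[n - 1].2 : ℚ) else thr
  have hx1 : (D : ℚ) ≤ x 1 := by
    simp only [x]
    rw [dif_pos (by omega)]
    have h1 := hanti 0 k (by omega) hk
    rw [hki] at h1
    simp only at h1
    exact_mod_cast hDe.trans h1
  have hxl : x (cs.length + 1) = thr := by simp [x]
  obtain ⟨r, hr1, hrl, hdrop, hdeg⟩ := exists_drop x cs.length D hx1 (by rw [hxl]; exact hsum)
  obtain ⟨r, rfl⟩ : ∃ m, r = m + 1 := ⟨r - 1, by omega⟩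
  have hxr : x (r + 1) = cs[r].2 := by simp only [x]; rw [dif_pos (by omega)]; simp
  -- The entries kept, and the order below which polynomials are disregarded then.
  set suf := (cs.take (r + 1)).reverse with hsuf
  set pre := (cs.drop (r + 1)).reverse with hpre
  have hsplit : cs.reverse = pre ++ suf := by
    rw [hsuf, hpre, ← List.reverse_append, List.take_append_drop]
  have hj : (cutAfter thr pre : ℚ) ≤ x (r + 1 + 1) + 1 ∧ cutAfter thr pre ≤ D := by
    by_cases hr : r + 1 < cs.length
    · have h1 : cs.drop (r + 1) = cs[r + 1] :: cs.drop (r + 1 + 1) := List.drop_eq_getElem_cons hr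
      have h2 : x (r + 1 + 1) = cs[r + 1].2 := by simp only [x]; rw [dif_pos (by omega)]; simp
      rw [hpre, h1, List.reverse_cons, cutAfter_append, h2]
      rw [h2] at hdeg
      refine ⟨by push_cast; exact le_rfl, ?_⟩
      have : cs[r + 1].2 < D := by exact_mod_cast hdeg
      omega
    · have h1 : cs.drop (r + 1) = [] := List.drop_eq_nil_of_le (by omega)
      have h2 : x (r + 1 + 1) = thr := by simp only [x]; rw [dif_neg (by omega)]
      rw [hpre, h1, h2]
      exact ⟨by simp [cutAfter], hthrD.le⟩
  set j := cutAfter thr pre with hjdef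
  have hle : ∀ p ∈ suf, (j : ℚ) ≤ p.2 ∧ ((r + 1 : ℕ) : ℚ) ^ 2 < 2 * (p.2 - j) + 2 := by
    intro p hp
    rw [hsuf, List.mem_reverse, List.mem_take_iff_getElem] at hp
    obtain ⟨n, hn, rfl⟩ := hp
    have h1 : (cs[r].2 : ℚ) ≤ cs[n].2 := by
      exact_mod_cast hanti n r (by omega) (by omega)
    rw [hxr] at hdrop
    have h2 : (j : ℚ) < cs[r].2 + 1 := by
      have : (0 : ℚ) ≤ ((r + 1 : ℕ) : ℚ) ^ 2 / 2 := by positivity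
      linarith [hj.1]
    have h3 : j ≤ cs[r].2 := by
      have : j < cs[r].2 + 1 := by exact_mod_cast h2
      omega
    have h4 : (j : ℚ) ≤ cs[r].2 := by exact_mod_cast h3
    exact ⟨by linarith, by linarith [hj.1]⟩
  have hsuflen : suf.length = r + 1 := by rw [hsuf]; simp; omega
  have hle' : ∀ p ∈ suf, j ≤ p.2 := fun p hp => by exact_mod_cast (hle p hp).1
  have hcov' : Covers a e J K j suf := by
    have hsub : suf.Sublist cs.reverse := hsplit ▸ List.sublist_append_right pre suf
    refine ⟨hcov.nodup.sublist hsub, hcov.sorted.sublist hsub,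
      fun p hp => hcov.lt p (hsub.subset hp), fun p hp => (hle' p hp).trans (by omega), ?_, ?_⟩
    · have := he i hi; omega
    · intro i hi hji
      have h1 : thr ≤ j := by
        refine le_cutAfter ?_ ?_
        · exact hcov.sorted.sublist (hsplit ▸ List.sublist_append_left pre suf)
        · intro p hp
          have := hge p (by
            rw [hpre, List.mem_reverse] at hp; exact List.mem_of_mem_drop hp)
          omega
      have h2 := hcov.mem i hi (h1.trans hji)
      rw [hsplit, List.mem_append] at h2
      refine h2.resolve_left fun hp => ?_
      rw [hpre, List.mem_reverse, List.mem_drop_iff_getElem] at hp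
      obtain ⟨n, hn, hni⟩ := hp
      have h3 := hanti (r + 1) (r + 1 + n) (by omega) (by omega)
      have h4 : j = cs[r + 1].2 + 1 := by
        rw [hjdef, hpre, List.drop_eq_getElem_cons (show r + 1 < cs.length by omega),
          List.reverse_cons, cutAfter_append]
      have h5 : cs[r + 1 + n].2 = e i := by
        rw [show cs[r + 1 + n] = (a i, e i) by rw [← hni]]
      omega
  have hone : (rels (K - j) (topParts (sumOn α a e J) j suf)).length = 1 := by
    refine length_rels_eq_one (degree_lt_of_mem_topParts (degree_sumOn_lt he) hcov'.lt)
      (relOf_ne_zero (coefOn α a e J) suf) (degree_relOf_lt _ _ _ _) (hcov'.dot_relOf α) ?_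
    intro w hw hdot
    refine AffinePowers.eq_C_mul_relOf hcov'.nodup hle' (fun p hp => ?_) (hcov'.dot_relOf α) hw hdot
    have h1 := (hle p hp).2
    rw [← Nat.cast_sub (hle' p hp)] at h1
    have h2 : (r + 1) ^ 2 < 2 * (p.2 - j) + 2 := by exact_mod_cast h1
    rw [hsuflen]
    have h3 : (r + 1) * (r + 1 - 1) ≤ (r + 1) ^ 2 := by rw [pow_two]; gcongr; omega
    omega
  obtain ⟨j', w, ds, h1, h2⟩ := extr_le (f := sumOn α a e J) (K := K) (j := thr) (pre := pre)
    (suf := suf)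
    (hcov.sorted.sublist (hsplit ▸ List.sublist_append_left pre suf))
    (fun p hp => by
      have := hge p (by rw [hpre, List.mem_reverse] at hp; exact List.mem_of_mem_drop hp)
      omega) (by rw [← List.length_pos_iff, hsuflen]; omega) hone
  exact ⟨j', w, ds, by rw [hsplit]; exact h1, h2.trans hj.2⟩

open Classical in
theorem IsSparse.triples_eq (h : IsSparse α a e J) {cs : List (F × ℕ)} (hnd : cs.Nodup) :
    (((cs.filter fun p => decide (coefOn α a e J p ≠ 0)).map
      fun p => (coefOn α a e J p, p.1, p.2) : List (F × F × ℕ)) : Multiset (F × F × ℕ)) =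
      (J.filter fun i => (a i, e i) ∈ cs).val.map fun i => (α i, a i, e i) := by
  refine (Multiset.Nodup.ext ?_ (h.nodup_triples (Finset.filter_subset _ _))).2 ?_
  · rw [Multiset.coe_nodup]
    refine (hnd.filter _).map fun p q hpq => ?_
    simp only [Prod.mk.injEq] at hpq
    exact Prod.ext hpq.2.1 hpq.2.2
  · intro x
    simp only [Multiset.mem_coe, List.mem_map, List.mem_filter, decide_eq_true_eq,
      Multiset.mem_map, Finset.mem_val, Finset.mem_filter]
    constructor
    · rintro ⟨p, ⟨hp, hp0⟩, rfl⟩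
      obtain ⟨i, hi, rfl⟩ := h.coefOn_ne_zero.1 hp0
      exact ⟨i, ⟨hi, hp⟩, by rw [h.coefOn_eq hi]⟩
    · rintro ⟨i, ⟨hi, hp⟩, rfl⟩
      exact ⟨_, ⟨hp, by rw [h.coefOn_eq hi]; exact h.ne_zero i hi⟩, by rw [h.coefOn_eq hi]⟩

theorem length_rootList_le {ρ : F[X] → List F} (hρ : IsRootFinder ρ) {p : F[X]} (hp : p ≠ 0) :
    (ρ p).length ≤ p.natDegree := by
  classical
  have hnd := (hρ p hp).1
  have h1 : (ρ p).toFinset ⊆ p.roots.toFinset := fun x hx => by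
    rw [Multiset.mem_toFinset, mem_roots hp, ← (hρ p hp).2]
    exact List.mem_toFinset.1 hx
  rw [← List.toFinset_card_of_nodup hnd]
  exact (Finset.card_le_card h1).trans ((Multiset.toFinset_card_le _).trans (card_roots' p))

end Pass

/-! ### A pass of the program -/

section PassProgram

variable {F : Type u} [Field F] {ι : Type*} {α a : ι → F} {e : ι → ℕ} {J : Finset ι}
  {ρ : F[X] → List F} {S : ℕ} {env : List (Val F)}

/-- A pass of the program, on a sparse sum: it subtracts some of the terms, at least one unless
there is none left, and puts them in front of the list `out`. -/
theorem IsSparse.ev_passP [CharZero F] (h : IsSparse α a e J) {K s : ℕ} (hs : J.card ≤ s)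
    (he : ∀ i ∈ J, e i < K) (hK2 : 2 ≤ K) (hK : s * (2 * s + 1) + 1 ≤ K) (hS : (K + 1) ^ 2 ≤ S)
    (hρ : IsRootFinder ρ) (out : List (F × F × ℕ)) :
    ∃ (J' : Finset ι) (A : List (F × F × ℕ)), J' ⊆ J ∧ (J.Nonempty → J'.card < J.card) ∧
      (A : Multiset (F × F × ℕ)) + (J'.val.map fun i => (α i, a i, e i)) =
        (J.val.map fun i => (α i, a i, e i)) ∧
      (A.Pairwise fun p q => p.2.2 ≤ q.2.2) ∧ (∀ i ∈ J', ∀ q ∈ A, e i ≤ q.2.2) ∧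
      ev ρ (2 * s - 1) S (.cons (vecV K (sumOn α a e J)) (encL Val.ofTriple out) :: env) passP =
        some (.cons (vecV K (sumOn α a e J')) (encL Val.ofTriple (A ++ out))) := by
  classical
  set f := sumOn α a e J with hf
  set arg : Val F := .cons (vecV K f) (encL Val.ofTriple out) with harg
  have hKpos : 0 < K := by omega
  have hKS : K + (K + 1) ≤ S := by nlinarith
  have hfK : f.degree < K := degree_sumOn_lt he
  -- The differential equation.
  have hcard : J.card * (2 * J.card + 1) ≤ s * (2 * s + 1) := by gcongr
  have hcardK : 2 * J.card ≤ K := by nlinarith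
  obtain ⟨Q, hQ, hQs⟩ := exists_isSDE J α a e (t := max (2 * J.card) 1 - 1) (by omega)
  obtain ⟨n, hn, hne, hmin, emin⟩ := ev_minP (ρ := ρ) (D := 2 * s - 1) (env := arg :: env) f hKpos
    hfK hS (by omega) (rels_cols_ne_nil hfK hQ hQs)
  obtain ⟨t, rfl⟩ : ∃ t, n = t + 1 := by
    rcases n with _ | t
    · exact absurd (rels_nil K) hne
    · exact ⟨t, rfl⟩
  obtain ⟨w, ws, hw⟩ := List.exists_cons_of_ne_nil hne
  rw [hw] at emin
  obtain ⟨hw0, hwdeg, hwdot⟩ := mem_rels (degree_lt_of_mem_cols hfK)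
    (show w ∈ rels K (cols f (t + 1)) by rw [hw]; exact List.mem_cons_self)
  have hP := isSDE_eqn hwdeg hw0
  have hPf := (satisfies_eqn_iff w f t).2 hwdot
  have hPt := polyOfList_vec_ne_zero hfK (hmin t (by omega)) hwdeg hw0 hwdot
  -- The candidates.
  set thr := (cols f (t + 1)).length + 1 with hthr
  have hthr2 : 2 * thr = (t + 1) * (t + 2) + 2 := by
    have := two_mul_length_cols f (t + 1)
    rw [hthr]; linarith
  have hthrt : (t + 1) ^ 2 ≤ 2 * thr ∧ t + 1 ≤ thr := by
    constructor <;> nlinarith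
  have hthrK : thr ≤ K := by
    rcases Nat.eq_zero_or_pos J.card with h0 | h0
    · rw [h0] at hn
      have : t = 0 := by simp at hn; omega
      subst this; omega
    · have h1 : t + 1 ≤ 2 * J.card := by omega
      have h2 : (t + 1) * (t + 2) ≤ (2 * J.card) * (2 * J.card + 1) :=
        Nat.mul_le_mul h1 (by omega)
      nlinarith
  have htD : t + 1 ≤ 2 * s - 1 + 1 := by omega
  have hroots := length_rootList_le hρ hPt
  have hdegPt := natDegree_polyOfList_vec_le t w
  obtain ⟨cs, hnd, hsorted, hmem, ecand⟩ := ev_candP (ρ := ρ) (D := 2 * s - 1) (S := S)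
    (env := vecV thr w :: .cons (.ofNat (t + 1)) (encL (vecV thr) (w :: ws)) :: arg :: env)
    f w hKpos (by omega) hthrt.2 hthrK htD hPt (hρ _ hPt).1 (by omega)
  rw [← hthr] at ecand
  have hlen : cs.length ≤ t := by
    have := card_affineSolutions_le hP.1 (Q := cs.toFinset) fun p hp => by
      obtain ⟨h1, h2, h3⟩ := (hmem p).1 (List.mem_toFinset.1 hp)
      exact ⟨by have := h1.1; omega, (satisfies_eqn_iff w _ t).2 h3⟩
    rwa [List.toFinset_card_of_nodup hnd] at this
  have hcov : Covers a e J K thr cs.reverse := by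
    refine ⟨List.nodup_reverse.2 hnd, List.pairwise_reverse.2 hsorted,
      fun p hp => ((hmem p).1 (List.mem_reverse.1 hp)).1.2, fun p hp => ?_, hthrK,
      fun i hi hle => ?_⟩
    · have := ((hmem p).1 (List.mem_reverse.1 hp)).1.1
      omega
    · have hsat := h.satisfies hP hPf hi (by omega)
      refine List.mem_reverse.2 ((hmem _).2 ⟨⟨hle, he i hi⟩, ?_, (satisfies_eqn_iff w _ t).1 hsat⟩)
      rw [(hρ _ hPt).2, ← eqn_succ_self]
      exact isRoot_of_satisfies (by omega) hsat
  -- The extraction.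
  obtain ⟨u, v, eextr⟩ := ev_extrP (ρ := ρ) (D := 2 * s - 1) (S := S)
    (env := encL (encCand K) cs :: vecV thr w ::
      .cons (.ofNat (t + 1)) (encL (vecV thr) (w :: ws)) :: arg :: env) hfK (Covers a e J K)
    (fun j c ds hc => ⟨hc.order_le, hc.lt, hc.rels_ne_nil α he, hc.tail⟩) hcov
    (by rw [List.length_reverse]; omega)
  have elen := ev_lengthP (ρ := ρ) (D := 2 * s - 1) (S := S)
    (env := encL (encCand K) cs :: vecV thr w ::
      .cons (.ofNat (t + 1)) (encL (vecV thr) (w :: ws)) :: arg :: env) Val.elt (vec thr w)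
    (by rw [length_vec]; omega)
  rw [length_vec] at elen
  change ev ρ (2 * s - 1) S (vecV thr w :: _) lengthP = _ at elen
  have erev := ev_revP (ρ := ρ) (D := 2 * s - 1) (S := S)
    (env := encL (encCand K) cs :: vecV thr w ::
      .cons (.ofNat (t + 1)) (encL (vecV thr) (w :: ws)) :: arg :: env) (p := .var 0)
    (encCand K) (l := cs) (by simp [ev]) (by omega)
  rw [encL_cons] at emin ecand eextr elen erev
  have epass : ev ρ (2 * s - 1) S (arg :: env) passP =
      ev ρ (2 * s - 1) S (encExtr K (extr K f thr cs.reverse) :: encL (encCand K) cs ::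
        vecV thr w :: .cons (.ofNat (t + 1)) (.cons (vecV thr w) (encL (vecV thr) ws)) :: arg :: env)
        (.ifPair (.var 0) (.letIn (.cons (.var 4) (.var 0)) updP) (.var 4)) := by
    simp only [passP, ev, harg, List.getElem?_cons_zero, List.getElem?_cons_succ, Option.bind_some,
      Option.map_some]
    simp only [harg] at emin ecand eextr elen erev
    simp only [emin, ecand, elen, erev, eextr, Option.bind_some, Option.map_some]
  rw [epass]
  rcases hres : extr K f thr cs.reverse with _ | ⟨j, w', ds⟩
  · -- Without a result, no term is left.
    have hJ : ¬ J.Nonempty := by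
      intro hJ
      have h0 := Finset.card_pos.2 hJ
      obtain ⟨j, w', ds, h1, _⟩ := h.exists_extr hJ he (by omega) hthr2 hcov hlen
        fun p hp => ((hmem p).1 hp).1.1
      rw [← hf, hres] at h1
      exact absurd h1 (by simp)
    exact ⟨J, [], subset_rfl, fun h => absurd h hJ, by simp, by simp, by simp,
      by simp [ev, encExtr, harg, hf]⟩
  · obtain ⟨⟨hcov', hdslen⟩, hrel⟩ := extr_spec
      (G := fun j ds => Covers a e J K j ds ∧ ds.length ≤ cs.length)
      (fun _ _ _ hc => ⟨hc.1.tail, by have := hc.2; rw [List.length_cons] at this; omega⟩)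
      ⟨hcov, by simp⟩ hres
    obtain ⟨γ, hγ, hw'⟩ := hcov'.eq_C_mul_relOf he hrel
    have eupd := fun env => ev_updP (ρ := ρ) (D := 2 * s - 1) (env := env) f w'
      (coefOn α a e J) γ ds out hγ hw' (show K ≤ S by omega)
      (show ds.length ≤ S by omega)
    refine ⟨J.filter fun i => (a i, e i) ∉ ds,
      (ds.filter fun p => decide (coefOn α a e J p ≠ 0)).map fun p => (coefOn α a e J p, p.1, p.2),
      Finset.filter_subset _ _, fun hJ => ?_, ?_, ?_, ?_, ?_⟩
    · have h0 := Finset.card_pos.2 hJ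
      obtain ⟨j₁, w₁, ds₁, h1, h2⟩ := h.exists_extr hJ he (by omega) hthr2 hcov hlen
        fun p hp => ((hmem p).1 hp).1.1
      rw [← hf, hres] at h1
      simp only [Option.some.injEq, Prod.mk.injEq] at h1
      obtain ⟨rfl, rfl, rfl⟩ := h1
      obtain ⟨i, hi, hmax⟩ := exists_max_exponent e hJ
      have h3 : (a i, e i) ∈ ds := hcov'.mem i hi (h2.trans (natDegree_sumOn_le hmax))
      exact Finset.card_lt_card (Finset.filter_ssubset.2 ⟨i, hi, by simpa using h3⟩)
    · rw [h.triples_eq hcov'.nodup, ← Multiset.map_add, Finset.filter_val, Finset.filter_val,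
        Multiset.filter_add_not]
    · rw [List.pairwise_map]
      exact (hcov'.sorted.sublist List.filter_sublist)
    · intro i hi q hq
      rw [Finset.mem_filter] at hi
      obtain ⟨p, hp, rfl⟩ := List.mem_map.1 hq
      have h1 := hcov'.le p (List.mem_of_mem_filter hp)
      by_contra hlt
      exact hi.2 (hcov'.mem i hi.1 (by simp only at hlt; omega))
    · rw [← sumOn_sub_list_sum α a e J hcov'.nodup]
      simp only [encExtr, ev, List.getElem?_cons_zero, List.getElem?_cons_succ, Option.bind_some,
        Option.map_some]
      exact eupd _

end PassProgram

/-! ### The output of the program -/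

section Build

variable {F : Type u} [Field F] {ι : Type*} {α a : ι → F} {e : ι → ℕ} {J : Finset ι}
  {ρ : F[X] → List F} {S : ℕ}

theorem ofPoly_eq (f : F[X]) : Val.ofPoly f = vecV (f.natDegree + 1) f := by
  simp [Val.ofPoly, vecV, encL, vec, Function.comp_def]

/-- The program finds the terms of a sparse sum, in the order of decreasing exponents. -/
theorem IsSparse.ev_buildP [CharZero F] (h : IsSparse α a e J) {N : ℕ}
    (hN : N = (sumOn α a e J).natDegree + 1) (hS : (2 * N + 1) ^ 2 ≤ S) (hρ : IsRootFinder ρ) :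
    ∃ L : List (F × F × ℕ), (L : Multiset (F × F × ℕ)) = (J.val.map fun i => (α i, a i, e i)) ∧
      (L.Pairwise fun p q => q.2.2 ≤ p.2.2) ∧
      ev ρ (2 * J.card - 1) S [Val.ofPoly (sumOn α a e J)] buildP =
        some (encL Val.ofTriple L) := by
  set f := sumOn α a e J with hf
  set s := J.card with hs
  have hbounds : (∀ i ∈ J, e i < 2 * N) ∧ s * (2 * s + 1) + 1 ≤ 2 * N ∧ s ≤ 2 * N := by
    rcases J.eq_empty_or_nonempty with rfl | hJ
    · simp [hs]; omega
    · have h1 := h.card_bound_natDegree hJ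
      rw [← hf, ← hs] at h1
      have h2 : s * (s - 1) ≤ s * s := Nat.mul_le_mul_left _ (Nat.sub_le _ _)
      have h3 : (s + 1) ^ 3 = s * s * s + 3 * (s * s) + 3 * s + 1 := by ring
      have h4 : s * (2 * s + 1) = 2 * (s * s) + s := by ring
      refine ⟨fun i hi => ?_, by omega, by omega⟩
      have h5 := h.exponent_le_natDegree hi
      rw [← hf, ← hs] at h5
      omega
  obtain ⟨he, hK, hsK⟩ := hbounds
  have hNS : 2 * N ≤ S := by nlinarith
  have hpad : vec N f ++ vec N 0 = vec (2 * N) f := by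
    rw [vec_append (degree_le_natDegree.trans_lt (by rw [hN]; exact_mod_cast Nat.lt_succ_self _)), mul_zero, add_zero, two_mul]
  have e1 := ev_revP (ρ := ρ) (D := 2 * s - 1) (S := S) (env := [vecV N f]) (p := .var 0) Val.elt
    (l := vec N f) rfl (by rw [length_vec]; omega)
  have e2 := ev_zerosP (ρ := ρ) (D := 2 * s - 1) (S := S) (env := [vecV N f]) Val.elt (vec N f)
    (by rw [length_vec]; omega)
  rw [length_vec] at e2
  change ev ρ (2 * s - 1) S (vecV N f :: _) zerosP = _ at e2
  have e3 := ev_revAppP (ρ := ρ) (D := 2 * s - 1) (S := S) (env := [vecV N f]) Val.elt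
    (vec N f).reverse (vec N 0) (by rw [List.length_reverse, length_vec]; omega)
  rw [List.reverse_reverse, hpad] at e3
  obtain ⟨⟨f', out⟩, ⟨J', hJ', hf', hcard, hmul, hsorted, hle⟩, h'⟩ := ev_foldP_of_state (ρ := ρ)
    (D := 2 * s - 1) (S := S)
    (env := [vecV (2 * N) f, vecV N f]) Val.elt (lp := .var 0) (ip := .cons (.var 0) .nil)
    (body := .letIn (.var 1) passP)
    (fun s : F[X] × List (F × F × ℕ) => .cons (vecV (2 * N) s.1) (encL Val.ofTriple s.2))
    (fun rem s => ∃ J' ⊆ J, s.1 = sumOn α a e J' ∧ J'.card ≤ rem.length ∧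
      (s.2 : Multiset (F × F × ℕ)) + (J'.val.map fun i => (α i, a i, e i)) =
        (J.val.map fun i => (α i, a i, e i)) ∧
      (s.2.Pairwise fun p q => p.2.2 ≤ q.2.2) ∧ ∀ i ∈ J', ∀ q ∈ s.2, e i ≤ q.2.2)
    (l := vec (2 * N) f) (s := (f, [])) (by simp [ev, vecV]) (by simp [ev])
    (by simpa using hNS) ⟨J, subset_rfl, rfl, by simpa using hsK, by simp, by simp, by simp⟩ (by
      rintro x rem ⟨f', out⟩ st ⟨J', hJ', hf', hcard, hmul, hsorted, hle⟩
      simp only [List.length_cons] at hf' hcard hmul hsorted hle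
      subst hf'
      obtain ⟨J'', A, hJ'', hlt, hA, hAs, hAle, epass⟩ := (h.mono hJ').ev_passP (ρ := ρ) (S := S)
        (env := .elt x :: .cons (vecV (2 * N) (sumOn α a e J')) (encL Val.ofTriple out) :: st ::
          [vecV (2 * N) f, vecV N f])
        (Finset.card_le_card hJ') (fun i hi => he i (hJ' hi)) (by omega) hK hS hρ out
      refine ⟨(sumOn α a e J'', A ++ out), ⟨J'', hJ''.trans hJ', rfl, ?_, ?_, ?_, ?_⟩, ?_⟩
      · rcases J'.eq_empty_or_nonempty with rfl | hne
        · rw [Finset.subset_empty.1 hJ'']; simp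
        · have := hlt hne; omega
      · rw [← hmul, ← hA, ← Multiset.coe_add, add_comm (A : Multiset (F × F × ℕ)), add_assoc]
      · refine List.pairwise_append.2 ⟨hAs, hsorted, fun p hp q hq => ?_⟩
        have hp' : p ∈ J'.val.map fun i => (α i, a i, e i) := by
          rw [← hA]; exact Multiset.mem_add.2 (Or.inl hp)
        obtain ⟨i, hi, rfl⟩ := Multiset.mem_map.1 hp'
        exact hle i hi q hq
      · intro i hi q hq
        rcases List.mem_append.1 hq with hq | hq
        · exact hAle i hi q hq
        · exact hle i (hJ'' hi) q hq
      · simp only [ev, List.getElem?_cons_zero, List.getElem?_cons_succ, Option.bind_some]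
        exact epass)
  rw [List.length_nil, Nat.le_zero, Finset.card_eq_zero] at hcard
  subst hcard
  simp only [Finset.empty_val, Multiset.map_zero, add_zero] at hmul hsorted
  have hlen : out.length = s := by
    have := congrArg Multiset.card hmul
    simpa using this
  have e4 := ev_revP (ρ := ρ) (D := 2 * s - 1) (S := S) (env := [vecV (2 * N) f, vecV N f])
    (p := .snd (foldP (.var 0) (.cons (.var 0) .nil) (.letIn (.var 1) passP))) Val.ofTriple
    (l := out) (by simp only [ev, h']) (by omega)
  refine ⟨out.reverse, by rw [← hmul]; simp, List.pairwise_reverse.2 hsorted, ?_⟩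
  rw [ofPoly_eq, ← hN]
  simp only [buildP, ev, e1, e2, List.getElem?_cons_zero, Option.bind_some, Option.map_some]
  change ((ev ρ (2 * s - 1) S (.cons (encL Val.elt (vec N f).reverse) (encL Val.elt (vec N 0)) ::
    [vecV N f]) revAppP).bind fun v => _) = _
  rw [e3]
  exact e4

end Build

end AffinePowers

theorem theorem4p5 :
    ∃ (build : AffinePowers.Prog) (q : Polynomial ℕ),
      ∀ (F : Type u) [Field F] [CharZero F] (s : ℕ) (α a : Fin s → F) (e : Fin s → ℕ)
        (f : Polynomial F),
        f = AffinePowers.affineSum α a e →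
        Function.Injective a →
        (∀ i, α i ≠ 0) →
        (∀ i : ℕ, 2 ≤ i →
          ((Finset.univ.filter fun j => e j ≤ i).card : ℝ) ≤ (3 * (i : ℝ) / 4) ^ ((1 : ℝ) / 3) - 1) →
        AffinePowers.affPow f = s ∧
        AffinePowers.BuildsTo s f (Finset.univ.val.map fun i => (α i, a i, e i)) ∧
        ∀ ρ : Polynomial F → List F, AffinePowers.IsRootFinder ρ →
          ∃ (L : List (F × F × ℕ)) (n : ℕ),
            AffinePowers.Eval ρ (2 * s - 1) [AffinePowers.Val.ofPoly f] build
              (AffinePowers.Val.ofList (L.map AffinePowers.Val.ofTriple)) n ∧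
            n ≤ q.eval (f.natDegree + 1) ∧
            AffinePowers.BuildRun f L ∧
            (L : Multiset (F × F × ℕ)) = Finset.univ.val.map fun i => (α i, a i, e i) := by
  refine ⟨AffinePowers.buildP, (AffinePowers.timeBound AffinePowers.buildP).comp
    ((2 * Polynomial.X + 1) ^ 2), ?_⟩
  intro F _ _ s α a e f hf ha hα hn
  have h := AffinePowers.isSparse_of_card_le ha hα hn
  have hcard : (Finset.univ : Finset (Fin s)).card = s := Finset.card_fin s
  have hf' : f = AffinePowers.sumOn α a e Finset.univ := hf
  refine ⟨le_antisymm (Nat.sInf_le ⟨α, a, e, hf⟩)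
    (le_csInf ⟨s, α, a, e, hf⟩ ?_), ?_, fun ρ hρ => ?_⟩
  · rintro m ⟨α', a', e', hm⟩
    have := h.card_le_of_eq_affineSum (hf'.symm.trans hm)
    rwa [hcard] at this
  · rw [hf']
    exact h.buildsTo s _ hcard.le
  · obtain ⟨L, hL, hsorted, hev⟩ := h.ev_buildP (ρ := ρ) (N := f.natDegree + 1) (by rw [hf'])
      le_rfl hρ
    rw [hcard, ← hf'] at hev
    obtain ⟨n, hn, heval⟩ := AffinePowers.eval_of_ev _ _ _ hev
    refine ⟨L, n, heval, ?_, ?_, hL⟩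
    · simpa [Polynomial.eval_comp] using hn
    · rw [hf']
      exact h.buildRun s _ L hcard.le hL hsorted
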